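/- **Setting.** Let $(M_0,g_0)$ be a simply connected smooth pseudo-Riemannian spin manifold of dimension $m$ and signature $(k,l)$. Let $S\to M_0$ be its spinor bundle, associated with an irreducible real module of dimension $n$ over the Clifford algebra ($vw+wv=-2\langle v,w\rangle$), with Clifford multiplication $\rho:TM_0\to\mathrm{End}(S)$ and with the connection $\nabla$ induced by the Levi-Civita connection. A bilinear form $\beta$ on $S$ is called *suitable* if there are $\sigma,\tau\in\{\pm1\}$ with $\sigma\tau=1$ such that $\beta(t,s)=\sigma\beta(s,t)$ and $\beta(\rho(v)s,t)=\tau\beta(s,\rho(v)t)$. For a parallel non-degenerate suitable form $g_1$ on $S$, the form $g=g_0+g_1$ on $TM_0\oplus S$ is called an *extension* of $g_0$. Let $M=M(S)$ be the supermanifold $(M_0,\mathcal A)$, where $\mathcal A(U)=\Gamma(U,\bigwedge S)$. Its vector fields are the sections of $\mathrm{Der}\,\mathcal A$. A vector field $Y$ on $M_0$ defines the even vector field $\iota(Y)=\nabla_Y$, and a section $\varphi$ of $S^*$ defines the odd vector field $\iota(\varphi)$, interior multiplication by $\varphi$. The cotangent bundle $T^*M_0$ is identified with $TM_0$ by $g_0$.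 For a smooth section $s$ of $S$ put $X_s^{g}=\iota(g_1(s,\cdot))$. **The $G$-structure of an extension $g=g_0+g_1$.** Define $\pi:\vee^2S\to TM_0$ by $g_0(\pi(s_1\vee s_2),v)=g_1(\rho(v)s_1,s_2)$. In the coframe $b=(e^i,\theta_j)$ dual to a spin frame $(e_i,\theta^j)$ of $TM_0\oplus S$, let $\mathfrak g\subset\mathfrak{gl}_{m|n}(\mathbb R)$ be the linear Lie superalgebra with even part the Lie algebra $\mathfrak{spin}(k,l)$, acting on $T^*M_0\oplus S^*$, and with odd part the matrices $\begin{pmatrix}0&0\\ C&0\end{pmatrix}$, $C^{ji}=e^i(\pi(s\vee\theta^j))$, $s\in S_p$; it does not depend on the spin frame or on $p$. Let $\mathcal G$ be the sheaf of groups whose sections are the supermatrices over $\mathcal A$ which locally lie in the group generated by the exponentials of the even part of $\mathfrak g\otimes\mathcal A$. Let $\mathcal F_G(U)$ be the set of the frame fields $\iota(b)h$, where $b$ is dual to a spin frame field over $U$ and $h\in\mathcal G(U)$. An open set $U$ is *small* if $\mathcal G(U)$ acts simply transitively on $\mathcal F_G(U)$. A vector field $X$ on $M$ is a *Killing vector field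 on $(M,g)$* if for all small $U$ and all $E=(X_1,\dots,X_{m+n})\in\mathcal F_G(U)$ the tuple $L_XE=([X,X_1],\dots,[X,X_{m+n}])$ of supercommutators lies in $E\,(\mathfrak g\otimes\mathcal A(U))$. **Corollary.** Let $g=g_0+g_1$ and $g'=g_0+g_1'$ be two extensions of $g_0$ and let $s$ be a smooth section of $S$. If $X_s^{g}$ is a Killing vector field on $(M,g)$, then $X_s^{g'}$ is a Killing vector field on $(M,g')$, and so is the vector field $X_s^{g}$ itself. -/

import Mathlib

open Bundle Manifold TopologicalSpace
open scoped ContDiff Topology Nat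

namespace SpinSuper

noncomputable section

set_option linter.unusedSectionVars false

/-! ### The spinor module of a pseudo-Euclidean space, in an orthonormal basis -/

/-- The spinor module of a pseudo-Euclidean space with orthonormal basis `e₁, …, e_m`,
`⟨e_i, e_j⟩ = ε_i δ_ij`: an irreducible real module of dimension `n` over its Clifford algebra,
written in a basis. The matrix of Clifford multiplication by `e_i` is `γ i`, and
`v w + w v = -2 ⟨v, w⟩`. -/
structure SpinorModule (m n : ℕ) where
  ε : Fin m → ℝ
  ε_sign : ∀ i, ε i = 1 ∨ ε i = -1
  γ : Fin m → Matrix (Fin n) (Fin n) ℝ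
  clifford : ∀ i j, γ i * γ j + γ j * γ i = (if i = j then -2 * ε i else 0) • 1
  pos : 0 < n
  irreducible : ∀ W : Submodule ℝ (Fin n → ℝ),
    (∀ i, ∀ w ∈ W, (γ i).mulVec w ∈ W) → W = ⊥ ∨ W = ⊤

namespace SpinorModule

variable {m n : ℕ} (Δ : SpinorModule m n)

/-- `𝔰𝔬(k,l)`: the matrices `A` with `Aᵀ ε + ε A = 0`. -/
def so : Submodule ℝ (Matrix (Fin m) (Fin m) ℝ) where
  carrier := {A | A.transpose * Matrix.diagonal Δ.ε + Matrix.diagonal Δ.ε * A = 0}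
  zero_mem' := by simp
  add_mem' := by
    intro A B hA hB
    simp only [Set.mem_ofPred_eq, Matrix.transpose_add, add_mul, mul_add] at hA hB ⊢
    rw [add_add_add_comm, hA, hB, add_zero]
  smul_mem' := by
    intro c A hA
    simp only [Set.mem_ofPred_eq, Matrix.transpose_smul, Matrix.smul_mul, Matrix.mul_smul] at hA ⊢
    rw [← smul_add, hA, smul_zero]

/-- The spinor representation of `𝔰𝔬(k,l)`: `A ↦ ¼ ∑ ε_i e_i · (A e_i)`. -/
def spinRep : Matrix (Fin m) (Fin m) ℝ →ₗ[ℝ] Matrix (Fin n) (Fin n) ℝ where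
  toFun A := (1 / 4 : ℝ) • ∑ i, ∑ k, (Δ.ε i * A k i) • (Δ.γ i * Δ.γ k)
  map_add' A B := by
    simp only [Matrix.add_apply, mul_add, add_smul, Finset.sum_add_distrib, smul_add]
  map_smul' c A := by
    simp only [Matrix.smul_apply, smul_eq_mul, RingHom.id_apply, Finset.smul_sum, smul_smul]
    refine Finset.sum_congr rfl fun i _ => Finset.sum_congr rfl fun k _ => ?_
    congr 1
    ring

/-- The connected spin group, acting on `V₀ ⊕ V₁`: the group generated by the exponentials of
`𝔰𝔭𝔦𝔫(k,l) = {(A, spinRep A)}`. -/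
def spinGroup : Subgroup ((Matrix (Fin m) (Fin m) ℝ)ˣ × (Matrix (Fin n) (Fin n) ℝ)ˣ) :=
  Subgroup.closure {k | ∃ A ∈ Δ.so, (k.1 : Matrix (Fin m) (Fin m) ℝ) = NormedSpace.exp A ∧
    (k.2 : Matrix (Fin n) (Fin n) ℝ) = NormedSpace.exp (Δ.spinRep A)}

end SpinorModule

variable {m n : ℕ}
  {M : Type*} [TopologicalSpace M] [ChartedSpace (EuclideanSpace ℝ (Fin m)) M]
  [IsManifold (𝓡 m) ∞ M]
  {S : M → Type*} [TopologicalSpace (TotalSpace (EuclideanSpace ℝ (Fin n)) S)]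
  [∀ p, TopologicalSpace (S p)] [∀ p, AddCommGroup (S p)] [∀ p, Module ℝ (S p)]
  [∀ p, IsTopologicalAddGroup (S p)] [∀ p, ContinuousSMul ℝ (S p)]
  [FiberBundle (EuclideanSpace ℝ (Fin n)) S] [VectorBundle ℝ (EuclideanSpace ℝ (Fin n)) S]
  [ContMDiffVectorBundle ∞ (EuclideanSpace ℝ (Fin n)) S (𝓡 m)]

/-! ### Smooth functions, vector fields and sections over open sets

A section over an open set `W` is represented by a function on all of `M`, only its values on `W`
matter. -/

variable (m) in
/-- `h` is a smooth function on `W`. -/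
def SmoothFun (W : Opens M) (h : M → ℝ) : Prop :=
  ContMDiffOn (𝓡 m) 𝓘(ℝ, ℝ) ∞ h W

/-- `Y` is a smooth vector field on `W`. -/
def SmoothVec (W : Opens M) (Y : ∀ p : M, TangentSpace (𝓡 m) p) : Prop :=
  ContMDiffOn (𝓡 m) ((𝓡 m).prod 𝓘(ℝ, EuclideanSpace ℝ (Fin m))) ∞
    (fun p => TotalSpace.mk' (EuclideanSpace ℝ (Fin m)) p (Y p)) W

variable (m n) in
/-- `t` is a smooth section of `S` over `W`. -/
def SmoothSec (W : Opens M) (t : ∀ p : M, S p) : Prop :=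
  ContMDiffOn (𝓡 m) ((𝓡 m).prod 𝓘(ℝ, EuclideanSpace ℝ (Fin n))) ∞
    (fun p => TotalSpace.mk' (EuclideanSpace ℝ (Fin n)) p (t p)) W

/-- The derivative `(Y h)(p)` of `h` in the direction `Y p`. -/
def dirDeriv (h : M → ℝ) (p : M) (v : TangentSpace (𝓡 m) p) : ℝ :=
  mfderiv (𝓡 m) 𝓘(ℝ, ℝ) h p v

/-! ### Pseudo-Riemannian spin manifolds -/

variable (m M) in
/-- A pseudo-Riemannian metric: a smooth field of non-degenerate symmetric bilinear forms. -/
structure PseudoMetric where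
  form : ∀ p : M, LinearMap.BilinForm ℝ (TangentSpace (𝓡 m) p)
  symm : ∀ p v w, form p v w = form p w v
  nondeg : ∀ p, (form p).Nondegenerate
  smooth : ∀ (W : Opens M) (Y Z : ∀ p : M, TangentSpace (𝓡 m) p),
    SmoothVec W Y → SmoothVec W Z → SmoothFun m W fun p => form p (Y p) (Z p)

/-- The tangent spaces of the `m`-dimensional manifold `M` are finite dimensional. -/
instance (p : M) : FiniteDimensional ℝ (TangentSpace (𝓡 m) p) :=
  inferInstanceAs (FiniteDimensional ℝ (EuclideanSpace ℝ (Fin m)))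

/-- The isomorphism `T_p^* M → T_p M` given by the metric. -/
def PseudoMetric.sharp (g₀ : PseudoMetric m M) (p : M)
    (α : Module.Dual ℝ (TangentSpace (𝓡 m) p)) : TangentSpace (𝓡 m) p :=
  ((g₀.form p).toDual (g₀.nondeg p)).symm α

variable (m n S) in
/-- Frames of `V = TM ⊕ S` at `p` consisting of a basis of `T_p M` and a basis of `S_p`. -/
abbrev Frame (p : M) : Type _ :=
  Module.Basis (Fin m) ℝ (TangentSpace (𝓡 m) p) × Module.Basis (Fin n) ℝ (S p)

/-- A field of frames which is smooth on `W`. -/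
def SmoothFrame (W : Opens M) (f : ∀ p : M, Frame m n S p) : Prop :=
  (∀ i, SmoothVec W fun p => (f p).1 i) ∧ (∀ a, SmoothSec m n W fun p => (f p).2 a)

variable (S) in
/-- A spin structure on `(M, g₀)` for which `S` is the spinor bundle. It is given by the bundle of
spin frames, a reduction of the frame bundle of `TM ⊕ S` to the connected spin group. Clifford
multiplication `ρ` is given in every spin frame by the matrices of the spinor module. -/
structure SpinStructure (Δ : SpinorModule m n) (g₀ : PseudoMetric m M) where
  frames : ∀ p : M, Set (Frame m n S p)
  orthonormal : ∀ p, ∀ f ∈ frames p, ∀ i j,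
    g₀.form p (f.1 i) (f.1 j) = if i = j then Δ.ε i else 0
  torsor : ∀ p, ∀ f ∈ frames p, ∀ f' : Frame m n S p, f' ∈ frames p ↔ ∃ k ∈ Δ.spinGroup,
    (∀ j, f'.1 j = ∑ i, (k.1 : Matrix (Fin m) (Fin m) ℝ) i j • f.1 i) ∧
    (∀ b, f'.2 b = ∑ a, (k.2 : Matrix (Fin n) (Fin n) ℝ) a b • f.2 a)
  local_section : ∀ p : M, ∃ W : Opens M, p ∈ W ∧
    ∃ f : ∀ q : M, Frame m n S q, SmoothFrame W f ∧ ∀ q ∈ W, f q ∈ frames q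
  ρ : ∀ p : M, TangentSpace (𝓡 m) p →ₗ[ℝ] S p →ₗ[ℝ] S p
  ρ_frame : ∀ p, ∀ f ∈ frames p, ∀ i a, ρ p (f.1 i) (f.2 a) = ∑ b, Δ.γ i b a • f.2 b

/-- A spin frame field over `W`: a smooth section over `W` of the bundle of spin frames. -/
def SpinStructure.IsFrameField {Δ : SpinorModule m n} {g₀ : PseudoMetric m M}
    (P : SpinStructure S Δ g₀) (W : Opens M) (f : ∀ p : M, Frame m n S p) : Prop :=
  SmoothFrame W f ∧ ∀ p ∈ W, f p ∈ P.frames p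

/-- `D` is the Levi-Civita connection of `g₀` (`D Z p v` is `∇_v Z`). -/
structure IsLeviCivita (g₀ : PseudoMetric m M)
    (D : CovariantDerivative (𝓡 m) (EuclideanSpace ℝ (Fin m))
      (fun p : M => TangentSpace (𝓡 m) p)) : Prop where
  smooth : ∀ (W : Opens M) (Y Z : ∀ p : M, TangentSpace (𝓡 m) p),
    SmoothVec W Y → SmoothVec W Z → SmoothVec W fun p => D Z p (Y p)
  torsion_free : ∀ (W : Opens M) (Y Z : ∀ p : M, TangentSpace (𝓡 m) p),
    SmoothVec W Y → SmoothVec W Z →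
    ∀ p ∈ W, D Z p (Y p) - D Y p (Z p) = VectorField.mlieBracket (𝓡 m) Y Z p
  metric : ∀ (W : Opens M) (Y Z : ∀ p : M, TangentSpace (𝓡 m) p),
    SmoothVec W Y → SmoothVec W Z → ∀ p ∈ W, ∀ v : TangentSpace (𝓡 m) p,
    dirDeriv (fun q => g₀.form q (Y q) (Z q)) p v
      = g₀.form p (D Y p v) (Z p) + g₀.form p (Y p) (D Z p v)

/-- `DS` is the connection on the spinor bundle `S` induced by the Levi-Civita connection `D`:
if `D_v e_i = A e_i` in a spin frame field, `A ∈ 𝔰𝔬(k,l)`, then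
`DS_v θ_a = ¼ ∑ ε_i ρ(e_i) ρ(A e_i) θ_a`. -/
structure IsSpinConnection {Δ : SpinorModule m n} {g₀ : PseudoMetric m M}
    (P : SpinStructure S Δ g₀)
    (D : CovariantDerivative (𝓡 m) (EuclideanSpace ℝ (Fin m))
      (fun p : M => TangentSpace (𝓡 m) p))
    (DS : CovariantDerivative (𝓡 m) (EuclideanSpace ℝ (Fin n)) S) : Prop where
  smooth : ∀ (W : Opens M) (Y : ∀ p : M, TangentSpace (𝓡 m) p) (t : ∀ p : M, S p),
    SmoothVec W Y → SmoothSec m n W t → SmoothSec m n W fun p => DS t p (Y p)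
  induced : ∀ (W : Opens M) (f : ∀ p : M, Frame m n S p), P.IsFrameField W f →
    ∀ p ∈ W, ∀ (v : TangentSpace (𝓡 m) p) (a : Fin n),
      DS (fun q => (f q).2 a) p v = (1 / 4 : ℝ) • ∑ i, Δ.ε i •
        P.ρ p ((f p).1 i) (P.ρ p (D (fun q => (f q).1 i) p v) ((f p).2 a))

/-! ### Suitable forms and extensions of the metric -/

/-- A bilinear form `β` on a spinor module with Clifford multiplication `ρ` is suitable if it is
(skew-)symmetric with symmetry `σ = ±1`, Clifford multiplication is `β`-(skew-)symmetric with type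
`τ = ±1`, and `σ τ = 1`. -/
def IsSuitable {V₀ V₁ : Type*} [AddCommGroup V₀] [Module ℝ V₀] [AddCommGroup V₁] [Module ℝ V₁]
    (ρ : V₀ →ₗ[ℝ] V₁ →ₗ[ℝ] V₁) (β : LinearMap.BilinForm ℝ V₁) : Prop :=
  ∃ σ τ : ℝ, (σ = 1 ∨ σ = -1) ∧ (τ = 1 ∨ τ = -1) ∧ (∀ s t, β t s = σ * β s t) ∧
    (∀ v s t, β (ρ v s) t = τ * β s (ρ v t)) ∧ σ * τ = 1

/-- A parallel non-degenerate suitable bilinear form `g₁` on the spinor bundle. It defines the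
extension `g = g₀ + g₁` of the metric `g₀`. -/
structure SpinorForm {Δ : SpinorModule m n} {g₀ : PseudoMetric m M} (P : SpinStructure S Δ g₀)
    (DS : CovariantDerivative (𝓡 m) (EuclideanSpace ℝ (Fin n)) S) where
  form : ∀ p : M, LinearMap.BilinForm ℝ (S p)
  smooth : ∀ (W : Opens M) (t t' : ∀ p : M, S p),
    SmoothSec m n W t → SmoothSec m n W t' → SmoothFun m W fun p => form p (t p) (t' p)
  nondeg : ∀ p, (form p).Nondegenerate
  suitable : ∀ p, IsSuitable (P.ρ p) (form p)
  parallel : ∀ (W : Opens M) (t t' : ∀ p : M, S p), SmoothSec m n W t → SmoothSec m n W t' →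
    ∀ p ∈ W, ∀ v : TangentSpace (𝓡 m) p,
    dirDeriv (fun q => form q (t q) (t' q)) p v
      = form p (DS t p v) (t' p) + form p (t p) (DS t' p v)

section Poincare

variable {Δ : SpinorModule m n} {g₀ : PseudoMetric m M} {P : SpinStructure S Δ g₀}
  {DS : CovariantDerivative (𝓡 m) (EuclideanSpace ℝ (Fin n)) S}

/-- The vector `π(s₁ ∨ s₂)` defined by `g₀(π(s₁ ∨ s₂), v) = g₁(ρ(v) s₁, s₂)`. -/
def SpinorForm.bracket (g₁ : SpinorForm P DS) (p : M) (s₁ s₂ : S p) : TangentSpace (𝓡 m) p :=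
  g₀.sharp p (((g₁.form p).flip s₂) ∘ₗ ((P.ρ p).flip s₁))

/-- The odd part of the Lie superalgebra of `g₀ + g₁`: the space of the matrices
`C^{ji} = e^i(π(s ∨ θ^j))`, for a spin frame `(e_i, θ^j)` at `p` and `s ∈ S_p`. Since `g₁` is
parallel this set of matrices is the same for all spin frames at all points. -/
def SpinorForm.oddPart (g₁ : SpinorForm P DS) : Submodule ℝ (Matrix (Fin n) (Fin m) ℝ) :=
  Submodule.span ℝ {C | ∃ p, ∃ f ∈ P.frames p, ∃ s : S p,
    C = Matrix.of fun j i => f.1.coord i (g₁.bracket p s (f.2 j))}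

/-- The linear Lie superalgebra `𝔤 ⊆ 𝔤𝔩_{m|n}` of `g₀ + g₁`: the image of the Poincaré
superalgebra `𝔰𝔭𝔦𝔫(TM) + TM + S` under the representation on `V^*` induced by the coadjoint
representation, in the basis dual to a spin frame. An element `A` of `𝔰𝔭𝔦𝔫` acts on `V^*` by the
negative transposes of its matrices on `TM` and `S`. -/
def SpinorForm.lieAlg (g₁ : SpinorForm P DS) :
    Submodule ℝ (Matrix (Fin m ⊕ Fin n) (Fin m ⊕ Fin n) ℝ) where
  carrier := {x | ∃ A ∈ Δ.so, ∃ C ∈ g₁.oddPart,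
    x = Matrix.fromBlocks (-A.transpose) 0 C (-(Δ.spinRep A).transpose)}
  zero_mem' := ⟨0, zero_mem _, 0, zero_mem _, by simp⟩
  add_mem' := by
    rintro _ _ ⟨A, hA, C, hC, rfl⟩ ⟨A', hA', C', hC', rfl⟩
    refine ⟨A + A', add_mem hA hA', C + C', add_mem hC hC', ?_⟩
    simp [Matrix.fromBlocks_add, add_comm]
  smul_mem' := by
    rintro c _ ⟨A, hA, C, hC, rfl⟩
    refine ⟨c • A, Submodule.smul_mem _ _ hA, c • C, Submodule.smul_mem _ _ hC, ?_⟩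
    simp [Matrix.fromBlocks_smul]

end Poincare

/-! ### The supermanifold `M(S)`: functions -/

variable (S) in
/-- Set-theoretic sections of the exterior bundle `⋀S` over `W`. -/
abbrev RawFun (W : Opens M) : Type _ := ∀ p : W, ExteriorAlgebra ℝ (S p)

/-- Restriction of sections of `⋀S`. -/
def rawRes {V W : Opens M} (h : V ≤ W) : RawFun S W →ₐ[ℝ] RawFun S V where
  toFun f p := f ⟨p, h p.2⟩
  map_one' := rfl
  map_mul' _ _ := rfl
  map_zero' := rfl
  map_add' _ _ := rfl
  commutes' _ := rfl

variable (S) in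
/-- A function on `M`, as a section of `⋀S` over `W`. -/
def rawOfFun (W : Opens M) (h : M → ℝ) : RawFun S W := fun p => algebraMap ℝ _ (h p)

/-- A section of `S`, as a section of `⋀S` over `W`. -/
def rawOfSec (W : Opens M) (t : ∀ p : M, S p) : RawFun S W := fun p => ExteriorAlgebra.ι ℝ (t p)

variable (m n S) in
/-- The algebra generated by the smooth functions and the smooth sections of `S` over `W`. -/
def generated (W : Opens M) : Subalgebra ℝ (RawFun S W) :=
  Algebra.adjoin ℝ ({f | ∃ h, SmoothFun m W h ∧ f = rawOfFun S W h} ∪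
    {f | ∃ t, SmoothSec m n W t ∧ f = rawOfSec W t})

theorem generated_res {V W : Opens M} (h : V ≤ W) {f : RawFun S W} (hf : f ∈ generated m n S W) :
    rawRes h f ∈ generated m n S V := by
  have hle : (generated m n S W).map (rawRes h) ≤ generated m n S V := by
    rw [generated, AlgHom.map_adjoin]
    refine Algebra.adjoin_mono ?_
    rintro _ ⟨f, hf | hf, rfl⟩
    · obtain ⟨u, hu, rfl⟩ := hf
      exact Or.inl ⟨u, ContMDiffOn.mono hu h, rfl⟩
    · obtain ⟨t, ht, rfl⟩ := hf
      exact Or.inr ⟨t, ContMDiffOn.mono ht h, rfl⟩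
  exact hle ⟨f, hf, rfl⟩

variable (m n S) in
/-- The algebra `𝒜(W) = Γ(W, ⋀S)` of functions on the supermanifold `M(S)` over `W`: the smooth
sections of `⋀S`, i.e. those which locally are polynomials in smooth functions and smooth sections
of `S`. -/
def superFun (W : Opens M) : Subalgebra ℝ (RawFun S W) where
  carrier := {f | ∀ p ∈ W, ∃ V : Opens M, ∃ h : V ≤ W, p ∈ V ∧ rawRes h f ∈ generated m n S V}
  mul_mem' := by
    intro f g hf hg p hp
    obtain ⟨V, hV, hpV, hfV⟩ := hf p hp
    obtain ⟨V', hV', hpV', hgV⟩ := hg p hp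
    refine ⟨V ⊓ V', inf_le_left.trans hV, ⟨hpV, hpV'⟩, ?_⟩
    rw [map_mul]
    exact mul_mem (generated_res (inf_le_left : V ⊓ V' ≤ V) hfV)
      (generated_res (inf_le_right : V ⊓ V' ≤ V') hgV)
  add_mem' := by
    intro f g hf hg p hp
    obtain ⟨V, hV, hpV, hfV⟩ := hf p hp
    obtain ⟨V', hV', hpV', hgV⟩ := hg p hp
    refine ⟨V ⊓ V', inf_le_left.trans hV, ⟨hpV, hpV'⟩, ?_⟩
    rw [map_add]
    exact add_mem (generated_res (inf_le_left : V ⊓ V' ≤ V) hfV)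
      (generated_res (inf_le_right : V ⊓ V' ≤ V') hgV)
  algebraMap_mem' := by
    intro r p hp
    refine ⟨W, le_rfl, hp, ?_⟩
    rw [AlgHom.commutes]
    exact algebraMap_mem _ r

theorem generated_le_superFun (W : Opens M) : generated m n S W ≤ superFun m n S W :=
  fun _ hf _ hp => ⟨W, le_rfl, hp, hf⟩

variable (n S) in
/-- Smooth functions on `W ⊆ M` are functions on `M(S)`. -/
def ofFun {W : Opens M} (h : M → ℝ) (hh : SmoothFun m W h) : superFun m n S W :=
  ⟨rawOfFun S W h, generated_le_superFun W (Algebra.subset_adjoin (Or.inl ⟨h, hh, rfl⟩))⟩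

/-- Smooth sections of `S` over `W` are (odd) functions on `M(S)`. -/
def ofSec {W : Opens M} (t : ∀ p : M, S p) (ht : SmoothSec m n W t) : superFun m n S W :=
  ⟨rawOfSec W t, generated_le_superFun W (Algebra.subset_adjoin (Or.inr ⟨t, ht, rfl⟩))⟩

/-- Restriction `𝒜(W) → 𝒜(V)`. -/
def res {V W : Opens M} (h : V ≤ W) : superFun m n S W →ₐ[ℝ] superFun m n S V :=
  ((rawRes h).comp (superFun m n S W).val).codRestrict (superFun m n S V) (by
    intro f p hp
    obtain ⟨V', hV', hpV', hf⟩ := f.2 p (h hp)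
    exact ⟨V ⊓ V', inf_le_left, ⟨hp, hpV'⟩, generated_res (inf_le_right : V ⊓ V' ≤ V') hf⟩)

/-- The pointwise grade involution of sections of `⋀S`. -/
def rawInvol (W : Opens M) : RawFun S W →ₐ[ℝ] RawFun S W where
  toFun f p := CliffordAlgebra.involute (f p)
  map_one' := by ext p; exact map_one _
  map_mul' f g := by ext p; exact map_mul _ _ _
  map_zero' := by ext p; exact map_zero _
  map_add' f g := by ext p; exact map_add _ _ _
  commutes' r := by ext p; exact AlgHom.commutes _ r

theorem SmoothSec.neg {W : Opens M} {t : ∀ p : M, S p} (ht : SmoothSec m n W t) :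
    SmoothSec m n W fun p => -t p :=
  ContMDiffOn.neg_section ht

theorem generated_invol {W : Opens M} {f : RawFun S W} (hf : f ∈ generated m n S W) :
    rawInvol W f ∈ generated m n S W := by
  have hle : (generated m n S W).map (rawInvol W) ≤ generated m n S W := by
    rw [generated, AlgHom.map_adjoin]
    refine Algebra.adjoin_mono ?_
    rintro _ ⟨f, hf | hf, rfl⟩
    · obtain ⟨u, hu, rfl⟩ := hf
      refine Or.inl ⟨u, hu, ?_⟩
      ext p
      exact AlgHom.commutes _ _
    · obtain ⟨t, ht, rfl⟩ := hf
      refine Or.inr ⟨_, ht.neg, ?_⟩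
      ext p
      exact (CliffordAlgebra.involute_ι _).trans (map_neg _ _).symm
  exact hle ⟨f, hf, rfl⟩

/-- The grade involution of `𝒜(W)`: `+1` on even and `-1` on odd functions. -/
def invol (W : Opens M) : superFun m n S W →ₐ[ℝ] superFun m n S W :=
  ((rawInvol W).comp (superFun m n S W).val).codRestrict (superFun m n S W) (by
    intro f p hp
    obtain ⟨V, hV, hpV, hf⟩ := f.2 p hp
    exact ⟨V, hV, hpV, generated_invol hf⟩)

/-! ### Vector fields on `M(S)` -/

variable (m n S) in
/-- Families of `ℝ`-linear maps `𝒜(W) → 𝒜(W)`, for all open `W ⊆ U`. -/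
abbrev Endo (U : Opens M) : Type _ := ∀ W : Set.Iic U, Module.End ℝ (superFun m n S W.1)

/-- Restriction of a family to a smaller open set. -/
def Endo.restrict {V U : Opens M} (h : V ≤ U) (X : Endo m n S U) : Endo m n S V :=
  fun W => X ⟨W.1, W.2.trans h⟩

/-- The family is a morphism of sheaves. -/
def Endo.IsLocal {U : Opens M} (X : Endo m n S U) : Prop :=
  ∀ (V W : Set.Iic U) (h : V.1 ≤ W.1) (f : superFun m n S W.1), X V (res h f) = res h (X W f)

/-- The grade involution, as a family. -/
def Endo.parity (U : Opens M) : Endo m n S U := fun W => (invol W.1).toLinearMap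

/-- Multiplication by `a ∈ 𝒜(U)`, as a family. -/
def Endo.mulBy {U : Opens M} (a : superFun m n S U) : Endo m n S U :=
  fun W => LinearMap.mulLeft ℝ (res W.2 a)

/-- The even component of a family. -/
def Endo.even {U : Opens M} (X : Endo m n S U) : Endo m n S U :=
  (1 / 2 : ℝ) • (X + Endo.parity U * X * Endo.parity U)

/-- The odd component of a family. -/
def Endo.odd {U : Opens M} (X : Endo m n S U) : Endo m n S U :=
  (1 / 2 : ℝ) • (X - Endo.parity U * X * Endo.parity U)

/-- Even derivations of the sheaf of superalgebras `𝒜|_U`. -/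
def IsEvenDer {U : Opens M} (X : Endo m n S U) : Prop :=
  X.IsLocal ∧ X.even = X ∧ ∀ W f g, X W (f * g) = X W f * g + f * X W g

/-- Odd derivations of `𝒜|_U`: `X(f g) = X(f) g + (-1)^{deg f} f X(g)`. -/
def IsOddDer {U : Opens M} (X : Endo m n S U) : Prop :=
  X.IsLocal ∧ X.odd = X ∧ ∀ W f g, X W (f * g) = X W f * g + invol W.1 f * X W g

/-- Vector fields on `M(S)` over `U`: the sections of the tangent sheaf `Der 𝒜`. -/
def IsVectorField {U : Opens M} (X : Endo m n S U) : Prop :=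
  ∃ X₀ X₁, IsEvenDer X₀ ∧ IsOddDer X₁ ∧ X = X₀ + X₁

/-- The supercommutator, `[X, Y] = X Y - (-1)^{deg X deg Y} Y X` for `X`, `Y` of pure degree. -/
def superBracket {U : Opens M} (X Y : Endo m n S U) : Endo m n S U :=
  X * Y - (Y.even * X.even + Y.even * X.odd + Y.odd * X.even - Y.odd * X.odd)

/-- The right module structure of vector fields over functions,
`X · a = (-1)^{deg X deg a} a X` for `X`, `a` of pure degree. -/
def rightMul {U : Opens M} (X : Endo m n S U) (a : superFun m n S U) : Endo m n S U :=
  Endo.mulBy a * X.even + Endo.mulBy (invol U a) * X.odd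

theorem raw_leibniz {W : Type*} [AddCommGroup W] [Module ℝ W] (d : Module.Dual ℝ W)
    (x y : ExteriorAlgebra ℝ W) :
    CliffordAlgebra.contractLeft d (x * y) = CliffordAlgebra.contractLeft d x * y +
      CliffordAlgebra.involute x * CliffordAlgebra.contractLeft d y := by
  induction x using CliffordAlgebra.left_induction with
  | algebraMap r =>
    rw [CliffordAlgebra.contractLeft_algebraMap_mul, CliffordAlgebra.contractLeft_algebraMap,
      AlgHom.commutes, zero_mul, zero_add]
  | add a b ha hb => simp only [add_mul, map_add, ha, hb]; abel
  | ι_mul a v ha =>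
    rw [mul_assoc, CliffordAlgebra.contractLeft_ι_mul, CliffordAlgebra.contractLeft_ι_mul, ha,
      map_mul, CliffordAlgebra.involute_ι]
    simp only [mul_add, sub_mul, smul_mul_assoc, neg_mul, mul_assoc]
    abel

variable (m n S) in
/-- Smooth sections of `S^*` over `U`. -/
structure Covector (U : Opens M) where
  toFun : ∀ p : M, Module.Dual ℝ (S p)
  smooth : ∀ W ≤ U, ∀ t : ∀ p : M, S p, SmoothSec m n W t → SmoothFun m W fun p => toFun p (t p)

/-- Pointwise interior multiplication. -/
def rawInterior {U : Opens M} (σ : Covector m n S U) (W : Opens M) :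
    RawFun S W →ₗ[ℝ] RawFun S W where
  toFun f p := CliffordAlgebra.contractLeft (σ.toFun p) (f p)
  map_add' f g := by ext p; exact map_add _ _ _
  map_smul' c f := by
    ext p
    exact (CliffordAlgebra.contractLeft (σ.toFun p)).map_smul c (f p)

theorem generated_interior {U : Opens M} (σ : Covector m n S U) {W : Opens M} (hW : W ≤ U)
    {f : RawFun S W} (hf : f ∈ generated m n S W) : rawInterior σ W f ∈ generated m n S W := by
  induction hf using Algebra.adjoin_induction with
  | mem f hf =>
    rcases hf with ⟨u, hu, rfl⟩ | ⟨t, ht, rfl⟩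
    · have : rawInterior σ W (rawOfFun S W u) = 0 := by
        ext p
        exact CliffordAlgebra.contractLeft_algebraMap _ _ _
      rw [this]
      exact zero_mem _
    · refine Algebra.subset_adjoin (Or.inl ⟨_, σ.smooth W hW t ht, ?_⟩)
      ext p
      exact CliffordAlgebra.contractLeft_ι _ _ _
  | algebraMap r =>
    have : rawInterior σ W (algebraMap ℝ _ r) = 0 := by
      ext p
      exact CliffordAlgebra.contractLeft_algebraMap _ _ _
    rw [this]
    exact zero_mem _
  | add f g _ _ hf hg => rw [map_add]; exact add_mem hf hg
  | mul f g hfm hgm hf hg =>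
    have : rawInterior σ W (f * g)
        = rawInterior σ W f * g + rawInvol W f * rawInterior σ W g := by
      ext p
      exact raw_leibniz _ _ _
    rw [this]
    exact add_mem (mul_mem hf hgm) (mul_mem (generated_invol hfm) hg)

/-- The vector field `ι(σ)`: interior multiplication by a section `σ` of `S^*`. -/
def interior {U : Opens M} (σ : Covector m n S U) : Endo m n S U := fun W =>
  ((rawInterior σ W.1).comp (superFun m n S W.1).val.toLinearMap).codRestrict
    (Subalgebra.toSubmodule (superFun m n S W.1)) (by
      intro f p hp
      obtain ⟨V, hV, hpV, hf⟩ := f.2 p hp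
      exact ⟨V, hV, hpV, generated_interior σ (hV.trans W.2) hf⟩)

/-- `X` is the vector field `ι(Y) = ∇_Y` for a vector field `Y` on `U ⊆ M`, where `∇` is the
connection on `⋀S` induced by `DS`: the derivation which is `Y` on functions and `DS_Y` on
sections of `S`. -/
def IsNabla (DS : CovariantDerivative (𝓡 m) (EuclideanSpace ℝ (Fin n)) S) {U : Opens M}
    (Y : ∀ p : M, TangentSpace (𝓡 m) p) (X : Endo m n S U) : Prop :=
  IsEvenDer X ∧
  (∀ (W : Set.Iic U) (h : M → ℝ) (hh : SmoothFun m W.1 h),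
    (X W (ofFun n S h hh)).1 = rawOfFun S W.1 fun p => dirDeriv h p (Y p)) ∧
  (∀ (W : Set.Iic U) (t : ∀ p : M, S p) (ht : SmoothSec m n W.1 t),
    (X W (ofSec t ht)).1 = rawOfSec W.1 fun p => DS t p (Y p))

/-! ### The `G`-structure of `g₀ + g₁` and its infinitesimal automorphisms -/

variable (m n S) in
/-- Supermatrices over `𝒜(U)`. -/
abbrev SMat (U : Opens M) : Type _ := Matrix (Fin m ⊕ Fin n) (Fin m ⊕ Fin n) (superFun m n S U)

/-- Even supermatrices: even diagonal blocks, odd off-diagonal blocks. -/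
def SMat.IsEven {U : Opens M} (x : SMat m n S U) : Prop :=
  ∀ i j, invol U (x i j) = if i.isLeft = j.isLeft then x i j else -x i j

/-- The canonical embedding `𝔤𝔩_{m|n}(ℝ) ⊗ 𝒜(U) → 𝔤𝔩_{m|n}(𝒜(U))`,
`(x ⊗ a)_{ij} = (-1)^{deg i · deg a} x_{ij} a` for `a` of pure degree. -/
def tensor {U : Opens M} (x : Matrix (Fin m ⊕ Fin n) (Fin m ⊕ Fin n) ℝ) (a : superFun m n S U) :
    SMat m n S U :=
  Matrix.of fun i j => x i j • (if i.isLeft then a else invol U a)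

/-- `h = ∑ Y^N / N!`, with convergence of the entries at every point of `U` in the finite
dimensional space `⋀S_p`. -/
def IsExp {U : Opens M} (Y h : SMat m n S U) : Prop :=
  ∀ (p : U) (i j : Fin m ⊕ Fin n) (l : Module.Dual ℝ (ExteriorAlgebra ℝ (S p))),
    HasSum (fun N : ℕ => ((N ! : ℕ) : ℝ)⁻¹ * l (((Y ^ N) i j).1 p)) (l ((h i j).1 p))

/-- The right action of supermatrices on tuples of vector fields. -/
def tupleMul {U : Opens M} (E : Fin m ⊕ Fin n → Endo m n S U) (x : SMat m n S U) :
    Fin m ⊕ Fin n → Endo m n S U :=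
  fun j => ∑ i, rightMul (E i) (x i j)

/-- The Lie derivative `L_X E` of a tuple of vector fields. -/
def lieDer {U : Opens M} (X : Endo m n S U) (E : Fin m ⊕ Fin n → Endo m n S U) :
    Fin m ⊕ Fin n → Endo m n S U :=
  fun j => superBracket X (E j)

section GStructure

variable {Δ : SpinorModule m n} {g₀ : PseudoMetric m M} {P : SpinStructure S Δ g₀}
  {DS : CovariantDerivative (𝓡 m) (EuclideanSpace ℝ (Fin n)) S} (g₁ : SpinorForm P DS)

/-- `𝔤 ⊗ 𝒜(U)`. -/
def SpinorForm.lieTensor (U : Opens M) : Submodule ℝ (SMat m n S U) :=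
  Submodule.span ℝ {y | ∃ x ∈ g₁.lieAlg, ∃ a, y = tensor x a}

/-- The group `G(𝒜(U))` generated by the exponentials of the even part of `𝔤 ⊗ 𝒜(U)`. -/
def SpinorForm.expGroup (U : Opens M) : Subgroup (SMat m n S U)ˣ :=
  Subgroup.closure {u | ∃ Y ∈ g₁.lieTensor U, SMat.IsEven Y ∧ IsExp Y (u : SMat m n S U)}

/-- The sheaf of groups of the linear supergroup `G = exp 𝔤`: supermatrices over `𝒜(U)` which
locally belong to `G(𝒜(W))`. -/
def SpinorForm.groupSheaf (U : Opens M) : Set (SMat m n S U) :=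
  {h | ∀ p ∈ U, ∃ W : Opens M, ∃ hW : W ≤ U, p ∈ W ∧
    ∃ u ∈ g₁.expGroup W, (u : SMat m n S W) = h.map (res hW)}

variable (P DS) in
/-- The tuple of vector fields `ι(b) = (ι(e^i), ι(θ_j))`, where `b = (e^i, θ_j)` is the coframe
field dual to a spin frame field `f` over `U`, and `T^*M` is identified with `TM` by `g₀`. -/
def IsSpinTuple (U : Opens M) (E : Fin m ⊕ Fin n → Endo m n S U) : Prop :=
  ∃ f, P.IsFrameField U f ∧
    (∀ i, IsNabla DS (fun p => g₀.sharp p ((f p).1.coord i)) (E (Sum.inl i))) ∧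
    (∀ j, ∃ σ : Covector m n S U, (∀ p, σ.toFun p = (f p).2.coord j) ∧ E (Sum.inr j) = interior σ)

/-- The `G`-structure `ℱ_G` on `M(S)`: the frame fields `ι(b) h`, where `b` is dual to a spin
frame field over `U` and `h` is a section of the sheaf of groups of `G`. -/
def SpinorForm.gStructure (U : Opens M) : Set (Fin m ⊕ Fin n → Endo m n S U) :=
  {E | ∃ E₀, IsSpinTuple P DS U E₀ ∧ ∃ h ∈ g₁.groupSheaf U, E = tupleMul E₀ h}

/-- `U` is small: the group over `U` acts simply transitively on the frame fields of the
`G`-structure over `U`. -/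
def SpinorForm.IsSmall (U : Opens M) : Prop :=
  (g₁.gStructure U).Nonempty ∧ ∀ E ∈ g₁.gStructure U,
    (∀ h ∈ g₁.groupSheaf U, tupleMul E h ∈ g₁.gStructure U) ∧
    ∀ E' ∈ g₁.gStructure U, ∃! h, h ∈ g₁.groupSheaf U ∧ E' = tupleMul E h

/-- A Killing vector field on `(M(S), g₀ + g₁)`: a vector field which is an infinitesimal
automorphism of the `G`-structure. -/
def SpinorForm.IsKilling (X : Endo m n S (⊤ : Opens M)) : Prop :=
  IsVectorField X ∧ ∀ U : Opens M, g₁.IsSmall U → ∀ E ∈ g₁.gStructure U,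
    ∃ x ∈ g₁.lieTensor U, lieDer (X.restrict le_top) E = tupleMul E x

/-- The section `s^* = g₁(s, ·)` of `S^*`. -/
def SpinorForm.flat (s : ∀ p : M, S p) (hs : SmoothSec m n ⊤ s) : Covector m n S (⊤ : Opens M) where
  toFun p := g₁.form p (s p)
  smooth _ hW t ht := g₁.smooth _ s t (ContMDiffOn.mono hs hW) ht

/-- The odd vector field `X_s = ι(s^*)` of a spinor field `s`. -/
def SpinorForm.spinorField (s : ∀ p : M, S p) (hs : SmoothSec m n ⊤ s) :
    Endo m n S (⊤ : Opens M) :=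
  interior (g₁.flat s hs)

end GStructure

end

end SpinSuper

/-!
The vector field `X_s` of a spinor field `s` turns out to be a Killing vector field, for the extension
which defines it or for any other one, if and only if `s` is a twistor spinor (`IsTwistor`): at each
point there is a spinor `t` with `∇_v s = ρ(v) t` for all `v`. This condition does not involve the
form `g₁` at all.

Let `E₀` be the tuple of vector fields `∇_{Y_i}`, `ι(θ_j)` dual to a spin frame field. As `g₁` is
parallel, the Lie derivative `L_{X_s} E₀` is `E₀ x₀`, where `x₀` has the lower left block
`-g₁(∇_{Y_i} s, θ^j)` and no other (`SpinorForm.lieDer_spinorField`).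

* If `X_s` is Killing (`SpinorForm.IsKilling.isTwistor`), its defining property applies to `E₀`, since
  the domains of spin frame fields are small (`SpinorForm.isSmall`). The tuple `E₀` is independent
  over the functions on the supermanifold (`IsDualTuple.tupleMul_injective`), so `x₀` belongs to
  `𝔤 ⊗ 𝒜`, hence to `𝔤` at each point. The matrix of `g₁` is the same in all spin frames
  (`SpinorForm.mat_const`): it is invariant under the spin group, the form is parallel, and the
  manifold is connected. Therefore the odd elements of `𝔤` are the matrices of single spinors
  (`SpinorForm.exists_of_mem_oddPart`), and by non-degeneracy of `g₁` the spinor of `x₀` provides `t`.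
* Conversely, let `s` be a twistor spinor (`IsTwistor.isKilling`), and consider another extension with
  the form `g₁'`. Both forms being suitable, `g₁(ρ(v) t, ·)` equals `g₁'(ρ(v) t', ·)`, where `t'` is up
  to a sign the spinor with `g₁'(t', ·) = g₁(t, ·)`, so that `x₀` is in the Lie superalgebra of either
  extension (`SpinorForm.derMat_mem_lieAlg`). For a section `h` of the sheaf of groups,
  `L_{X_s} (E₀ h) = (E₀ h) (h⁻¹ D h + h⁻¹ x₀ h)` (`lieDer_tupleMul`). Both summands belong to `𝔤 ⊗ 𝒜`;
  this is a pointwise statement (`mem_glin_iff_evMat`) which reduces to exponentials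
  (`isGroupElt_exp`), where it follows from the series of `Ad (exp Y)` and of the logarithmic
  derivative (`IsWExp.conj_sub_mem`, `IsWExp.logDeriv_mem`).

Smallness of the domains of spin frame fields requires that the transition matrices between spin
frame fields are sections of the sheaf of groups, thus locally products of exponentials of
`𝔰𝔭𝔦𝔫`-valued functions (`SpinorForm.transition_mem_groupSheaf`). This uses a smooth logarithm on the
spin group near the unit (`SpinorModule.exists_log`): an element of the spin group close to the unit
is the exponential of the logarithm of its image in `SO`, because an even element of the Clifford
algebra which is central acts as a scalar (`SpinorModule.scalar_of_even`) and this scalar is fixed up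
to sign by an invariant form.

Exponentials are characterised weakly, by means of linear forms (`IsWExp`), and `𝔤 ⊗ R` is described
by the linear forms which vanish on `𝔤` (`glin`). In this way the subspaces of `𝒜`-valued matrices
need no topology.
-/

namespace SpinSuper

noncomputable section

set_option linter.unusedSectionVars false

/-! ### Supercommutative algebras and supermatrices -/

/-- `τ` is the grade involution of a supercommutative algebra. -/
structure IsSuperComm {R : Type*} [Ring R] [Algebra ℝ R] (τ : R →ₐ[ℝ] R) : Prop where
  invol : ∀ a, τ (τ a) = a
  even_comm : ∀ a b, τ a = a → a * b = b * a
  odd_comm : ∀ a b, τ a = -a → a * b = τ b * a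

section SuperMatrix

variable {m n : ℕ} {R : Type*} [Ring R] [Algebra ℝ R] (τ : R →ₐ[ℝ] R)

/-- The sign rule `a ↦ (-1)^{deg i · deg a} a` for an index `i`, which is even in the left and odd
in the right summand. -/
def twist (i : Fin m ⊕ Fin n) : R →ₐ[ℝ] R := if i.isLeft then AlgHom.id ℝ R else τ

@[simp] theorem twist_inl (i : Fin m) : twist τ (Sum.inl i : Fin m ⊕ Fin n) = AlgHom.id ℝ R := rfl

@[simp] theorem twist_inr (i : Fin n) : twist τ (Sum.inr i : Fin m ⊕ Fin n) = τ := rfl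

theorem twist_eq {i j : Fin m ⊕ Fin n} (h : i.isLeft = j.isLeft) : twist τ i = twist τ j := by
  simp only [twist, h]

theorem twist_ne (hτ : IsSuperComm τ) {i j : Fin m ⊕ Fin n} (h : i.isLeft ≠ j.isLeft) (a : R) :
    twist τ i (τ a) = twist τ j a := by
  rcases i with i | i <;> rcases j with j | j <;> simp_all [hτ.invol]

theorem twist_twist (hτ : IsSuperComm τ) (i : Fin m ⊕ Fin n) (a : R) :
    twist τ i (twist τ i a) = a := by
  cases i <;> simp [hτ.invol]

theorem twist_tau (i : Fin m ⊕ Fin n) (a : R) : twist τ i (τ a) = τ (twist τ i a) := by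
  cases i <;> simp

/-- Even supermatrices over `R`. -/
def SEven (x : Matrix (Fin m ⊕ Fin n) (Fin m ⊕ Fin n) R) : Prop :=
  ∀ i j, τ (x i j) = if i.isLeft = j.isLeft then x i j else -x i j

/-- The element `x ⊗ a` of `𝔤𝔩_{m|n}(ℝ) ⊗ R`, as a supermatrix. -/
def tens (x : Matrix (Fin m ⊕ Fin n) (Fin m ⊕ Fin n) ℝ) (a : R) :
    Matrix (Fin m ⊕ Fin n) (Fin m ⊕ Fin n) R :=
  Matrix.of fun i j => x i j • twist τ i a

theorem tens_apply (x : Matrix (Fin m ⊕ Fin n) (Fin m ⊕ Fin n) ℝ) (a : R) (i j) :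
    tens τ x a i j = x i j • twist τ i a := rfl

theorem tens_sub_left (x y : Matrix (Fin m ⊕ Fin n) (Fin m ⊕ Fin n) ℝ) (a : R) :
    tens τ (x - y) a = tens τ x a - tens τ y a := by
  ext i j; simp [tens_apply, sub_smul]

theorem tens_zero_left (a : R) :
    tens τ (0 : Matrix (Fin m ⊕ Fin n) (Fin m ⊕ Fin n) ℝ) a = 0 := by
  ext i j; simp [tens_apply]

/-- Real matrices whose off-diagonal blocks vanish. -/
def RealEven (x : Matrix (Fin m ⊕ Fin n) (Fin m ⊕ Fin n) ℝ) : Prop :=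
  ∀ i j, i.isLeft ≠ j.isLeft → x i j = 0

/-- Real matrices whose diagonal blocks vanish. -/
def RealOdd (x : Matrix (Fin m ⊕ Fin n) (Fin m ⊕ Fin n) ℝ) : Prop :=
  ∀ i j, i.isLeft = j.isLeft → x i j = 0

theorem tens_mul_of_even {x : Matrix (Fin m ⊕ Fin n) (Fin m ⊕ Fin n) ℝ} (hx : RealEven x)
    (y : Matrix (Fin m ⊕ Fin n) (Fin m ⊕ Fin n) ℝ) (a b : R) :
    tens τ x a * tens τ y b = tens τ (x * y) (a * b) := by
  ext i j
  simp only [Matrix.mul_apply, tens_apply, Finset.sum_smul]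
  refine Finset.sum_congr rfl fun k _ => ?_
  by_cases h : i.isLeft = k.isLeft
  · rw [map_mul, twist_eq τ h, smul_mul_smul_comm]
  · simp [hx i k h]

/-- For `x` odd, the entries of `x ⊗ a` which meet `b` are in the off-diagonal blocks, and moving `b`
past `x` yields its involution. -/
theorem tens_mul_of_odd (hτ : IsSuperComm τ)
    {x : Matrix (Fin m ⊕ Fin n) (Fin m ⊕ Fin n) ℝ} (hx : RealOdd x)
    (y : Matrix (Fin m ⊕ Fin n) (Fin m ⊕ Fin n) ℝ) (a b : R) :
    tens τ x a * tens τ y b = tens τ (x * y) (a * τ b) := by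
  ext i j
  simp only [Matrix.mul_apply, tens_apply, Finset.sum_smul]
  refine Finset.sum_congr rfl fun k _ => ?_
  by_cases h : i.isLeft = k.isLeft
  · simp [hx i k h]
  · rw [map_mul, twist_ne τ hτ h, smul_mul_smul_comm]

/-- The diagonal blocks of a real matrix. -/
def realDiag (x : Matrix (Fin m ⊕ Fin n) (Fin m ⊕ Fin n) ℝ) :
    Matrix (Fin m ⊕ Fin n) (Fin m ⊕ Fin n) ℝ :=
  Matrix.of fun i j => if i.isLeft = j.isLeft then x i j else 0

/-- `𝔤` is a graded Lie subalgebra of `𝔤𝔩_{m|n}(ℝ)` in which products of odd elements vanish. -/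
structure IsSuperLie (𝔤 : Submodule ℝ (Matrix (Fin m ⊕ Fin n) (Fin m ⊕ Fin n) ℝ)) : Prop where
  diag_mem : ∀ x ∈ 𝔤, realDiag x ∈ 𝔤
  bracket_mem : ∀ x ∈ 𝔤, ∀ y ∈ 𝔤, RealEven x → x * y - y * x ∈ 𝔤
  odd_mul : ∀ x ∈ 𝔤, ∀ y ∈ 𝔤, RealOdd x → RealOdd y → x * y = 0

/-- `𝔤 ⊗ R` as a space of supermatrices, cut out by the linear forms which vanish on `𝔤`. -/
def glin (𝔤 : Submodule ℝ (Matrix (Fin m ⊕ Fin n) (Fin m ⊕ Fin n) ℝ)) :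
    Submodule ℝ (Matrix (Fin m ⊕ Fin n) (Fin m ⊕ Fin n) R) where
  carrier := {y | ∀ l : Matrix (Fin m ⊕ Fin n) (Fin m ⊕ Fin n) ℝ,
    (∀ x ∈ 𝔤, ∑ i, ∑ j, l i j * x i j = 0) → ∑ i, ∑ j, l i j • twist τ i (y i j) = 0}
  zero_mem' := by intro l _; simp
  add_mem' := by
    intro y z hy hz l hl
    simp only [Matrix.add_apply, map_add, smul_add, Finset.sum_add_distrib, hy l hl, hz l hl,
      add_zero]
  smul_mem' := by
    intro c y hy l hl
    have := hy l hl
    simp only [Matrix.smul_apply, map_smul, smul_comm _ c, ← Finset.smul_sum, this, smul_zero]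

variable {𝔤 : Submodule ℝ (Matrix (Fin m ⊕ Fin n) (Fin m ⊕ Fin n) ℝ)}

theorem tens_mem_glin (hτ : IsSuperComm τ) {x : Matrix (Fin m ⊕ Fin n) (Fin m ⊕ Fin n) ℝ}
    (hx : x ∈ 𝔤) (a : R) : tens τ x a ∈ glin τ 𝔤 := by
  intro l hl
  simp only [tens_apply, map_smul, twist_twist τ hτ, smul_smul, ← Finset.sum_smul, hl x hx,
    zero_smul]

/-- The description of `𝔤 ⊗ R` by linear forms agrees with the span of the elements `x ⊗ a`: apply a
projection onto `𝔤` to the first factor. -/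
theorem glin_eq_span (hτ : IsSuperComm τ) :
    glin τ 𝔤 = Submodule.span ℝ {y | ∃ x ∈ 𝔤, ∃ a, y = tens τ x a} := by
  apply le_antisymm
  · intro y hy
    obtain ⟨K, hK⟩ := Submodule.exists_isCompl 𝔤
    -- the projection onto `𝔤` along a complement
    obtain ⟨p, hp⟩ : ∃ p : Matrix (Fin m ⊕ Fin n) (Fin m ⊕ Fin n) ℝ →ₗ[ℝ] 𝔤,
        ∀ x : 𝔤, p x = x :=
      ⟨Submodule.projectionOnto 𝔤 K hK, fun x => Submodule.projectionOnto_apply_left hK x⟩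
    have key : y = ∑ i, ∑ j, tens τ (p (Matrix.single i j 1) :
        Matrix (Fin m ⊕ Fin n) (Fin m ⊕ Fin n) ℝ) (twist τ i (y i j)) := by
      ext k l
      have h := hy (Matrix.of fun i j => (p (Matrix.single i j 1) :
        Matrix (Fin m ⊕ Fin n) (Fin m ⊕ Fin n) ℝ) k l - (Matrix.single i j 1 : Matrix _ _ ℝ) k l) (by
          intro x hx
          have h1 : ∑ i, ∑ j, x i j • p (Matrix.single i j 1) = ⟨x, hx⟩ := by
            have : (∑ i, ∑ j, x i j • Matrix.single i j (1 : ℝ)) = x := by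
              conv_rhs => rw [Matrix.matrix_eq_sum_single x]
              simp [Matrix.smul_single]
            have h2 := congrArg p this
            simp only [map_sum, map_smul] at h2
            rw [h2]; exact hp ⟨x, hx⟩
          have h3 := congrArg (fun z : 𝔤 => (z : Matrix (Fin m ⊕ Fin n) (Fin m ⊕ Fin n) ℝ) k l) h1
          simp only [AddSubmonoidClass.coe_finsetSum, Submodule.coe_smul, Matrix.sum_apply,
            Matrix.smul_apply, smul_eq_mul] at h3
          simp only [Matrix.of_apply, sub_mul, Finset.sum_sub_distrib]
          rw [sub_eq_zero]
          have h4 : ∑ i, ∑ j, (Matrix.single i j (1 : ℝ) : Matrix _ _ ℝ) k l * x i j = x k l := by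
            rw [Finset.sum_eq_single k, Finset.sum_eq_single l]
            · simp
            · intro b _ hb; simp [hb]
            · simp
            · intro b _ hb; simp [hb]
            · simp
          rw [h4, ← h3]
          exact Finset.sum_congr rfl fun i _ => Finset.sum_congr rfl fun j _ => mul_comm _ _)
      simp only [Matrix.of_apply, sub_smul, Finset.sum_sub_distrib, sub_eq_zero] at h
      have h5 : ∑ i, ∑ j, (Matrix.single i j (1 : ℝ) : Matrix _ _ ℝ) k l • twist τ i (y i j)
          = twist τ k (y k l) := by
        rw [Finset.sum_eq_single k, Finset.sum_eq_single l]
        · simp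
        · intro b _ hb; simp [hb]
        · simp
        · intro b _ hb; simp [hb]
        · simp
      rw [h5] at h
      have h6 := congrArg (twist τ k) h
      rw [twist_twist τ hτ] at h6
      simp only [map_sum, map_smul] at h6
      rw [Matrix.sum_apply, ← h6]
      refine Finset.sum_congr rfl fun i _ => ?_
      rw [Matrix.sum_apply]
      rfl
    rw [key]
    exact sum_mem fun i _ => sum_mem fun j _ => Submodule.subset_span ⟨_, (p _).2, _, rfl⟩
  · rw [Submodule.span_le]
    rintro _ ⟨x, hx, a, rfl⟩
    exact tens_mem_glin τ hτ hx a

/-- The projection onto even supermatrices. -/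
def evenProj : Matrix (Fin m ⊕ Fin n) (Fin m ⊕ Fin n) R →ₗ[ℝ]
    Matrix (Fin m ⊕ Fin n) (Fin m ⊕ Fin n) R where
  toFun y := Matrix.of fun i j => (1 / 2 : ℝ) •
    (y i j + (if i.isLeft = j.isLeft then (1 : ℝ) else -1) • τ (y i j))
  map_add' y z := by
    ext i j; simp only [Matrix.of_apply, Matrix.add_apply, map_add, smul_add]; abel
  map_smul' c y := by
    ext i j
    simp only [Matrix.of_apply, Matrix.smul_apply, map_smul, smul_add, RingHom.id_apply,
      smul_comm _ c]

theorem evenProj_of_even {y : Matrix (Fin m ⊕ Fin n) (Fin m ⊕ Fin n) R} (hy : SEven τ y) :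
    evenProj τ y = y := by
  ext i j
  change (1 / 2 : ℝ) • (y i j + (if i.isLeft = j.isLeft then (1 : ℝ) else -1) • τ (y i j)) = y i j
  rw [hy i j]
  split_ifs <;> simp <;> module

theorem evenProj_tens (x : Matrix (Fin m ⊕ Fin n) (Fin m ⊕ Fin n) ℝ) (a : R) :
    evenProj τ (tens τ x a) = tens τ (realDiag x) ((1 / 2 : ℝ) • (a + τ a)) +
      tens τ (x - realDiag x) ((1 / 2 : ℝ) • (a - τ a)) := by
  ext i j
  change (1 / 2 : ℝ) • (_ + (if i.isLeft = j.isLeft then (1 : ℝ) else -1) • τ (x i j • twist τ i a))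
    = _
  simp only [Matrix.add_apply, tens_apply, Matrix.sub_apply, realDiag, Matrix.of_apply, map_smul,
    map_add, map_sub, twist_tau]
  split_ifs <;> simp <;> module

/-- `𝔤 ⊗ R` is closed under commutators with its even elements. -/
theorem bracket_mem_glin (hτ : IsSuperComm τ) (hg : IsSuperLie 𝔤)
    {Y x : Matrix (Fin m ⊕ Fin n) (Fin m ⊕ Fin n) R}
    (hY : Y ∈ glin τ 𝔤) (hYe : SEven τ Y) (hx : x ∈ glin τ 𝔤) : Y * x - x * Y ∈ glin τ 𝔤 := by
  rw [← evenProj_of_even τ hYe]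
  clear hYe
  rw [glin_eq_span τ hτ] at hY hx
  have hdiag : ∀ x : Matrix (Fin m ⊕ Fin n) (Fin m ⊕ Fin n) ℝ, RealEven (realDiag x) := by
    intro x i j h; simp [realDiag, h]
  have hoff : ∀ x : Matrix (Fin m ⊕ Fin n) (Fin m ⊕ Fin n) ℝ, RealOdd (x - realDiag x) := by
    intro x i j h; simp [realDiag, h]
  have hev : ∀ a : R, τ ((1 / 2 : ℝ) • (a + τ a)) = (1 / 2 : ℝ) • (a + τ a) := by
    intro a; rw [map_smul, map_add, hτ.invol, add_comm]
  have hod : ∀ a : R, τ ((1 / 2 : ℝ) • (a - τ a)) = -((1 / 2 : ℝ) • (a - τ a)) := by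
    intro a; rw [map_smul, map_sub, hτ.invol, ← smul_neg, neg_sub]
  induction hY using Submodule.span_induction with
  | zero => simp
  | add Y Z _ _ hY hZ =>
    rw [map_add, add_mul, mul_add, add_sub_add_comm]; exact add_mem hY hZ
  | smul c Y _ hY =>
    rw [map_smul, smul_mul_assoc, mul_smul_comm, ← smul_sub]; exact Submodule.smul_mem _ _ hY
  | mem Y hY =>
    obtain ⟨A, hA, a, rfl⟩ := hY
    rw [evenProj_tens]
    have hA0 := hg.diag_mem A hA
    have hA1 := sub_mem hA hA0
    have hA0' := hdiag A
    have hA1' := hoff A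
    generalize (realDiag A) = A0 at *
    generalize (A - A0) = A1 at *
    have ha0 := hev a
    have ha1 := hod a
    generalize (1 / 2 : ℝ) • (a + τ a) = a0 at *
    generalize (1 / 2 : ℝ) • (a - τ a) = a1 at *
    induction hx using Submodule.span_induction with
    | zero => simp
    | add Y Z _ _ hY hZ =>
      rw [mul_add, add_mul _ _ (tens τ A0 a0 + tens τ A1 a1), add_sub_add_comm]
      exact add_mem hY hZ
    | smul c Y _ hY =>
      rw [smul_mul_assoc, mul_smul_comm, ← smul_sub]; exact Submodule.smul_mem _ _ hY
    | mem y hy =>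
      obtain ⟨B, hB, b, rfl⟩ := hy
      have hBsplit : tens τ B b = tens τ (realDiag B) b + tens τ (B - realDiag B) b := by
        rw [tens_sub_left]; abel
      rw [hBsplit]
      have hB0 := hg.diag_mem B hB
      have hB1 := sub_mem hB hB0
      have hB0' := hdiag B
      have hB1' := hoff B
      generalize (realDiag B) = B0 at *
      generalize (B - B0) = B1 at *
      have e1 : a0 * b = b * a0 := hτ.even_comm _ _ ha0
      have e2 : a1 * τ b = b * a1 := by rw [hτ.odd_comm _ _ ha1, hτ.invol]
      have : (tens τ A0 a0 + tens τ A1 a1) * (tens τ B0 b + tens τ B1 b) -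
          (tens τ B0 b + tens τ B1 b) * (tens τ A0 a0 + tens τ A1 a1) =
          tens τ (A0 * B0 - B0 * A0) (b * a0) + tens τ (A0 * B1 - B1 * A0) (b * a0) -
          tens τ (B0 * A1 - A1 * B0) (b * a1) := by
        simp only [add_mul, mul_add, tens_mul_of_even τ hA0', tens_mul_of_even τ hB0',
          tens_mul_of_odd τ hτ hA1', tens_mul_of_odd τ hτ hB1', hg.odd_mul A1 hA1 B1 hB1 hA1' hB1',
          hg.odd_mul B1 hB1 A1 hA1 hB1' hA1', tens_zero_left, ha0, e1, e2, tens_sub_left]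
        abel
      rw [this]
      exact sub_mem (add_mem (tens_mem_glin τ hτ (hg.bracket_mem _ hA0 _ hB0 hA0') _)
        (tens_mem_glin τ hτ (hg.bracket_mem _ hA0 _ hB1 hA0') _))
        (tens_mem_glin τ hτ (hg.bracket_mem _ hB0 _ hA1 hB0') _)

theorem SEven.mul {x y : Matrix (Fin m ⊕ Fin n) (Fin m ⊕ Fin n) R}
    (hx : SEven τ x) (hy : SEven τ y) : SEven τ (x * y) := by
  intro i j
  rw [Matrix.mul_apply, map_sum]
  have : ∀ k, τ (x i k * y k j) = if i.isLeft = j.isLeft then x i k * y k j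
      else -(x i k * y k j) := by
    intro k
    rw [map_mul, hx, hy]
    rcases i with i | i <;> rcases j with j | j <;> rcases k with k | k <;> simp
  simp only [this]
  split_ifs <;> simp

theorem SEven.one : SEven τ (1 : Matrix (Fin m ⊕ Fin n) (Fin m ⊕ Fin n) R) := by
  intro i j
  by_cases h : i = j
  · subst h; simp
  · simp [Matrix.one_apply_ne h]

/-- The automorphism of the algebra of supermatrices whose fixed points are the even ones. -/
def matInvol (x : Matrix (Fin m ⊕ Fin n) (Fin m ⊕ Fin n) R) :
    Matrix (Fin m ⊕ Fin n) (Fin m ⊕ Fin n) R :=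
  Matrix.of fun i j => if i.isLeft = j.isLeft then τ (x i j) else -τ (x i j)

theorem sEven_iff {x : Matrix (Fin m ⊕ Fin n) (Fin m ⊕ Fin n) R} :
    SEven τ x ↔ matInvol τ x = x := by
  constructor
  · intro h; ext i j
    simp only [matInvol, Matrix.of_apply, h i j]
    split_ifs <;> simp
  · intro h i j
    have := congrFun (congrFun h i) j
    simp only [matInvol, Matrix.of_apply] at this
    split_ifs at this ⊢
    · exact this
    · exact neg_eq_iff_eq_neg.1 this

theorem matInvol_mul (x y : Matrix (Fin m ⊕ Fin n) (Fin m ⊕ Fin n) R) :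
    matInvol τ (x * y) = matInvol τ x * matInvol τ y := by
  ext i j
  simp only [matInvol, Matrix.of_apply, Matrix.mul_apply, map_sum, map_mul]
  rw [← Finset.sum_neg_distrib]
  split_ifs with h <;> refine Finset.sum_congr rfl fun k _ => ?_ <;>
    rcases i with i | i <;> rcases j with j | j <;> rcases k with k | k <;> simp_all

/-- The inverse of an even supermatrix is even. -/
theorem SEven.of_mul_eq_one {x y : Matrix (Fin m ⊕ Fin n) (Fin m ⊕ Fin n) R}
    (hx : SEven τ x) (hxy : x * y = 1) (hyx : y * x = 1) : SEven τ y := by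
  have h1 : matInvol τ (1 : Matrix (Fin m ⊕ Fin n) (Fin m ⊕ Fin n) R) = 1 :=
    (sEven_iff τ).1 (SEven.one τ)
  rw [sEven_iff] at hx ⊢
  have h := matInvol_mul τ x y
  rw [hxy, h1, hx] at h
  calc matInvol τ y = y * (x * matInvol τ y) := by rw [← mul_assoc, hyx, one_mul]
    _ = y := by rw [← h, mul_one]

/-- An odd derivation of a superalgebra. -/
structure IsOddDeriv (d : R →ₗ[ℝ] R) : Prop where
  leibniz : ∀ a b, d (a * b) = d a * b + τ a * d b
  odd : ∀ a, d (τ a) = -τ (d a)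

/-- The action of an odd derivation on supermatrices, `h_{kj} ↦ (-1)^{deg k} d h_{kj}`. -/
def matDer (d : R →ₗ[ℝ] R) : Matrix (Fin m ⊕ Fin n) (Fin m ⊕ Fin n) R →ₗ[ℝ]
    Matrix (Fin m ⊕ Fin n) (Fin m ⊕ Fin n) R where
  toFun h := Matrix.of fun k j => if k.isLeft then d (h k j) else -d (h k j)
  map_add' x y := by
    ext i j; cases i <;> simp [add_comm]
  map_smul' c x := by
    ext i j; cases i <;> simp

theorem matDer_apply (d : R →ₗ[ℝ] R) (h : Matrix (Fin m ⊕ Fin n) (Fin m ⊕ Fin n) R) (k j) :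
    matDer d h k j = if k.isLeft then d (h k j) else -d (h k j) := rfl

variable {d : R →ₗ[ℝ] R}

/-- The sign in the definition of `matDer` turns the odd derivation `d` into an ordinary derivation on
even supermatrices. -/
theorem matDer_mul (hd : IsOddDeriv τ d) {x : Matrix (Fin m ⊕ Fin n) (Fin m ⊕ Fin n) R}
    (hx : SEven τ x) (y : Matrix (Fin m ⊕ Fin n) (Fin m ⊕ Fin n) R) :
    matDer d (x * y) = matDer d x * y + x * matDer d y := by
  ext i j
  simp only [Matrix.add_apply, Matrix.mul_apply, matDer_apply, map_sum, hd.leibniz]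
  rw [← Finset.sum_add_distrib, ← Finset.sum_neg_distrib]
  split_ifs with h <;> refine Finset.sum_congr rfl fun k _ => ?_ <;> have hik := hx i k <;>
    rcases i with i | i <;> rcases k with k | k <;> simp_all <;> abel

theorem matDer_one (hd : IsOddDeriv τ d) :
    matDer d (1 : Matrix (Fin m ⊕ Fin n) (Fin m ⊕ Fin n) R) = 0 := by
  have := matDer_mul (m := m) (n := n) τ hd (SEven.one τ) 1
  simpa using this

theorem matDer_tens (hd : IsOddDeriv τ d) (x : Matrix (Fin m ⊕ Fin n) (Fin m ⊕ Fin n) ℝ) (a : R) :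
    matDer d (tens τ x a) = tens τ x (d a) := by
  ext i j
  rw [matDer_apply]
  cases i <;> simp [tens_apply, hd.odd]

theorem matDer_mem_glin (hτ : IsSuperComm τ) (hd : IsOddDeriv τ d)
    {x : Matrix (Fin m ⊕ Fin n) (Fin m ⊕ Fin n) R} (hx : x ∈ glin τ 𝔤) :
    matDer d x ∈ glin τ 𝔤 := by
  rw [glin_eq_span τ hτ] at hx
  induction hx using Submodule.span_induction with
  | zero => rw [map_zero]; exact zero_mem _
  | add Y Z _ _ hY hZ => rw [map_add]; exact add_mem hY hZ
  | smul c Y _ hY => rw [map_smul]; exact Submodule.smul_mem _ _ hY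
  | mem y hy =>
    obtain ⟨B, hB, b, rfl⟩ := hy
    rw [matDer_tens τ hd]
    exact tens_mem_glin τ hτ hB _

end SuperMatrix

/-! ### Exterior algebras -/

section Exterior

variable {V : Type*} [AddCommGroup V] [Module ℝ V]

theorem ι_mul_eq_involute_mul (v : V) (y : ExteriorAlgebra ℝ V) :
    ExteriorAlgebra.ι ℝ v * y = CliffordAlgebra.involute y * ExteriorAlgebra.ι ℝ v := by
  induction y using CliffordAlgebra.left_induction with
  | algebraMap r => rw [AlgHom.commutes]; exact (Algebra.commutes _ _).symm
  | add a b ha hb => rw [mul_add, map_add, add_mul, ha, hb]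
  | ι_mul a w ha =>
    rw [map_mul, CliffordAlgebra.involute_ι, mul_assoc, ← ha, ← mul_assoc, ← mul_assoc]
    have : ExteriorAlgebra.ι ℝ v * CliffordAlgebra.ι 0 w
        = -(CliffordAlgebra.ι 0 w * ExteriorAlgebra.ι ℝ v) :=
      eq_neg_of_add_eq_zero_left (ExteriorAlgebra.ι_add_mul_swap v w)
    rw [this, neg_mul]
    exact (neg_mul (CliffordAlgebra.ι 0 w * ExteriorAlgebra.ι ℝ v : ExteriorAlgebra ℝ V)
      a).symm.trans
      (congrArg (· * a)
        (neg_mul (CliffordAlgebra.ι 0 w : ExteriorAlgebra ℝ V) (ExteriorAlgebra.ι ℝ v)).symm)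

/-- The exterior algebra is supercommutative. -/
theorem isSuperComm_involute :
    IsSuperComm (CliffordAlgebra.involute : ExteriorAlgebra ℝ V →ₐ[ℝ] ExteriorAlgebra ℝ V) := by
  have key : ∀ x y : ExteriorAlgebra ℝ V,
      (x + CliffordAlgebra.involute x) * y = y * (x + CliffordAlgebra.involute x) ∧
      (x - CliffordAlgebra.involute x) * y
        = CliffordAlgebra.involute y * (x - CliffordAlgebra.involute x) := by
    intro x
    induction x using CliffordAlgebra.left_induction with
    | algebraMap r =>
      intro y
      rw [AlgHom.commutes, sub_self, zero_mul, mul_zero, ← map_add]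
      exact ⟨Algebra.commutes _ _, rfl⟩
    | add a b ha hb =>
      intro y
      have := ha y
      have := hb y
      constructor
      · rw [map_add, add_add_add_comm, add_mul, mul_add, (ha y).1, (hb y).1]
      · rw [map_add, add_sub_add_comm, add_mul, mul_add, (ha y).2, (hb y).2]
    | ι_mul a v ha =>
      intro y
      have h := ι_mul_eq_involute_mul v
      change ∀ y, CliffordAlgebra.ι 0 v * y = _ * CliffordAlgebra.ι 0 v at h
      rw [map_mul, CliffordAlgebra.involute_ι]
      constructor
      · rw [neg_mul, ← sub_eq_add_neg, ← mul_sub, mul_assoc, (ha y).2, ← mul_assoc, h,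
          CliffordAlgebra.involute_involute, mul_assoc]
      · rw [neg_mul, sub_neg_eq_add, ← mul_add, mul_assoc, (ha y).1, ← mul_assoc, h, mul_assoc]
  refine ⟨fun a => CliffordAlgebra.involute_involute a, fun a b ha => ?_, fun a b ha => ?_⟩
  · have := (key a b).1
    rw [ha, ← two_smul ℝ a, smul_mul_assoc, mul_smul_comm] at this
    exact smul_right_injective _ (two_ne_zero' ℝ) this
  · have := (key a b).2
    rw [ha, sub_neg_eq_add, ← two_smul ℝ a, smul_mul_assoc, mul_smul_comm] at this
    exact smul_right_injective _ (two_ne_zero' ℝ) this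

instance [FiniteDimensional ℝ V] : FiniteDimensional ℝ (ExteriorAlgebra ℝ V) :=
  Module.Finite.of_basis (Module.finBasis ℝ V).ExteriorAlgebra

theorem involute_contractLeft (f : Module.Dual ℝ V) (x : ExteriorAlgebra ℝ V) :
    CliffordAlgebra.contractLeft f (CliffordAlgebra.involute x)
      = -CliffordAlgebra.involute (CliffordAlgebra.contractLeft f x) := by
  induction x using CliffordAlgebra.left_induction with
  | algebraMap r =>
    rw [AlgHom.commutes, CliffordAlgebra.contractLeft_algebraMap, map_zero, neg_zero]
  | add a b ha hb => simp only [map_add, ha, hb, neg_add]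
  | ι_mul a v ha =>
    rw [map_mul, CliffordAlgebra.involute_ι, neg_mul, map_neg, CliffordAlgebra.contractLeft_ι_mul,
      CliffordAlgebra.contractLeft_ι_mul, ha, map_sub, map_mul, CliffordAlgebra.involute_ι,
      map_smul]
    simp

/-- Contraction is an odd derivation of the exterior algebra. -/
theorem isOddDeriv_contractLeft (f : Module.Dual ℝ V) :
    IsOddDeriv (CliffordAlgebra.involute : ExteriorAlgebra ℝ V →ₐ[ℝ] ExteriorAlgebra ℝ V)
      (CliffordAlgebra.contractLeft f) :=
  ⟨raw_leibniz f, involute_contractLeft f⟩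

end Exterior

/-! ### Exponentials in finite dimensional algebras -/

section WeakExp

/-- `h = ∑ Y^N / N!`, with weak convergence. In finite dimensional algebras this is the exponential
series for any norm. -/
def IsWExp {B : Type*} [Ring B] [Algebra ℝ B] (Y h : B) : Prop :=
  ∀ l : Module.Dual ℝ B, HasSum (fun N : ℕ => ((N ! : ℕ) : ℝ)⁻¹ * l (Y ^ N)) (l h)

variable {B : Type*} [Ring B] [Algebra ℝ B]

/-- Membership in a subspace is tested by linear forms, so that no topology on `V` is needed. -/
theorem mem_of_forall_dual {V : Type*} [AddCommGroup V] [Module ℝ V] {W : Submodule ℝ V} {v : V}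
    (h : ∀ l : Module.Dual ℝ V, (∀ w ∈ W, l w = 0) → l v = 0) : v ∈ W := by
  by_contra hv
  obtain ⟨f, hf, hW⟩ := Submodule.exists_le_ker_of_notMem hv
  exact hf (h f fun w hw => hW hw)

theorem eq_of_forall_dual {V : Type*} [AddCommGroup V] [Module ℝ V] {x y : V}
    (h : ∀ l : Module.Dual ℝ V, l x = l y) : x = y := by
  rw [← sub_eq_zero, ← Module.forall_dual_apply_eq_zero_iff ℝ]
  intro l
  rw [map_sub, h l, sub_self]

theorem IsWExp.mem {Y h : B} (H : IsWExp Y h) {W : Submodule ℝ B} (hW : ∀ N, Y ^ N ∈ W) :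
    h ∈ W := by
  refine mem_of_forall_dual fun l hl => ?_
  have := H l
  simp only [fun N => hl _ (hW N), mul_zero] at this
  exact this.unique hasSum_zero

theorem IsWExp.map {Y h : B} (H : IsWExp Y h) {B' : Type*} [Ring B'] [Algebra ℝ B']
    (f : B →ₗ[ℝ] B') (hf : ∀ N, f (Y ^ N) = f Y ^ N) : IsWExp (f Y) (f h) := by
  intro l
  have := H (l ∘ₗ f)
  simpa only [LinearMap.comp_apply, hf] using this

theorem isWExp_matrix {d : Type*} [Fintype d] [DecidableEq d] (Y : Matrix d d ℝ) :
    IsWExp Y (NormedSpace.exp Y) := by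
  intro l
  let : NormedRing (Matrix d d ℝ) := Matrix.linftyOpNormedRing
  let : NormedAlgebra ℝ (Matrix d d ℝ) := Matrix.linftyOpNormedAlgebra
  have h := NormedSpace.exp_series_hasSum_exp' (𝕂 := ℝ) Y
  have := h.mapL (LinearMap.toContinuousLinearMap l)
  simp only [map_smul, smul_eq_mul] at this
  exact this

/-- If `B` intertwines `X` and `Y`, then it intertwines their exponentials. -/
theorem exp_semiconj {d : Type*} [Fintype d] [DecidableEq d] {B X Y : Matrix d d ℝ}
    (h : B * X = Y * B) : B * NormedSpace.exp X = NormedSpace.exp Y * B := by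
  rw [← sub_eq_zero, ← Submodule.mem_bot ℝ]
  refine mem_of_forall_dual fun l _ => ?_
  have hN : ∀ N : ℕ, B * X ^ N = Y ^ N * B := fun N => (SemiconjBy.pow_right (a := B) h N)
  have h1 := isWExp_matrix X (l ∘ₗ LinearMap.mulLeft ℝ B)
  have h2 := isWExp_matrix Y (l ∘ₗ LinearMap.mulRight ℝ B)
  simp only [LinearMap.comp_apply, LinearMap.mulLeft_apply, LinearMap.mulRight_apply, hN] at h1 h2
  rw [map_sub, h1.unique h2, sub_self]

theorem IsWExp.unique {Y h h' : B} (H : IsWExp Y h) (H' : IsWExp Y h') : h = h' := by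
  rw [← sub_eq_zero, ← Submodule.mem_bot ℝ]
  refine mem_of_forall_dual fun l _ => ?_
  rw [map_sub, (H l).unique (H' l), sub_self]

/-- All terms of the series of `exp T v - v` start with `T v`, hence lie in any invariant subspace which
contains `T v`. -/
theorem IsWExp.apply_sub_mem {V : Type*} [AddCommGroup V] [Module ℝ V] {T e : Module.End ℝ V}
    (H : IsWExp T e) {W : Submodule ℝ V} (hT : ∀ w ∈ W, T w ∈ W) {v : V} (hv : T v ∈ W) :
    e v - v ∈ W := by
  refine mem_of_forall_dual fun l hl => ?_
  have h := H (l ∘ₗ LinearMap.applyₗ v)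
  have hN : ∀ N : ℕ, (T ^ (N + 1)) v ∈ W := by
    intro N
    induction N with
    | zero => simpa using hv
    | succ N ih => rw [pow_succ']; exact hT _ ih
  have h2 : HasSum (fun N : ℕ => ((N ! : ℕ) : ℝ)⁻¹ * (l ∘ₗ LinearMap.applyₗ v) (T ^ N)) (l v) := by
    convert hasSum_single (f := fun N : ℕ => ((N ! : ℕ) : ℝ)⁻¹ *
      (l ∘ₗ LinearMap.applyₗ v) (T ^ N)) 0 ?_ using 1
    · simp
    · intro N hN0
      obtain ⟨k, rfl⟩ := Nat.exists_eq_succ_of_ne_zero hN0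
      have := hl _ (hN k)
      simp [this]
  rw [map_sub, sub_eq_zero]
  exact h.unique h2

/-- In a finite dimensional algebra the weak exponential is the matrix exponential in the left regular
representation. -/
theorem isWExp_iff (b : Module.Basis (Fin (Module.finrank ℝ B)) ℝ B) (Y h : B) :
    IsWExp Y h ↔ Algebra.leftMulMatrix b h = NormedSpace.exp (Algebra.leftMulMatrix b Y) := by
  constructor
  · intro H
    exact (H.map (Algebra.leftMulMatrix b).toLinearMap fun N =>
      map_pow (Algebra.leftMulMatrix b) Y N).unique
      (isWExp_matrix _)
  · intro H l
    obtain ⟨g, hg⟩ := LinearMap.exists_leftInverse_of_injective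
      (Algebra.leftMulMatrix b).toLinearMap
      (LinearMap.ker_eq_bot.2 (Algebra.leftMulMatrix_injective b))
    have := isWExp_matrix (Algebra.leftMulMatrix b Y) (l ∘ₗ g)
    rw [← H] at this
    have hg' : ∀ x, g (Algebra.leftMulMatrix b x) = x := fun x => LinearMap.congr_fun hg x
    simpa only [LinearMap.comp_apply, ← map_pow, hg'] using this

variable [Module.Finite ℝ B]

theorem IsWExp.mul {Y h Y' h' : B} (H : IsWExp Y h) (H' : IsWExp Y' h') (hc : Commute Y Y') :
    IsWExp (Y + Y') (h * h') := by
  have b := Module.finBasis ℝ B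
  rw [isWExp_iff b] at *
  rw [map_mul, H, H', map_add, Matrix.exp_add_of_commute _ _ (hc.map _)]

theorem IsWExp.neg {Y h h' : B} (H : IsWExp Y h) (h1 : h * h' = 1) : IsWExp (-Y) h' := by
  have b := Module.finBasis ℝ B
  rw [isWExp_iff b] at *
  rw [map_neg, Matrix.exp_neg, ← H]
  symm
  apply Matrix.inv_eq_right_inv
  rw [← map_mul, h1, map_one]

/-- Conjugation by `exp Y` is the exponential of `x ↦ x * Y - Y * x`, as the sum of the commuting
operators of right multiplication by `Y` and left multiplication by `-Y`. -/
theorem IsWExp.conj_sub_mem {Y h h' : B} (H : IsWExp Y h) (h1 : h * h' = 1)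
    {W : Submodule ℝ B} (hW : ∀ x ∈ W, x * Y - Y * x ∈ W) {x : B} (hx : x * Y - Y * x ∈ W) :
    h' * x * h - x ∈ W := by
  have h2 : IsWExp (LinearMap.mulRight ℝ Y) (LinearMap.mulRight ℝ h) := by
    have := H.map (LinearMap.mul ℝ B).flip fun N => by
      change LinearMap.mulRight ℝ (Y ^ N) = _
      exact (LinearMap.pow_mulRight ℝ B Y N).symm
    exact this
  have h3 : IsWExp (LinearMap.mulLeft ℝ (-Y)) (LinearMap.mulLeft ℝ h') := by
    have := (H.neg h1).map (LinearMap.mul ℝ B) fun N => by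
      change LinearMap.mulLeft ℝ ((-Y) ^ N) = _
      exact (LinearMap.pow_mulLeft ℝ B (-Y) N).symm
    exact this
  have h4 := h2.mul h3 (by
    ext x; simp [mul_assoc])
  have h5 := h4.apply_sub_mem (W := W) (v := x) (fun w hw => by
    simpa [sub_eq_add_neg] using hW w hw) (by simpa [sub_eq_add_neg] using hx)
  simpa using h5

theorem IsWExp.conj_mem {Y h h' : B} (H : IsWExp Y h) (h1 : h * h' = 1)
    {W : Submodule ℝ B} (hW : ∀ x ∈ W, x * Y - Y * x ∈ W) {x : B} (hx : x ∈ W) :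
    h' * x * h ∈ W := by
  have := add_mem (H.conj_sub_mem h1 hW (hW x hx)) hx
  simpa using this

/-- The logarithmic derivative of `exp Y` along a derivation `D` lies in any space which contains
`D Y` and is stable under commutators with `Y`. -/
theorem IsWExp.logDeriv_mem {Y h h' : B} (H : IsWExp Y h) (h1 : h * h' = 1)
    {W : Submodule ℝ B} (hW : ∀ x ∈ W, x * Y - Y * x ∈ W) (D : Module.End ℝ B)
    (hD : ∀ x, D (Y * x) = D Y * x + Y * D x) (hD1 : D 1 = 0) (hDY : D Y ∈ W) :
    h' * D h ∈ W := by
  have h3 : IsWExp (LinearMap.mulLeft ℝ Y) (LinearMap.mulLeft ℝ h) := by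
    have := H.map (LinearMap.mul ℝ B) fun N => by
      change LinearMap.mulLeft ℝ (Y ^ N) = _
      exact (LinearMap.pow_mulLeft ℝ B Y N).symm
    exact this
  have h2 := h3.conj_sub_mem (h' := LinearMap.mulLeft ℝ h') (W := W.map (LinearMap.mul ℝ B))
    (x := D) (by ext; simp [← mul_assoc, h1]) (by
      rintro _ ⟨w, hw, rfl⟩
      refine ⟨_, hW w hw, ?_⟩
      ext x
      simp [mul_assoc]) (by
      refine ⟨_, hDY, ?_⟩
      ext x
      simp [hD])
  obtain ⟨w, hw, hw'⟩ := h2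
  have := LinearMap.congr_fun hw' 1
  simp [hD1] at this
  rwa [← this]

end WeakExp

/-! ### The group generated by the exponentials of a linear Lie superalgebra -/

section GroupElements

variable {m n : ℕ} {R : Type*} [Ring R] [Algebra ℝ R] (τ : R →ₐ[ℝ] R)
  (𝔤 : Submodule ℝ (Matrix (Fin m ⊕ Fin n) (Fin m ⊕ Fin n) ℝ))

/-- The properties of the elements `h` of the group of `𝔤 ⊗ R` and their inverses `h'` which are
used below: they are even, conjugation preserves `𝔤 ⊗ R`, and the logarithmic derivatives along odd
derivations belong to `𝔤 ⊗ R`. -/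
structure IsGroupElt (h h' : Matrix (Fin m ⊕ Fin n) (Fin m ⊕ Fin n) R) : Prop where
  mul_inv : h * h' = 1
  inv_mul : h' * h = 1
  even : SEven τ h
  conj : ∀ x ∈ glin τ 𝔤, h' * x * h ∈ glin τ 𝔤
  conj' : ∀ x ∈ glin τ 𝔤, h * x * h' ∈ glin τ 𝔤
  logDer : ∀ d : R →ₗ[ℝ] R, IsOddDeriv τ d → h' * matDer d h ∈ glin τ 𝔤

variable {τ 𝔤} {h h' k k' Y : Matrix (Fin m ⊕ Fin n) (Fin m ⊕ Fin n) R}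

theorem IsGroupElt.one : IsGroupElt τ 𝔤 1 1 where
  mul_inv := mul_one 1
  inv_mul := mul_one 1
  even := SEven.one τ
  conj x hx := by rwa [one_mul, mul_one]
  conj' x hx := by rwa [one_mul, mul_one]
  logDer d hd := by rw [matDer_one τ hd, mul_zero]; exact zero_mem _

theorem IsGroupElt.mul (hh : IsGroupElt τ 𝔤 h h') (hk : IsGroupElt τ 𝔤 k k') :
    IsGroupElt τ 𝔤 (h * k) (k' * h') where
  mul_inv := by
    rw [← mul_assoc, mul_assoc h, hk.mul_inv, mul_one, hh.mul_inv]
  inv_mul := by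
    rw [← mul_assoc, mul_assoc k', hh.inv_mul, mul_one, hk.inv_mul]
  even := hh.even.mul τ hk.even
  conj x hx := by
    have := hk.conj _ (hh.conj x hx)
    simpa only [mul_assoc] using this
  conj' x hx := by
    have := hh.conj' _ (hk.conj' x hx)
    simpa only [mul_assoc] using this
  logDer d hd := by
    have h1 : k' * h' * matDer d (h * k) = k' * (h' * matDer d h) * k + k' * matDer d k := by
      rw [matDer_mul τ hd hh.even, mul_add, ← mul_assoc, ← mul_assoc, mul_assoc k' h' h,
        hh.inv_mul, mul_one, ← mul_assoc]
    rw [h1]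
    exact add_mem (hk.conj _ (hh.logDer d hd)) (hk.logDer d hd)

theorem IsGroupElt.inv (hh : IsGroupElt τ 𝔤 h h') : IsGroupElt τ 𝔤 h' h where
  mul_inv := hh.inv_mul
  inv_mul := hh.mul_inv
  even := SEven.of_mul_eq_one τ hh.even hh.mul_inv hh.inv_mul
  conj := hh.conj'
  conj' := hh.conj
  logDer d hd := by
    have h1 := matDer_mul τ hd hh.even h'
    rw [hh.mul_inv, matDer_one τ hd] at h1
    have h2 : h * matDer d h' = -(h * (h' * matDer d h) * h') := by
      rw [← mul_assoc, hh.mul_inv, one_mul]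
      exact eq_neg_of_add_eq_zero_right h1.symm
    rw [h2]
    exact neg_mem (hh.conj' _ (hh.logDer d hd))

/-- Exponentials of even elements of `𝔤 ⊗ R` have the required properties, as `𝔤 ⊗ R` is stable under
commutators with such elements and under odd derivations. -/
theorem isGroupElt_exp [Module.Finite ℝ R] (hτ : IsSuperComm τ) (hg : IsSuperLie 𝔤)
    (hY : Y ∈ glin τ 𝔤) (hYe : SEven τ Y) (hh : IsWExp Y h) (h1 : h * h' = 1) (h2 : h' * h = 1) :
    IsGroupElt τ 𝔤 h h' := by
  have hb : ∀ x ∈ glin τ 𝔤, x * Y - Y * x ∈ glin τ 𝔤 := fun x hx => by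
    rw [← neg_sub]; exact neg_mem (bracket_mem_glin τ hτ hg hY hYe hx)
  refine ⟨h1, h2, ?_, fun x hx => hh.conj_mem h1 hb hx, fun x hx => ?_, fun d hd => ?_⟩
  · let W : Submodule ℝ (Matrix (Fin m ⊕ Fin n) (Fin m ⊕ Fin n) R) :=
      { carrier := {x | SEven τ x}
        zero_mem' := fun i j => by simp
        add_mem' := fun {x y} hx hy i j => by
          rw [Matrix.add_apply, map_add, hx, hy]
          split_ifs <;> simp [add_comm]
        smul_mem' := fun c x hx i j => by
          rw [Matrix.smul_apply, map_smul, hx]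
          split_ifs <;> simp }
    refine hh.mem (W := W) fun N => ?_
    induction N with
    | zero => rw [pow_zero]; exact SEven.one τ
    | succ N ih => rw [pow_succ]; exact SEven.mul τ ih hYe
  · refine (hh.neg h1).conj_mem h2 (fun x hx => ?_) hx
    rw [mul_neg, neg_mul, sub_neg_eq_add, neg_add_eq_sub, ← neg_sub]
    exact neg_mem (hb x hx)
  · exact hh.logDeriv_mem h1 hb (matDer d) (fun x => matDer_mul τ hd hYe x) (matDer_one τ hd)
      (matDer_mem_glin τ hτ hd hY)

end GroupElements

/-! ### The spin representation -/

namespace SpinorModule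

variable {m n : ℕ} (Δ : SpinorModule m n)

theorem ε_mul_self (i : Fin m) : Δ.ε i * Δ.ε i = 1 := by
  rcases Δ.ε_sign i with h | h <;> rw [h] <;> norm_num

theorem ε_ne_zero (i : Fin m) : Δ.ε i ≠ 0 := fun h => by
  have := Δ.ε_mul_self i
  rw [h] at this
  norm_num at this

theorem γ_mul_self (i : Fin m) : Δ.γ i * Δ.γ i = (-Δ.ε i) • (1 : Matrix (Fin n) (Fin n) ℝ) := by
  have h := Δ.clifford i i
  rw [if_pos rfl, ← two_smul ℝ (Δ.γ i * Δ.γ i), show -2 * Δ.ε i = 2 * (-Δ.ε i) by ring,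
    mul_smul] at h
  exact smul_right_injective _ (two_ne_zero' ℝ) h

theorem γ_anticomm {i j : Fin m} (h : i ≠ j) : Δ.γ i * Δ.γ j = -(Δ.γ j * Δ.γ i) := by
  have := Δ.clifford i j
  rw [if_neg h, zero_smul] at this
  exact eq_neg_of_add_eq_zero_left this

variable {Δ} in
theorem so_apply {A : Matrix (Fin m) (Fin m) ℝ} (hA : A ∈ Δ.so) (i k : Fin m) :
    Δ.ε i * A i k = -(A k i * Δ.ε k) := by
  have := congrFun (congrFun hA i) k
  simp only [Matrix.add_apply, Matrix.mul_diagonal, Matrix.diagonal_mul, Matrix.transpose_apply,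
    Matrix.zero_apply] at this
  linarith

variable {Δ} in
theorem so_apply' {A : Matrix (Fin m) (Fin m) ℝ} (hA : A ∈ Δ.so) (i k : Fin m) :
    Δ.ε k * A i k = -(A k i * Δ.ε i) := by
  linear_combination (Δ.ε i * Δ.ε k) * so_apply hA i k - (Δ.ε k * A i k) * Δ.ε_mul_self i
    - (A k i * Δ.ε i) * Δ.ε_mul_self k

variable {Δ} in
theorem so_of_apply {A : Matrix (Fin m) (Fin m) ℝ}
    (hA : ∀ i k, Δ.ε i * A i k = -(A k i * Δ.ε k)) : A ∈ Δ.so := by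
  change _ = _
  ext i k
  simp only [Matrix.add_apply, Matrix.mul_diagonal, Matrix.diagonal_mul, Matrix.transpose_apply,
    Matrix.zero_apply, hA]
  ring

variable {Δ} in
theorem so_bracket {A B : Matrix (Fin m) (Fin m) ℝ} (hA : A ∈ Δ.so) (hB : B ∈ Δ.so) :
    A * B - B * A ∈ Δ.so := by
  apply so_of_apply
  intro i k
  simp only [Matrix.sub_apply, Matrix.mul_apply, mul_sub, sub_mul, Finset.mul_sum, Finset.sum_mul]
  have h1 : ∀ j, Δ.ε i * (A i j * B j k) = B k j * A j i * Δ.ε k := by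
    intro j
    rw [← mul_assoc, so_apply hA, neg_mul, mul_assoc, so_apply hB]; ring
  have h2 : ∀ j, Δ.ε i * (B i j * A j k) = A k j * B j i * Δ.ε k := by
    intro j
    rw [← mul_assoc, so_apply hB, neg_mul, mul_assoc, so_apply hA]; ring
  simp only [h1, h2]
  ring

theorem spinRep_apply (A : Matrix (Fin m) (Fin m) ℝ) :
    Δ.spinRep A = (1 / 4 : ℝ) • ∑ i, ∑ k, (Δ.ε i * A k i) • (Δ.γ i * Δ.γ k) := rfl

variable {Δ} in
/-- The spin representation is infinitesimally compatible with Clifford multiplication. -/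
theorem spinRep_γ {A : Matrix (Fin m) (Fin m) ℝ} (hA : A ∈ Δ.so) (l : Fin m) :
    Δ.spinRep A * Δ.γ l - Δ.γ l * Δ.spinRep A = ∑ k, A k l • Δ.γ k := by
  have h1 : ∀ i k, Δ.γ i * Δ.γ k * Δ.γ l - Δ.γ l * (Δ.γ i * Δ.γ k)
      = (if k = l then -2 * Δ.ε k else 0) • Δ.γ i - (if i = l then -2 * Δ.ε i else 0) • Δ.γ k := by
    intro i k
    have e1 := Δ.clifford k l
    have e2 := Δ.clifford i l
    calc _ = Δ.γ i * (Δ.γ k * Δ.γ l + Δ.γ l * Δ.γ k) - (Δ.γ i * Δ.γ l + Δ.γ l * Δ.γ i) * Δ.γ k := by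
          noncomm_ring
      _ = _ := by rw [e1, e2]; simp
  rw [spinRep_apply, smul_mul_assoc, mul_smul_comm, ← smul_sub, Finset.sum_mul, Finset.mul_sum,
    ← Finset.sum_sub_distrib]
  have h2 : ∀ i, (∑ k, (Δ.ε i * A k i) • (Δ.γ i * Δ.γ k)) * Δ.γ l
      - Δ.γ l * (∑ k, (Δ.ε i * A k i) • (Δ.γ i * Δ.γ k))
      = (2 * A i l) • Δ.γ i + ∑ k, (if i = l then 2 * A k i else 0) • Δ.γ k := by
    intro i
    rw [Finset.sum_mul, Finset.mul_sum, ← Finset.sum_sub_distrib]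
    have : ∀ k, (Δ.ε i * A k i) • (Δ.γ i * Δ.γ k) * Δ.γ l
        - Δ.γ l * (Δ.ε i * A k i) • (Δ.γ i * Δ.γ k)
        = (if k = l then (2 * A i l) • Δ.γ i else 0)
          + (if i = l then 2 * A k i else 0) • Δ.γ k := by
      intro k
      rw [smul_mul_assoc, mul_smul_comm, ← smul_sub, h1, smul_sub, smul_smul, smul_smul,
        sub_eq_add_neg, ← neg_smul]
      congr 1
      · split_ifs with h
        · subst h
          congr 1
          have := so_apply hA i k
          have := Δ.ε_mul_self k
          calc _ = -2 * (Δ.ε i * (A k i * Δ.ε k)) := by ring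
            _ = 2 * (Δ.ε i * Δ.ε i) * A i k := by rw [← neg_eq_iff_eq_neg.2 (so_apply hA i k)]; ring
            _ = _ := by rw [Δ.ε_mul_self]; ring
        · simp
      · congr 1
        split_ifs with h
        · have := Δ.ε_mul_self i
          linear_combination (2 * A k i) * this
        · simp
    simp only [this, Finset.sum_add_distrib, Finset.sum_ite_eq', Finset.mem_univ, if_true]
  simp only [h2, Finset.sum_add_distrib]
  rw [Finset.sum_comm (f := fun i k => (if i = l then 2 * A k i else 0) • Δ.γ k)]
  have h3 : ∀ k, ∑ i, (if i = l then 2 * A k i else 0) • Δ.γ k = (2 * A k l) • Δ.γ k := by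
    intro k
    rw [← Finset.sum_smul]; simp
  simp only [h3]
  rw [← two_smul ℝ (∑ i, (2 * A i l) • Δ.γ i), smul_smul, Finset.smul_sum]
  refine Finset.sum_congr rfl fun k _ => ?_
  rw [smul_smul]; congr 1; ring

variable {Δ} in
theorem spinRep_bracket {A B : Matrix (Fin m) (Fin m) ℝ} (hA : A ∈ Δ.so) :
    Δ.spinRep (A * B - B * A) = Δ.spinRep A * Δ.spinRep B - Δ.spinRep B * Δ.spinRep A := by
  have h0 : ∀ X : Matrix (Fin m) (Fin m) ℝ, Δ.spinRep X
      = (1 / 4 : ℝ) • ∑ i, Δ.ε i • (Δ.γ i * ∑ k, X k i • Δ.γ k) := by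
    intro X
    rw [spinRep_apply]
    congr 1
    refine Finset.sum_congr rfl fun i _ => ?_
    rw [Finset.mul_sum, Finset.smul_sum]
    refine Finset.sum_congr rfl fun k _ => ?_
    rw [mul_smul_comm, smul_smul]
  have h1 : ∀ i, Δ.spinRep A * (∑ k, B k i • Δ.γ k) - (∑ k, B k i • Δ.γ k) * Δ.spinRep A
      = ∑ k, (A * B) k i • Δ.γ k := by
    intro i
    rw [Finset.mul_sum, Finset.sum_mul, ← Finset.sum_sub_distrib]
    simp only [mul_smul_comm, smul_mul_assoc, ← smul_sub, spinRep_γ hA, Finset.smul_sum]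
    rw [Finset.sum_comm]
    refine Finset.sum_congr rfl fun k _ => ?_
    rw [Matrix.mul_apply, Finset.sum_smul]
    refine Finset.sum_congr rfl fun j _ => ?_
    rw [smul_smul, mul_comm]
  have h2 : ∀ i, Δ.spinRep A * (Δ.γ i * ∑ k, B k i • Δ.γ k)
      - (Δ.γ i * ∑ k, B k i • Δ.γ k) * Δ.spinRep A
      = (∑ k, A k i • Δ.γ k) * (∑ k, B k i • Δ.γ k) + Δ.γ i * ∑ k, (A * B) k i • Δ.γ k := by
    intro i
    rw [← h1 i, ← spinRep_γ hA i]
    noncomm_ring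
  have h3 : ∑ i, Δ.ε i • ((∑ k, A k i • Δ.γ k) * (∑ k, B k i • Δ.γ k))
      = -∑ i, Δ.ε i • (Δ.γ i * ∑ k, (B * A) k i • Δ.γ k) := by
    rw [← Finset.sum_neg_distrib]
    have e1 : ∀ i, Δ.ε i • ((∑ k, A k i • Δ.γ k) * (∑ l, B l i • Δ.γ l))
        = ∑ k, ∑ l, (Δ.ε i * (A k i * B l i)) • (Δ.γ k * Δ.γ l) := by
      intro i
      rw [Finset.sum_mul_sum, Finset.smul_sum]
      refine Finset.sum_congr rfl fun k _ => ?_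
      rw [Finset.smul_sum]
      refine Finset.sum_congr rfl fun l _ => ?_
      rw [smul_mul_smul_comm, smul_smul]
    have e2 : ∀ i, -(Δ.ε i • (Δ.γ i * ∑ k, (B * A) k i • Δ.γ k))
        = ∑ l, ∑ j, (-(Δ.ε i * (B l j * A j i))) • (Δ.γ i * Δ.γ l) := by
      intro i
      rw [Finset.mul_sum, Finset.smul_sum, ← Finset.sum_neg_distrib]
      refine Finset.sum_congr rfl fun l _ => ?_
      rw [mul_smul_comm, smul_smul, ← neg_smul, ← Finset.sum_smul, Matrix.mul_apply,
        Finset.mul_sum, Finset.sum_neg_distrib]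
    simp only [e1, e2]
    rw [Finset.sum_comm]
    refine Finset.sum_congr rfl fun k _ => ?_
    rw [Finset.sum_comm]
    refine Finset.sum_congr rfl fun l _ => Finset.sum_congr rfl fun i _ => ?_
    congr 1
    linear_combination (B l i) * so_apply' hA i k
  have h4 := h0 B
  rw [h0 (A * B - B * A)]
  have h5 : Δ.spinRep A * Δ.spinRep B - Δ.spinRep B * Δ.spinRep A
      = (1 / 4 : ℝ) • ∑ i, Δ.ε i • (Δ.spinRep A * (Δ.γ i * ∑ k, B k i • Δ.γ k)
      - (Δ.γ i * ∑ k, B k i • Δ.γ k) * Δ.spinRep A) := by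
    conv_lhs => rw [h4]
    rw [mul_smul_comm, smul_mul_assoc, ← smul_sub, Finset.mul_sum, Finset.sum_mul,
      ← Finset.sum_sub_distrib]
    congr 1
    refine Finset.sum_congr rfl fun i _ => ?_
    rw [mul_smul_comm, smul_mul_assoc, ← smul_sub]
  rw [h5]
  simp only [h2, smul_add, Finset.sum_add_distrib, h3]
  rw [← smul_add]
  congr 1
  rw [neg_add_eq_sub, ← Finset.sum_sub_distrib]
  refine Finset.sum_congr rfl fun i _ => ?_
  rw [← smul_sub, ← mul_sub, ← Finset.sum_sub_distrib]
  simp only [Matrix.sub_apply, sub_smul]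

/-- `B` is the matrix of a suitable bilinear form on the spinor module: Clifford multiplication is
symmetric or skew-symmetric for `B`. -/
def IsCompatible (B : Matrix (Fin n) (Fin n) ℝ) : Prop :=
  ∃ t : ℝ, t * t = 1 ∧ ∀ i, (Δ.γ i).transpose * B = t • (B * Δ.γ i)

variable {Δ} in
/-- A suitable form is invariant under the spin representation. -/
theorem IsCompatible.spinRep {B : Matrix (Fin n) (Fin n) ℝ} (hB : Δ.IsCompatible B)
    {A : Matrix (Fin m) (Fin m) ℝ} (hA : A ∈ Δ.so) :
    (Δ.spinRep A).transpose * B = -(B * Δ.spinRep A) := by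
  obtain ⟨t, ht, hB⟩ := hB
  rw [spinRep_apply, Matrix.transpose_smul, Matrix.smul_mul, Matrix.mul_smul, ← smul_neg]
  congr 1
  simp only [Matrix.transpose_sum, Matrix.sum_mul, Matrix.mul_sum, ← Finset.sum_neg_distrib]
  refine Finset.sum_congr rfl fun i _ => Finset.sum_congr rfl fun k _ => ?_
  have h1 : (Δ.γ i * Δ.γ k).transpose * B = B * (Δ.γ k * Δ.γ i) := by
    rw [Matrix.transpose_mul, mul_assoc, hB, Matrix.mul_smul, ← mul_assoc, hB, Matrix.smul_mul,
      smul_smul, ht, one_smul, mul_assoc]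
  rw [Matrix.transpose_smul, Matrix.smul_mul, h1, Matrix.mul_smul]
  by_cases h : i = k
  · subst h
    have : A i i = 0 := by
      have := so_apply hA i i
      have h2 := Δ.ε_ne_zero i
      have h3 : 2 * Δ.ε i * A i i = 0 := by linarith
      simpa [h2] using h3
    simp [this]
  · rw [Δ.γ_anticomm h]; simp

theorem exp_mem_spinGroup {A : Matrix (Fin m) (Fin m) ℝ} (hA : A ∈ Δ.so)
    {g : (Matrix (Fin m) (Fin m) ℝ)ˣ × (Matrix (Fin n) (Fin n) ℝ)ˣ}
    (h1 : (g.1 : Matrix _ _ ℝ)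
      = NormedSpace.exp A)
    (h2 : (g.2 : Matrix _ _ ℝ) = NormedSpace.exp (Δ.spinRep A)) : g ∈ Δ.spinGroup :=
  Subgroup.subset_closure ⟨A, hA, h1, h2⟩

variable {Δ} in
/-- A suitable form is invariant under the spin group. -/
theorem IsCompatible.spinGroup {B : Matrix (Fin n) (Fin n) ℝ} (hB : Δ.IsCompatible B)
    {g : (Matrix (Fin m) (Fin m) ℝ)ˣ × (Matrix (Fin n) (Fin n) ℝ)ˣ}
    (hg : g ∈ Δ.spinGroup) :
    (g.2 : Matrix (Fin n) (Fin n) ℝ).transpose * B * (g.2 : Matrix (Fin n) (Fin n) ℝ) = B := by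
  induction hg using Subgroup.closure_induction with
  | one => simp
  | mul x y _ _ hx hy =>
    simp only [Prod.snd_mul, Units.val_mul, Matrix.transpose_mul]
    conv_rhs => rw [← hy, ← hx]
    simp only [mul_assoc]
  | inv x _ hx =>
    have h1 : (x.2 : Matrix (Fin n) (Fin n) ℝ) * ((x.2⁻¹ : (Matrix (Fin n) (Fin n) ℝ)ˣ) :
      Matrix (Fin n) (Fin n) ℝ) = 1 := Units.mul_inv _
    conv_lhs => rw [← hx]
    simp only [Prod.snd_inv]
    rw [mul_assoc, mul_assoc, h1, mul_one, ← mul_assoc, ← Matrix.transpose_mul, h1,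
      Matrix.transpose_one, one_mul]
  | mem x hx =>
    obtain ⟨A, hA, -, h2⟩ := hx
    rw [h2, ← Matrix.exp_transpose]
    have hs := exp_semiconj (B := B) (X := -Δ.spinRep A) (Y := (Δ.spinRep A).transpose)
      (by rw [hB.spinRep hA, mul_neg])
    rw [← hs, mul_assoc, ← Matrix.exp_add_of_commute (-Δ.spinRep A) (Δ.spinRep A)
      (Commute.neg_left (Commute.refl _)), neg_add_cancel,
      NormedSpace.exp_zero, mul_one]

/-- The Clifford product of the basis vectors with the indices in a list. -/
def word (w : List (Fin m)) : Matrix (Fin n) (Fin n) ℝ := (w.map Δ.γ).prod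

theorem γ_mul_word (i : Fin m) (w : List (Fin m)) :
    Δ.γ i * Δ.word w = (-1 : ℝ) ^ (w.length + w.count i) • (Δ.word w * Δ.γ i) := by
  induction w with
  | nil => simp [word]
  | cons j w ih =>
    have hw : Δ.word (j :: w) = Δ.γ j * Δ.word w := by simp [word]
    rw [hw]
    by_cases h : i = j
    · subst h
      rw [List.count_cons_self, List.length_cons, mul_assoc (Δ.γ i) (Δ.word w) (Δ.γ i),
        ← mul_smul_comm]
      congr 1
      rw [ih]
      congr 1
      ring
    · rw [List.count_cons_of_ne (Ne.symm h), List.length_cons, ← mul_assoc, Δ.γ_anticomm h, neg_mul,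
        mul_assoc, ih, mul_smul_comm, mul_assoc, ← neg_smul]
      congr 1
      ring

/-- A Clifford product in which every basis vector occurs an even number of times is a scalar. -/
theorem word_scalar (N : ℕ) : ∀ w : List (Fin m), w.length = N → (∀ i, Even (w.count i)) →
    ∃ c : ℝ, Δ.word w = c • 1 := by
  induction N using Nat.strong_induction_on with
  | _ N ih =>
    intro w hw he
    rcases w with _ | ⟨i, w⟩
    · exact ⟨1, by simp [word]⟩
    · have hi : i ∈ w := by
        have := he i
        rw [List.count_cons_self] at this
        rw [← List.count_pos_iff]
        by_contra h
        have : w.count i = 0 := by omega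
        simp_all
      obtain ⟨u, v, rfl⟩ := List.append_of_mem hi
      obtain ⟨c, hc⟩ := ih (u ++ v).length (by simp at hw ⊢; omega) (u ++ v) rfl (by
        intro j
        have := he j
        simp only [List.count_cons, List.count_append] at this ⊢
        by_cases hj : i = j
        · simp only [hj, beq_self_eq_true, if_true] at this
          rw [show u.count j + (v.count j + 1) + 1 = u.count j + v.count j + 2 by ring] at this
          exact (Nat.even_add.1 this).2 even_two
        · simpa [hj] using this)
      have e1 : Δ.word (i :: (u ++ i :: v)) = Δ.γ i * Δ.word u * (Δ.γ i * Δ.word v) := by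
        simp [word, mul_assoc]
      have e2 : Δ.word (u ++ v) = Δ.word u * Δ.word v := by simp [word]
      refine ⟨(-1 : ℝ) ^ (u.length + u.count i) * (-Δ.ε i) * c, ?_⟩
      rw [e1, γ_mul_word, smul_mul_assoc, mul_assoc, ← mul_assoc (Δ.γ i), γ_mul_self,
        smul_mul_assoc, one_mul, mul_smul_comm, ← e2, hc, smul_smul, smul_smul]

/-- The averaging operator over conjugation by `γ_i`. -/
def average (i : Fin m) : Module.End ℝ (Matrix (Fin n) (Fin n) ℝ) :=
  (1 / 2 : ℝ) • (1 + LinearMap.mulLeft ℝ (Δ.γ i) * LinearMap.mulRight ℝ (-Δ.ε i • Δ.γ i))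

theorem average_apply (i : Fin m) (x : Matrix (Fin n) (Fin n) ℝ) :
    Δ.average i x = (1 / 2 : ℝ) • (x + -Δ.ε i • (Δ.γ i * x * Δ.γ i)) := by
  simp [average, mul_assoc]

theorem average_of_commute {x : Matrix (Fin n) (Fin n) ℝ} {i : Fin m} {s : ℝ}
    (hx : Δ.γ i * x = s • (x * Δ.γ i)) : Δ.average i x = ((1 + s) / 2) • x := by
  rw [average_apply, hx, smul_mul_assoc, mul_assoc, γ_mul_self, mul_smul_comm, mul_one]
  simp only [smul_smul]
  have := Δ.ε_mul_self i
  nth_rewrite 1 [← one_smul ℝ x]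
  rw [← add_smul, smul_smul]
  congr 1
  linear_combination (s / 2) * this

/-- The subalgebra generated by the products of two vectors. -/
def evenAlg : Subalgebra ℝ (Matrix (Fin n) (Fin n) ℝ) :=
  Algebra.adjoin ℝ {x | ∃ i k, x = Δ.γ i * Δ.γ k}

/-- An even element of the Clifford algebra which commutes with all vectors acts as a scalar. It is
fixed by the averaging operators, and these kill all words except scalars. -/
theorem scalar_of_even {x : Matrix (Fin n) (Fin n) ℝ} (hx : x ∈ Δ.evenAlg)
    (hc : ∀ i, Δ.γ i * x = x * Δ.γ i) : ∃ c : ℝ, x = c • 1 := by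
  set T : Module.End ℝ (Matrix (Fin n) (Fin n) ℝ) := ((List.finRange m).map Δ.average).prod
  have hprod : ∀ (y : Matrix (Fin n) (Fin n) ℝ) (s : Fin m → ℝ),
      (∀ i, Δ.γ i * y = s i • (y * Δ.γ i)) → ∀ L : List (Fin m),
      (L.map Δ.average).prod y = (L.map fun i => (1 + s i) / 2).prod • y := by
    intro y s hs L
    induction L with
    | nil => simp
    | cons i L ih =>
      rw [List.map_cons, List.prod_cons, Module.End.mul_apply, ih, map_smul,
        Δ.average_of_commute (hs i), List.map_cons, List.prod_cons, smul_smul, mul_comm]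
  have hTx : T x = x := by
    rw [hprod x 1 (by simpa using hc)]
    simp
  have hle : Subalgebra.toSubmodule Δ.evenAlg ≤ (Submodule.span ℝ {1}).comap T := by
    rw [evenAlg, Algebra.adjoin_eq_span, Submodule.span_le]
    intro y hy
    obtain ⟨w, hw, rfl⟩ : ∃ w : List (Fin m), Even w.length ∧ Δ.word w = y := by
      induction hy using Submonoid.closure_induction with
      | mem y hy =>
        obtain ⟨i, k, rfl⟩ := hy
        exact ⟨[i, k], by simp, by simp [word]⟩
      | one => exact ⟨[], by simp, by simp [word]⟩
      | mul y z _ _ hy hz =>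
        obtain ⟨u, hu, rfl⟩ := hy
        obtain ⟨v, hv, rfl⟩ := hz
        exact ⟨u ++ v, by simpa using hu.add hv, by simp [word]⟩
    change T (Δ.word w) ∈ Submodule.span ℝ {1}
    rw [hprod _ _ fun i => Δ.γ_mul_word i w]
    by_cases h : ∀ i, Even (w.count i)
    · obtain ⟨c, hc⟩ := Δ.word_scalar _ w rfl h
      rw [hc]
      exact Submodule.smul_mem _ _ (Submodule.smul_mem _ _ (Submodule.mem_span_singleton_self _))
    · push Not at h
      obtain ⟨i, hi⟩ := h
      have : (List.map (fun i => (1 + (-1 : ℝ) ^ (w.length + w.count i)) / 2)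
          (List.finRange m)).prod = 0 := by
        apply List.prod_eq_zero
        rw [List.mem_map]
        exact ⟨i, List.mem_finRange i, by
          rw [(hw.add_odd (Nat.not_even_iff_odd.1 hi)).neg_one_pow]; norm_num⟩
      rw [this, zero_smul]
      exact zero_mem _
  have := hle hx
  rw [Submodule.mem_comap, hTx, Submodule.mem_span_singleton] at this
  obtain ⟨c, hc⟩ := this
  exact ⟨c, hc.symm⟩

theorem spinRep_mem_evenAlg (A : Matrix (Fin m) (Fin m) ℝ) : Δ.spinRep A ∈ Δ.evenAlg := by
  rw [spinRep_apply]
  exact Subalgebra.smul_mem Δ.evenAlg (sum_mem fun i _ => sum_mem fun k _ =>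
    Subalgebra.smul_mem Δ.evenAlg (Algebra.subset_adjoin ⟨i, k, rfl⟩) _) _

theorem exp_spinRep_mem_evenAlg (A : Matrix (Fin m) (Fin m) ℝ) :
    NormedSpace.exp (Δ.spinRep A) ∈ Δ.evenAlg :=
  (isWExp_matrix (Δ.spinRep A)).mem (W := Subalgebra.toSubmodule Δ.evenAlg)
    fun N => pow_mem (Δ.spinRep_mem_evenAlg A) N

/-- The spin group acts on spinors through the even part of the Clifford algebra. -/
theorem spinGroup_mem_evenAlg
    {g : (Matrix (Fin m) (Fin m) ℝ)ˣ × (Matrix (Fin n) (Fin n) ℝ)ˣ} (hg : g ∈ Δ.spinGroup) :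
    (g.2 : Matrix (Fin n) (Fin n) ℝ) ∈ Δ.evenAlg ∧
    ((g.2⁻¹ : (Matrix (Fin n) (Fin n) ℝ)ˣ) : Matrix (Fin n) (Fin n) ℝ) ∈ Δ.evenAlg := by
  induction hg using Subgroup.closure_induction with
  | one => simp [one_mem]
  | mul x y _ _ hx hy =>
    simp only [Prod.snd_mul, mul_inv_rev, Units.val_mul]
    exact ⟨mul_mem hx.1 hy.1, mul_mem hy.2 hx.2⟩
  | inv x _ hx =>
    simp only [Prod.snd_inv, inv_inv]
    exact hx.symm
  | mem x hx =>
    obtain ⟨A, hA, -, h2⟩ := hx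
    refine ⟨by rw [h2]; exact Δ.exp_spinRep_mem_evenAlg A, ?_⟩
    have : ((x.2⁻¹ : (Matrix (Fin n) (Fin n) ℝ)ˣ) : Matrix (Fin n) (Fin n) ℝ)
        = NormedSpace.exp (Δ.spinRep (-A)) := by
      rw [map_neg, Matrix.exp_neg, ← h2, Matrix.coe_units_inv]
    rw [this]
    exact Δ.exp_spinRep_mem_evenAlg _

/-- The odd matrix `C^{ji} = e^i(π(s ∨ θ^j))` of a spinor `s`, where `B` is the matrix of the form
which defines `π`. -/
def oddMat (B : Matrix (Fin n) (Fin n) ℝ) (s : Fin n → ℝ) : Matrix (Fin n) (Fin m) ℝ :=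
  Matrix.of fun j i => Δ.ε i * Matrix.vecMul ((Δ.γ i).mulVec s) B j

theorem oddMat_apply (B : Matrix (Fin n) (Fin n) ℝ) (s : Fin n → ℝ) (j : Fin n) (i : Fin m) :
    Δ.oddMat B s j i = Δ.ε i * Matrix.vecMul ((Δ.γ i).mulVec s) B j := rfl

variable {Δ} in
/-- The odd matrices form a representation of `𝔰𝔭𝔦𝔫`, since `π` is equivariant. -/
theorem oddMat_bracket {B : Matrix (Fin n) (Fin n) ℝ} (hB : Δ.IsCompatible B)
    {A : Matrix (Fin m) (Fin m) ℝ} (hA : A ∈ Δ.so) (s : Fin n → ℝ) :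
    Δ.oddMat B s * A.transpose - (Δ.spinRep A).transpose * Δ.oddMat B s
      = Δ.oddMat B ((Δ.spinRep A).mulVec s) := by
  ext j i
  have h1 : ((Δ.spinRep A).transpose * Δ.oddMat B s) j i
      = -(Δ.ε i * Matrix.vecMul ((Δ.spinRep A).mulVec ((Δ.γ i).mulVec s)) B j) := by
    have e1 : Matrix.vecMul ((Δ.spinRep A).mulVec ((Δ.γ i).mulVec s)) B
        = -Matrix.vecMul (Matrix.vecMul ((Δ.γ i).mulVec s) B) (Δ.spinRep A) := by
      rw [Matrix.vecMul_vecMul, ← Matrix.vecMul_transpose (Δ.spinRep A), Matrix.vecMul_vecMul,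
        hB.spinRep hA, Matrix.vecMul_neg]
    rw [e1, Matrix.mul_apply, Pi.neg_apply, mul_neg, neg_neg, Matrix.vecMul, dotProduct,
      Finset.mul_sum]
    refine Finset.sum_congr rfl fun b _ => ?_
    rw [oddMat_apply, Matrix.transpose_apply]; ring
  have h2 : (Δ.oddMat B s * A.transpose) j i
      = -(Δ.ε i * Matrix.vecMul ((∑ k, A k i • Δ.γ k).mulVec s) B j) := by
    rw [Matrix.sum_mulVec, Matrix.sum_vecMul, Finset.sum_apply, Finset.mul_sum,
      ← Finset.sum_neg_distrib, Matrix.mul_apply]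
    refine Finset.sum_congr rfl fun l _ => ?_
    rw [oddMat_apply, Matrix.transpose_apply, Matrix.smul_mulVec, Matrix.smul_vecMul,
      Pi.smul_apply, smul_eq_mul]
    linear_combination (Matrix.vecMul ((Δ.γ l).mulVec s) B j) * so_apply' hA i l
  rw [Matrix.sub_apply, h1, h2, ← spinRep_γ hA, Matrix.sub_mulVec, Matrix.sub_vecMul, oddMat_apply,
    Matrix.mulVec_mulVec, Matrix.mulVec_mulVec, Pi.sub_apply]
  ring

end SpinorModule

namespace SpinorModule

variable (Δ : SpinorModule m n)

theorem diagonal_mul_self : Matrix.diagonal Δ.ε * Matrix.diagonal Δ.ε = 1 := by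
  rw [Matrix.diagonal_mul_diagonal, ← Matrix.diagonal_one]
  congr 1
  funext i
  exact Δ.ε_mul_self i

variable {Δ}

/-- The spin group acts by isometries. -/
theorem spinGroup_orth {g : (Matrix (Fin m) (Fin m) ℝ)ˣ × (Matrix (Fin n) (Fin n) ℝ)ˣ}
    (hg : g ∈ Δ.spinGroup) : (g.1 : Matrix (Fin m) (Fin m) ℝ).transpose * Matrix.diagonal Δ.ε *
      (g.1 : Matrix (Fin m) (Fin m) ℝ) = Matrix.diagonal Δ.ε := by
  induction hg using Subgroup.closure_induction with
  | one => simp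
  | mul x y _ _ hx hy =>
    simp only [Prod.fst_mul, Units.val_mul, Matrix.transpose_mul]
    conv_rhs => rw [← hy, ← hx]
    simp only [mul_assoc]
  | inv x _ hx =>
    have h1 : (x.1 : Matrix (Fin m) (Fin m) ℝ) * ((x.1⁻¹ : (Matrix (Fin m) (Fin m) ℝ)ˣ) :
      Matrix (Fin m) (Fin m) ℝ) = 1 := Units.mul_inv _
    conv_lhs => rw [← hx]
    simp only [Prod.fst_inv]
    rw [mul_assoc, mul_assoc, h1, mul_one, ← mul_assoc, ← Matrix.transpose_mul, h1,
      Matrix.transpose_one, one_mul]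
  | mem x hx =>
    obtain ⟨A, hA, h2, -⟩ := hx
    rw [h2, ← Matrix.exp_transpose]
    have hA' : A.transpose * Matrix.diagonal Δ.ε + Matrix.diagonal Δ.ε * A = 0 := hA
    have hs := exp_semiconj (B := Matrix.diagonal Δ.ε) (X := -A) (Y := A.transpose)
      (by rw [mul_neg]; exact (eq_neg_of_add_eq_zero_left hA').symm)
    rw [← hs, mul_assoc, ← Matrix.exp_add_of_commute (-A) A
      (Commute.neg_left (Commute.refl _)), neg_add_cancel, NormedSpace.exp_zero, mul_one]

/-- The action of the spin group is compatible with Clifford multiplication. -/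
theorem spinGroup_γ {g : (Matrix (Fin m) (Fin m) ℝ)ˣ × (Matrix (Fin n) (Fin n) ℝ)ˣ}
    (hg : g ∈ Δ.spinGroup) (l : Fin m) : (g.2 : Matrix (Fin n) (Fin n) ℝ) * Δ.γ l =
      (∑ j, (g.1 : Matrix (Fin m) (Fin m) ℝ) j l • Δ.γ j) * (g.2 : Matrix (Fin n) (Fin n) ℝ) := by
  induction hg using Subgroup.closure_induction generalizing l with
  | one => simp [Matrix.one_apply]
  | mul x y _ _ hx hy =>
    simp only [Prod.fst_mul, Prod.snd_mul, Units.val_mul]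
    rw [mul_assoc, hy, ← mul_assoc, Finset.mul_sum]
    simp only [mul_smul_comm, hx, ← smul_mul_assoc, ← Finset.sum_mul, ← mul_assoc]
    congr 2
    simp only [Finset.smul_sum, smul_smul, Matrix.mul_apply, Finset.sum_smul]
    rw [Finset.sum_comm]
    exact Finset.sum_congr rfl fun i _ => Finset.sum_congr rfl fun j _ => by rw [mul_comm]
  | inv x _ hx =>
    have h1 : (x.2 : Matrix (Fin n) (Fin n) ℝ) * ((x.2⁻¹ : (Matrix (Fin n) (Fin n) ℝ)ˣ) :
      Matrix (Fin n) (Fin n) ℝ) = 1 := Units.mul_inv _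
    have h2 : ((x.2⁻¹ : (Matrix (Fin n) (Fin n) ℝ)ˣ) : Matrix (Fin n) (Fin n) ℝ) *
      (x.2 : Matrix (Fin n) (Fin n) ℝ) = 1 := Units.inv_mul _
    have h3 : (x.1 : Matrix (Fin m) (Fin m) ℝ) * ((x.1⁻¹ : (Matrix (Fin m) (Fin m) ℝ)ˣ) :
      Matrix (Fin m) (Fin m) ℝ) = 1 := Units.mul_inv _
    simp only [Prod.fst_inv, Prod.snd_inv]
    have h4 : (x.2 : Matrix (Fin n) (Fin n) ℝ) *
        (∑ j, ((x.1⁻¹ : (Matrix (Fin m) (Fin m) ℝ)ˣ) : Matrix (Fin m) (Fin m) ℝ) j l • Δ.γ j) =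
        Δ.γ l * (x.2 : Matrix (Fin n) (Fin n) ℝ) := by
      rw [Finset.mul_sum]
      simp only [mul_smul_comm, hx, ← smul_mul_assoc, ← Finset.sum_mul]
      congr 1
      simp only [Finset.smul_sum, smul_smul]
      rw [Finset.sum_comm]
      have : ∀ j, ∑ i, (((x.1⁻¹ : (Matrix (Fin m) (Fin m) ℝ)ˣ) : Matrix (Fin m) (Fin m) ℝ) i l *
          (x.1 : Matrix (Fin m) (Fin m) ℝ) j i) • Δ.γ j =
          (1 : Matrix (Fin m) (Fin m) ℝ) j l • Δ.γ j := by
        intro j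
        rw [← h3, Matrix.mul_apply, Finset.sum_smul]
        exact Finset.sum_congr rfl fun i _ => by rw [mul_comm]
      rw [Finset.sum_congr rfl fun j _ => this j]
      simp [Matrix.one_apply]
    calc _ = ((x.2⁻¹ : (Matrix (Fin n) (Fin n) ℝ)ˣ) : Matrix (Fin n) (Fin n) ℝ) *
          (Δ.γ l * (x.2 : Matrix (Fin n) (Fin n) ℝ)) *
          ((x.2⁻¹ : (Matrix (Fin n) (Fin n) ℝ)ˣ) : Matrix (Fin n) (Fin n) ℝ) := by
            rw [mul_assoc, mul_assoc, h1, mul_one]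
      _ = _ := by rw [← h4, ← mul_assoc, h2, one_mul]
  | mem x hx =>
    obtain ⟨A, hA, h1, h2⟩ := hx
    rw [h1, h2, ← sub_eq_zero, ← Submodule.mem_bot ℝ]
    -- the commutator with `R A` preserves the span of the `γ_j` and acts there as `A`
    let Γ : (Fin m → ℝ) →ₗ[ℝ] Matrix (Fin n) (Fin n) ℝ :=
      { toFun := fun v => ∑ j, v j • Δ.γ j
        map_add' := fun v w => by simp [add_smul, Finset.sum_add_distrib]
        map_smul' := fun c v => by simp [smul_smul, Finset.smul_sum] }
    have hΓ : ∀ v, Δ.spinRep A * Γ v - Γ v * Δ.spinRep A = Γ (A.mulVec v) := by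
      intro v
      change Δ.spinRep A * (∑ j, v j • Δ.γ j) - (∑ j, v j • Δ.γ j) * Δ.spinRep A =
        ∑ k, (A.mulVec v) k • Δ.γ k
      simp only [Finset.mul_sum, Finset.sum_mul, mul_smul_comm, smul_mul_assoc, Matrix.mulVec,
        dotProduct, Finset.sum_smul]
      rw [← Finset.sum_sub_distrib, Finset.sum_comm]
      refine Finset.sum_congr rfl fun j _ => ?_
      rw [← smul_sub, spinRep_γ hA, Finset.smul_sum]
      exact Finset.sum_congr rfl fun k _ => by rw [smul_smul, mul_comm]
    have hR := isWExp_matrix (Δ.spinRep A)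
    have hR' := isWExp_matrix (-Δ.spinRep A)
    have hinv : NormedSpace.exp (-Δ.spinRep A) * NormedSpace.exp (Δ.spinRep A) = 1 := by
      rw [← Matrix.exp_add_of_commute (-Δ.spinRep A) (Δ.spinRep A)
        (Commute.neg_left (Commute.refl _)), neg_add_cancel, NormedSpace.exp_zero]
    have h3 : IsWExp (LinearMap.mulLeft ℝ (Δ.spinRep A))
        (LinearMap.mulLeft ℝ (NormedSpace.exp (Δ.spinRep A))) :=
      hR.map (LinearMap.mul ℝ _) fun N => (LinearMap.pow_mulLeft ℝ _ (Δ.spinRep A) N).symm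
    have h4 : IsWExp (LinearMap.mulRight ℝ (-Δ.spinRep A))
        (LinearMap.mulRight ℝ (NormedSpace.exp (-Δ.spinRep A))) :=
      hR'.map (LinearMap.mul ℝ _).flip fun N => (LinearMap.pow_mulRight ℝ _ (-Δ.spinRep A) N).symm
    have h5 := h3.mul h4 (by ext x; simp [mul_assoc])
    have hN : ∀ (N : ℕ) v, ((LinearMap.mulLeft ℝ (Δ.spinRep A) +
        LinearMap.mulRight ℝ (-Δ.spinRep A)) ^ N) (Γ v) = Γ ((A ^ N).mulVec v) := by
      intro N
      induction N with
      | zero => intro v; simp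
      | succ N ih =>
        intro v
        rw [pow_succ, Module.End.mul_apply]
        have : (LinearMap.mulLeft ℝ (Δ.spinRep A) + LinearMap.mulRight ℝ (-Δ.spinRep A)) (Γ v) =
            Γ (A.mulVec v) := by
          rw [← hΓ]; simp [sub_eq_add_neg]
        rw [this, ih, Matrix.mulVec_mulVec, pow_succ]
    have key : ∀ v, NormedSpace.exp (Δ.spinRep A) * Γ v * NormedSpace.exp (-Δ.spinRep A) =
        Γ ((NormedSpace.exp A).mulVec v) := by
      intro v
      refine eq_of_forall_dual fun f => ?_
      have e1 := h5 (f ∘ₗ LinearMap.applyₗ (Γ v))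
      have e2 := isWExp_matrix A (f ∘ₗ Γ ∘ₗ (Matrix.mulVecBilin ℝ ℝ).flip v)
      simp only [LinearMap.comp_apply, LinearMap.applyₗ_apply_apply, hN] at e1
      have := e1.unique e2
      simpa [mul_assoc] using this
    have hl : ∀ B : Matrix (Fin m) (Fin m) ℝ,
        Γ (B.mulVec (Pi.single l 1)) = ∑ j, B j l • Δ.γ j := by
      intro B
      change ∑ j, (B.mulVec (Pi.single l 1)) j • Δ.γ j = _
      simp
    have h6 := key (Pi.single l 1)
    have h7 := hl 1
    rw [Matrix.one_mulVec] at h7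
    rw [hl, h7] at h6
    have h8 : ∑ j, (1 : Matrix (Fin m) (Fin m) ℝ) j l • Δ.γ j = Δ.γ l := by
      simp [Matrix.one_apply]
    rw [Submodule.mem_bot, sub_eq_zero, ← h6, h8, mul_assoc, mul_assoc, hinv, mul_one]

end SpinorModule

variable {m n : ℕ}
  {M : Type*} [TopologicalSpace M] [ChartedSpace (EuclideanSpace ℝ (Fin m)) M]
  [IsManifold (𝓡 m) ∞ M]
  {S : M → Type*} [TopologicalSpace (TotalSpace (EuclideanSpace ℝ (Fin n)) S)]
  [∀ p, TopologicalSpace (S p)] [∀ p, AddCommGroup (S p)] [∀ p, Module ℝ (S p)]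
  [∀ p, IsTopologicalAddGroup (S p)] [∀ p, ContinuousSMul ℝ (S p)]
  [FiberBundle (EuclideanSpace ℝ (Fin n)) S] [VectorBundle ℝ (EuclideanSpace ℝ (Fin n)) S]
  [ContMDiffVectorBundle ∞ (EuclideanSpace ℝ (Fin n)) S (𝓡 m)]

/-! ### Calculus of smooth functions and sections -/

section Calculus

variable {W V : Opens M}

theorem SmoothFun.mono {h : M → ℝ} (hh : SmoothFun m W h) (hV : V ≤ W) : SmoothFun m V h :=
  ContMDiffOn.mono hh hV

theorem SmoothSec.mono {t : ∀ p : M, S p} (ht : SmoothSec m n W t) (hV : V ≤ W) :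
    SmoothSec m n V t :=
  ContMDiffOn.mono ht hV

theorem SmoothVec.mono {Y : ∀ p : M, TangentSpace (𝓡 m) p} (hY : SmoothVec W Y) (hV : V ≤ W) :
    SmoothVec V Y :=
  ContMDiffOn.mono hY hV

theorem smoothFun_const (c : ℝ) : SmoothFun m W fun _ => c := contMDiffOn_const

theorem SmoothFun.add {h k : M → ℝ} (hh : SmoothFun m W h) (hk : SmoothFun m W k) :
    SmoothFun m W fun p => h p + k p :=
  ContMDiffOn.add hh hk

theorem SmoothFun.mul {h k : M → ℝ} (hh : SmoothFun m W h) (hk : SmoothFun m W k) :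
    SmoothFun m W fun p => h p * k p :=
  ContMDiffOn.mul hh hk

theorem SmoothFun.sum {ι : Type*} (s : Finset ι) {h : ι → M → ℝ}
    (hh : ∀ i ∈ s, SmoothFun m W (h i)) : SmoothFun m W fun p => ∑ i ∈ s, h i p :=
  contMDiffOn_finsetSum hh

theorem SmoothFun.prod {ι : Type*} (s : Finset ι) {h : ι → M → ℝ}
    (hh : ∀ i ∈ s, SmoothFun m W (h i)) : SmoothFun m W fun p => ∏ i ∈ s, h i p :=
  contMDiffOn_finsetProd hh

theorem SmoothFun.congr {h k : M → ℝ} (hh : SmoothFun m W h) (H : ∀ p ∈ W, k p = h p) :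
    SmoothFun m W k :=
  ContMDiffOn.congr hh H

theorem SmoothSec.add {t t' : ∀ p : M, S p} (ht : SmoothSec m n W t) (ht' : SmoothSec m n W t') :
    SmoothSec m n W fun p => t p + t' p :=
  ContMDiffOn.add_section ht ht'

theorem SmoothSec.smul {h : M → ℝ} {t : ∀ p : M, S p} (hh : SmoothFun m W h)
    (ht : SmoothSec m n W t) : SmoothSec m n W fun p => h p • t p :=
  ContMDiffOn.smul_section hh ht

theorem SmoothSec.sum {ι : Type*} (s : Finset ι) {t : ι → ∀ p : M, S p}
    (ht : ∀ i ∈ s, SmoothSec m n W (t i)) : SmoothSec m n W fun p => ∑ i ∈ s, t i p :=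
  ContMDiffOn.sum_section ht

theorem SmoothVec.smul {h : M → ℝ} {Y : ∀ p : M, TangentSpace (𝓡 m) p} (hh : SmoothFun m W h)
    (hY : SmoothVec W Y) : SmoothVec W fun p => h p • Y p :=
  ContMDiffOn.smul_section hh hY

theorem SmoothFun.mdifferentiableAt {h : M → ℝ} (hh : SmoothFun m W h) {p : M} (hp : p ∈ W) :
    MDifferentiableAt (𝓡 m) 𝓘(ℝ, ℝ) h p :=
  (ContMDiffOn.contMDiffAt hh (W.isOpen.mem_nhds hp)).mdifferentiableAt (by simp)

theorem SmoothSec.mdifferentiableAt {t : ∀ p : M, S p} (ht : SmoothSec m n W t) {p : M}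
    (hp : p ∈ W) : MDifferentiableAt (𝓡 m) ((𝓡 m).prod 𝓘(ℝ, EuclideanSpace ℝ (Fin n)))
      (fun p => TotalSpace.mk' (EuclideanSpace ℝ (Fin n)) p (t p)) p :=
  (ContMDiffOn.contMDiffAt ht (W.isOpen.mem_nhds hp)).mdifferentiableAt (by simp)

theorem dirDeriv_const (c : ℝ) (p : M) (v : TangentSpace (𝓡 m) p) :
    dirDeriv (fun _ : M => c) p v = 0 := by
  rw [dirDeriv, mfderiv_const]; rfl

theorem dirDeriv_add {h k : M → ℝ} {p : M} (hh : MDifferentiableAt (𝓡 m) 𝓘(ℝ, ℝ) h p)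
    (hk : MDifferentiableAt (𝓡 m) 𝓘(ℝ, ℝ) k p) (v : TangentSpace (𝓡 m) p) :
    dirDeriv (fun q => h q + k q) p v = dirDeriv h p v + dirDeriv k p v := by
  have := (hh.hasMFDerivAt.add hk.hasMFDerivAt).mfderiv
  rw [dirDeriv]
  exact congrArg (fun L : TangentSpace (𝓡 m) p →L[ℝ] ℝ => L v) this

theorem dirDeriv_mul {h k : M → ℝ} {p : M} (hh : MDifferentiableAt (𝓡 m) 𝓘(ℝ, ℝ) h p)
    (hk : MDifferentiableAt (𝓡 m) 𝓘(ℝ, ℝ) k p) (v : TangentSpace (𝓡 m) p) :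
    dirDeriv (fun q => h q * k q) p v = dirDeriv h p v * k p + h p * dirDeriv k p v := by
  have := (hh.hasMFDerivAt.mul hk.hasMFDerivAt).mfderiv
  rw [dirDeriv]
  refine (congrArg (fun L : TangentSpace (𝓡 m) p →L[ℝ] ℝ => L v) this).trans ?_
  change h p * dirDeriv k p v + k p * dirDeriv h p v = _
  ring

theorem dirDeriv_sum {ι : Type*} (s : Finset ι) {h : ι → M → ℝ} {p : M}
    (hh : ∀ i ∈ s, MDifferentiableAt (𝓡 m) 𝓘(ℝ, ℝ) (h i) p) (v : TangentSpace (𝓡 m) p) :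
    MDifferentiableAt (𝓡 m) 𝓘(ℝ, ℝ) (fun q => ∑ i ∈ s, h i q) p ∧
    dirDeriv (fun q => ∑ i ∈ s, h i q) p v = ∑ i ∈ s, dirDeriv (h i) p v := by
  classical
  induction s using Finset.induction_on with
  | empty => simp [dirDeriv_const, mdifferentiableAt_const]
  | insert a s ha ih =>
    have ih := ih fun i hi => hh i (Finset.mem_insert_of_mem hi)
    have ha' := hh a (Finset.mem_insert_self a s)
    simp only [Finset.sum_insert ha]
    exact ⟨ha'.add ih.1, by rw [dirDeriv_add ha' ih.1, ih.2]⟩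

theorem dirDeriv_congr {h k : M → ℝ} {p : M} (hp : p ∈ W) (H : ∀ q ∈ W, h q = k q)
    (v : TangentSpace (𝓡 m) p) : dirDeriv h p v = dirDeriv k p v := by
  have : h =ᶠ[𝓝 p] k := Filter.eventuallyEq_of_mem (W.isOpen.mem_nhds hp) H
  rw [dirDeriv, dirDeriv]
  exact congrArg (fun L : TangentSpace (𝓡 m) p →L[ℝ] ℝ => L v) (this.mfderiv_eq)

variable (DS : CovariantDerivative (𝓡 m) (EuclideanSpace ℝ (Fin n)) S)

theorem cov_add {t t' : ∀ p : M, S p} (ht : SmoothSec m n W t) (ht' : SmoothSec m n W t')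
    {p : M} (hp : p ∈ W) (v : TangentSpace (𝓡 m) p) :
    DS (fun q => t q + t' q) p v = DS t p v + DS t' p v := by
  have := DS.isCovariantDerivativeOnUniv.add (ht.mdifferentiableAt hp) (ht'.mdifferentiableAt hp)
  exact congrArg (fun L : TangentSpace (𝓡 m) p →L[ℝ] S p => L v) this

theorem cov_smul {h : M → ℝ} {t : ∀ p : M, S p} (hh : SmoothFun m W h) (ht : SmoothSec m n W t)
    {p : M} (hp : p ∈ W) (v : TangentSpace (𝓡 m) p) :
    DS (fun q => h q • t q) p v = h p • DS t p v + dirDeriv h p v • t p := by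
  have := DS.isCovariantDerivativeOnUniv.leibniz (ht.mdifferentiableAt hp)
    (hh.mdifferentiableAt hp)
  exact congrArg (fun L : TangentSpace (𝓡 m) p →L[ℝ] S p => L v) this

theorem cov_sum {ι : Type*} (s : Finset ι) {h : ι → M → ℝ} {t : ι → ∀ p : M, S p}
    (hh : ∀ i ∈ s, SmoothFun m W (h i)) (ht : ∀ i ∈ s, SmoothSec m n W (t i)) {p : M} (hp : p ∈ W)
    (v : TangentSpace (𝓡 m) p) :
    DS (fun q => ∑ i ∈ s, h i q • t i q) p v
      = ∑ i ∈ s, (h i p • DS (t i) p v + dirDeriv (h i) p v • t i p) := by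
  classical
  induction s using Finset.induction_on with
  | empty =>
    simp only [Finset.sum_empty]
    have := DS.isCovariantDerivativeOnUniv.zero (x := p)
    exact congrArg (fun L : TangentSpace (𝓡 m) p →L[ℝ] S p => L v) this
  | insert a s ha ih =>
    have hh' := fun i hi => hh i (Finset.mem_insert_of_mem hi)
    have ht' := fun i hi => ht i (Finset.mem_insert_of_mem hi)
    have ha' := hh a (Finset.mem_insert_self a s)
    have hat := ht a (Finset.mem_insert_self a s)
    simp only [Finset.sum_insert ha]
    rw [cov_add DS (SmoothSec.smul ha' hat)
      (SmoothSec.sum s fun i hi => (ht' i hi).smul (hh' i hi)) hp, ih hh' ht',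
      cov_smul DS ha' hat hp]

theorem smoothFun_det {k : ℕ} {A : Fin k → Fin k → M → ℝ} (hA : ∀ i j, SmoothFun m W (A i j)) :
    SmoothFun m W fun p => (Matrix.of fun i j => A i j p).det := by
  simp only [Matrix.det_apply']
  exact SmoothFun.sum _ fun σ _ => (smoothFun_const _).mul (SmoothFun.prod _ fun i _ => hA _ _)

theorem SmoothFun.inv {h : M → ℝ} (hh : SmoothFun m W h) (h0 : ∀ p ∈ W, h p ≠ 0) :
    SmoothFun m W fun p => (h p)⁻¹ :=
  ContMDiffOn.inv₀ hh h0

/-- The coefficients of a smooth section in a smooth frame are smooth, by Cramer's rule in a local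
trivialization. -/
theorem contMDiffOn_coord {k : ℕ} {F : M → Type*}
    [TopologicalSpace (TotalSpace (EuclideanSpace ℝ (Fin k)) F)]
    [∀ p, TopologicalSpace (F p)] [∀ p, AddCommGroup (F p)] [∀ p, Module ℝ (F p)]
    [FiberBundle (EuclideanSpace ℝ (Fin k)) F] [VectorBundle ℝ (EuclideanSpace ℝ (Fin k)) F]
    [ContMDiffVectorBundle ∞ (EuclideanSpace ℝ (Fin k)) F (𝓡 m)]
    (b : ∀ p, Module.Basis (Fin k) ℝ (F p))
    (hb : ∀ j, ContMDiffOn (𝓡 m) ((𝓡 m).prod 𝓘(ℝ, EuclideanSpace ℝ (Fin k))) ∞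
      (fun p => TotalSpace.mk' (EuclideanSpace ℝ (Fin k)) p (b p j)) W)
    {t : ∀ p, F p} (ht : ContMDiffOn (𝓡 m) ((𝓡 m).prod 𝓘(ℝ, EuclideanSpace ℝ (Fin k))) ∞
      (fun p => TotalSpace.mk' (EuclideanSpace ℝ (Fin k)) p (t p)) W) (j : Fin k) :
    SmoothFun m W fun p => (b p).coord j (t p) := by
  intro x hx
  let e := trivializationAt (EuclideanSpace ℝ (Fin k)) F x
  let V : Opens M := ⟨W ∩ e.baseSet, W.isOpen.inter e.open_baseSet⟩
  have hxV : x ∈ V := ⟨hx, FiberBundle.mem_baseSet_trivializationAt' x⟩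
  have key : ∀ u : ∀ p, F p, ContMDiffOn (𝓡 m) ((𝓡 m).prod 𝓘(ℝ, EuclideanSpace ℝ (Fin k))) ∞
      (fun p => TotalSpace.mk' (EuclideanSpace ℝ (Fin k)) p (u p)) W → ∀ i : Fin k,
      SmoothFun m V fun p => (e ⟨p, u p⟩).2 i := by
    intro u hu i
    have h1 : ContMDiffOn (𝓡 m) 𝓘(ℝ, EuclideanSpace ℝ (Fin k)) ∞ (fun p => (e ⟨p, u p⟩).2) V := by
      intro p hp
      have h2 := (hu.contMDiffAt (W.isOpen.mem_nhds hp.1))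
      exact (((Trivialization.contMDiffAt_section_iff (s := u) e hp.2).1 h2)).contMDiffWithinAt
    let pr : EuclideanSpace ℝ (Fin k) →L[ℝ] ℝ := EuclideanSpace.proj i
    exact (pr.contMDiff (n := ∞)).comp_contMDiffOn h1
  let L : ∀ p, F p →ₗ[ℝ] (Fin k → ℝ) := fun p =>
    (WithLp.linearEquiv 2 ℝ (Fin k → ℝ)).toLinearMap ∘ₗ e.linearMapAt ℝ p
  have hL : ∀ p ∈ V, ∀ v i, L p v i = (e ⟨p, v⟩).2 i := by
    intro p hp v i
    have := e.coe_linearMapAt_of_mem (R := ℝ) hp.2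
    simp [L, this]
  let P : M → Matrix (Fin k) (Fin k) ℝ := fun p => Matrix.of fun i l => (e ⟨p, b p l⟩).2 i
  have hdet : ∀ p ∈ V, (P p).det ≠ 0 := by
    intro p hp
    let b' : Module.Basis (Fin k) ℝ (Fin k → ℝ) := (b p).map
      ((e.linearEquivAt ℝ p hp.2).trans (WithLp.linearEquiv 2 ℝ (Fin k → ℝ)))
    have : P p = (Pi.basisFun ℝ (Fin k)).toMatrix b' := by
      ext i l
      simp [P, Module.Basis.toMatrix_apply, b']
    rw [this]
    have := (Module.Basis.toMatrix_mul_toMatrix_flip (Pi.basisFun ℝ (Fin k)) b')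
    have h := congrArg Matrix.det this
    rw [Matrix.det_mul, Matrix.det_one] at h
    exact left_ne_zero_of_mul_eq_one h
  have hcr : ∀ p ∈ V, (b p).coord j (t p) =
      ((P p).updateCol j (fun i => (e ⟨p, t p⟩).2 i)).det * ((P p).det)⁻¹ := by
    intro p hp
    have h1 : (fun i => (e ⟨p, t p⟩).2 i) = (P p).mulVec fun l => (b p).coord l (t p) := by
      ext i
      rw [← hL p hp]
      conv_lhs => rw [← (b p).sum_repr (t p)]
      rw [map_sum, Finset.sum_apply, Matrix.mulVec, dotProduct]
      refine Finset.sum_congr rfl fun l _ => ?_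
      rw [map_smul, Pi.smul_apply, hL p hp]
      simp [P, mul_comm]
    have h2 := congrFun (Matrix.mulVec_cramer (P p) (fun i => (e ⟨p, t p⟩).2 i))
    have h3 : (P p).cramer ((P p).mulVec fun l => (b p).coord l (t p)) =
        (P p).det • fun l => (b p).coord l (t p) := by
      rw [Matrix.cramer_eq_adjugate_mulVec, Matrix.mulVec_mulVec, Matrix.adjugate_mul,
        Matrix.smul_mulVec, Matrix.one_mulVec]
    rw [← Matrix.cramer_apply, h1, h3, Pi.smul_apply, smul_eq_mul, mul_comm, ← mul_assoc,
      inv_mul_cancel₀ (hdet p hp), one_mul]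
  have hs : SmoothFun m V fun p => (b p).coord j (t p) := by
    refine SmoothFun.congr ?_ hcr
    refine SmoothFun.mul ?_ (SmoothFun.inv (smoothFun_det fun i l => key _ (hb l) i) hdet)
    have : ∀ p, (P p).updateCol j (fun i => (e ⟨p, t p⟩).2 i) = Matrix.of fun i l =>
        (if l = j then fun p => (e ⟨p, t p⟩).2 i else fun p => (e ⟨p, b p l⟩).2 i) p := by
      intro p
      ext i l
      rw [Matrix.updateCol_apply]
      simp only [Matrix.of_apply, P]
      split_ifs <;> rfl
    simp only [this]
    refine smoothFun_det fun i l => ?_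
    split_ifs
    · exact key _ ht i
    · exact key _ (hb l) i
  exact (ContMDiffOn.contMDiffAt hs (V.isOpen.mem_nhds hxV)).contMDiffWithinAt

theorem SmoothFrame.coord_sec {f : ∀ p : M, Frame m n S p} (hf : SmoothFrame W f)
    {t : ∀ p : M, S p} (ht : SmoothSec m n V t) (hV : V ≤ W) (j : Fin n) :
    SmoothFun m V fun p => (f p).2.coord j (t p) :=
  contMDiffOn_coord (fun p => (f p).2) (fun j => (hf.2 j).mono hV) ht j

theorem SmoothFrame.coord_vec {f : ∀ p : M, Frame m n S p} (hf : SmoothFrame W f)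
    {Y : ∀ p : M, TangentSpace (𝓡 m) p} (hY : SmoothVec V Y) (hV : V ≤ W) (j : Fin m) :
    SmoothFun m V fun p => (f p).1.coord j (Y p) :=
  contMDiffOn_coord (fun p => (f p).1) (fun j => (hf.1 j).mono hV) hY j

end Calculus

/-- The ring structure of `𝒜(W)`, with the canonical semiring structure as a syntactic component, so
that instances of the two kinds are unified without unfolding. -/
instance (W : Opens M) : Ring (superFun m n S W) :=
  { toSemiring := Subalgebra.toSemiring (superFun m n S W)
    __ := Subalgebra.toRing (superFun m n S W) }

/-! ### The sheaf of functions on the supermanifold -/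

section Functions

variable {U W V : Opens M}

variable (m n) in
/-- Evaluation of functions on `M(S)` at a point of `M`. -/
def ev (W : Opens M) (p : W) : superFun m n S W →ₐ[ℝ] ExteriorAlgebra ℝ (S p) :=
  (Pi.evalAlgHom ℝ (fun p : W => ExteriorAlgebra ℝ (S p)) p).comp (superFun m n S W).val

theorem ev_invol (p : W) (f : superFun m n S W) :
    ev m n W p (invol W f) = CliffordAlgebra.involute (ev m n W p f) := rfl

theorem superFun_ext {f g : superFun m n S W} (h : ∀ p : W, ev m n W p f = ev m n W p g) :
    f = g :=
  Subtype.ext (funext h)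

theorem isSuperComm_invol (W : Opens M) : IsSuperComm (invol (m := m) (n := n) (S := S) W) := by
  refine ⟨fun a => ?_, fun a b ha => ?_, fun a b ha => ?_⟩
  · exact superFun_ext fun p => isSuperComm_involute.invol _
  · refine superFun_ext fun p => ?_
    rw [map_mul, map_mul]
    exact isSuperComm_involute.even_comm _ _ (by rw [← ev_invol, ha])
  · refine superFun_ext fun p => ?_
    rw [map_mul, map_mul, ev_invol]
    exact isSuperComm_involute.odd_comm _ _ (by rw [← ev_invol, ha, map_neg])

theorem ev_interior (σ : Covector m n S U) (W : Set.Iic U) (p : W.1) (f : superFun m n S W.1) :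
    ev m n W.1 p (interior σ W f) = CliffordAlgebra.contractLeft (σ.toFun p) (ev m n W.1 p f) := rfl

theorem isOddDeriv_interior (σ : Covector m n S U) (W : Set.Iic U) :
    IsOddDeriv (invol (m := m) (n := n) (S := S) W.1) (interior σ W) := by
  refine ⟨fun a b => superFun_ext fun p => ?_, fun a => superFun_ext fun p => ?_⟩
  · simp only [map_add, map_mul, ev_interior, ev_invol]
    exact raw_leibniz _ _ _
  · simp only [map_neg, ev_interior, ev_invol]
    exact involute_contractLeft _ _

theorem ev_res (h : V ≤ W) (p : V) (f : superFun m n S W) :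
    ev m n V p (res h f) = ev m n W ⟨p, h p.2⟩ f := rfl

/-- Membership in `𝒜(W)` is local. -/
theorem mem_superFun_of_local {f : RawFun S W}
    (h : ∀ p ∈ W, ∃ V : Opens M, ∃ hV : V ≤ W, p ∈ V ∧ rawRes hV f ∈ superFun m n S V) :
    f ∈ superFun m n S W := by
  intro p hp
  obtain ⟨V, hV, hpV, hf⟩ := h p hp
  obtain ⟨V', hV', hpV', hf'⟩ := hf p hpV
  exact ⟨V', hV'.trans hV, hpV', hf'⟩

end Functions

/-! ### Smooth maps into finite dimensional vector spaces -/

section SmoothVal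

variable {W : Opens M} {E : Type*} [AddCommGroup E] [Module ℝ E]

variable (m) in
/-- The map `F` into a finite dimensional vector space is smooth on `W`. -/
def SmoothVal (W : Opens M) (F : M → E) : Prop :=
  ∀ l : Module.Dual ℝ E, SmoothFun m W fun p => l (F p)

/-- The derivative of a map `F` into a finite dimensional vector space in the direction `v`. -/
def valDeriv [FiniteDimensional ℝ E] (F : M → E) (p : M) (v : TangentSpace (𝓡 m) p) : E :=
  ∑ i, dirDeriv (fun q => (Module.finBasis ℝ E).repr (F q) i) p v • Module.finBasis ℝ E i

theorem SmoothVal.congr {F G : M → E} (hF : SmoothVal m W F) (h : ∀ p ∈ W, G p = F p) :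
    SmoothVal m W G :=
  fun l => (hF l).congr fun p hp => by rw [h p hp]

theorem SmoothVal.mono {F : M → E} (hF : SmoothVal m W F) {V : Opens M} (hV : V ≤ W) :
    SmoothVal m V F :=
  fun l => (hF l).mono hV

theorem SmoothVal.map {E' : Type*} [AddCommGroup E'] [Module ℝ E'] {F : M → E}
    (hF : SmoothVal m W F) (L : E →ₗ[ℝ] E') : SmoothVal m W fun p => L (F p) :=
  fun l => hF (l ∘ₗ L)

theorem SmoothVal.add {F G : M → E} (hF : SmoothVal m W F) (hG : SmoothVal m W G) :
    SmoothVal m W fun p => F p + G p := by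
  intro l
  simp only [map_add]
  exact (hF l).add (hG l)

theorem smoothVal_smul_const {h : M → ℝ} (hh : SmoothFun m W h) (x : E) :
    SmoothVal m W fun p => h p • x := by
  intro l
  simp only [map_smul, smul_eq_mul]
  exact hh.mul (smoothFun_const _)

variable [FiniteDimensional ℝ E]

theorem SmoothVal.repr {F : M → E} (hF : SmoothVal m W F) (i) :
    SmoothFun m W fun q => (Module.finBasis ℝ E).repr (F q) i :=
  hF ((Module.finBasis ℝ E).coord i)

/-- The derivative `valDeriv`, which is computed in a basis, is characterised by linear forms. -/
theorem SmoothVal.dual_valDeriv {F : M → E} (hF : SmoothVal m W F) {p : M} (hp : p ∈ W)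
    (v : TangentSpace (𝓡 m) p) (l : Module.Dual ℝ E) :
    l (valDeriv F p v) = dirDeriv (fun q => l (F q)) p v := by
  have h : ∀ q, l (F q) = ∑ i, (Module.finBasis ℝ E).repr (F q) i * l (Module.finBasis ℝ E i) := by
    intro q
    conv_lhs => rw [← (Module.finBasis ℝ E).sum_repr (F q)]
    rw [map_sum]
    simp only [map_smul, smul_eq_mul]
  simp only [h]
  rw [(dirDeriv_sum _ (fun i _ => ((hF.repr i).mul (smoothFun_const _)).mdifferentiableAt hp) v).2,
    valDeriv, map_sum]
  refine Finset.sum_congr rfl fun i _ => ?_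
  rw [dirDeriv_mul ((hF.repr i).mdifferentiableAt hp) ((smoothFun_const _).mdifferentiableAt hp),
    dirDeriv_const, mul_zero, add_zero, map_smul, smul_eq_mul]

theorem valDeriv_congr {F G : M → E} {p : M} (hp : p ∈ W) (h : ∀ q ∈ W, F q = G q)
    (v : TangentSpace (𝓡 m) p) : valDeriv F p v = valDeriv G p v := by
  simp only [valDeriv]
  refine Finset.sum_congr rfl fun i _ => ?_
  rw [dirDeriv_congr hp (fun q hq => by rw [h q hq])]

theorem SmoothVal.valDeriv_map {E' : Type*} [AddCommGroup E'] [Module ℝ E']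
    [FiniteDimensional ℝ E'] {F : M → E}
    (hF : SmoothVal m W F) (L : E →ₗ[ℝ] E') {p : M} (hp : p ∈ W) (v : TangentSpace (𝓡 m) p) :
    valDeriv (fun q => L (F q)) p v = L (valDeriv F p v) := by
  refine eq_of_forall_dual fun l => ?_
  rw [(hF.map L).dual_valDeriv hp]
  exact (hF.dual_valDeriv hp v (l ∘ₗ L)).symm

theorem SmoothVal.valDeriv_add {F G : M → E} (hF : SmoothVal m W F) (hG : SmoothVal m W G)
    {p : M} (hp : p ∈ W) (v : TangentSpace (𝓡 m) p) :
    valDeriv (fun q => F q + G q) p v = valDeriv F p v + valDeriv G p v := by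
  refine eq_of_forall_dual fun l => ?_
  rw [(hF.add hG).dual_valDeriv hp, map_add, hF.dual_valDeriv hp, hG.dual_valDeriv hp]
  simp only [map_add]
  exact dirDeriv_add ((hF l).mdifferentiableAt hp) ((hG l).mdifferentiableAt hp) v

theorem valDeriv_smul_const {h : M → ℝ} (hh : SmoothFun m W h) (x : E)
    {p : M} (hp : p ∈ W) (v : TangentSpace (𝓡 m) p) :
    valDeriv (fun q => h q • x) p v = dirDeriv h p v • x := by
  refine eq_of_forall_dual fun l => ?_
  rw [(smoothVal_smul_const hh x).dual_valDeriv hp, map_smul, smul_eq_mul]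
  simp only [map_smul, smul_eq_mul]
  rw [dirDeriv_mul (hh.mdifferentiableAt hp) ((smoothFun_const _).mdifferentiableAt hp),
    dirDeriv_const, mul_zero, add_zero]

variable {B : Type*} [Ring B] [Algebra ℝ B] [FiniteDimensional ℝ B]

theorem dual_mul_eq (l : Module.Dual ℝ B) (x y : B) : l (x * y)
    = ∑ i, (Module.finBasis ℝ B).repr x i * l (Module.finBasis ℝ B i * y) := by
  conv_lhs => rw [← (Module.finBasis ℝ B).sum_repr x]
  rw [Finset.sum_mul, map_sum]
  simp only [smul_mul_assoc, map_smul, smul_eq_mul]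

theorem SmoothVal.mul {F G : M → B} (hF : SmoothVal m W F) (hG : SmoothVal m W G) :
    SmoothVal m W fun p => F p * G p := by
  intro l
  simp only [dual_mul_eq l (F _)]
  exact SmoothFun.sum _ fun i _ => (hF.repr i).mul
    (hG (l ∘ₗ LinearMap.mulLeft ℝ (Module.finBasis ℝ B i)))

theorem SmoothVal.valDeriv_mul {F G : M → B} (hF : SmoothVal m W F) (hG : SmoothVal m W G)
    {p : M} (hp : p ∈ W) (v : TangentSpace (𝓡 m) p) :
    valDeriv (fun q => F q * G q) p v = valDeriv F p v * G p + F p * valDeriv G p v := by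
  refine eq_of_forall_dual fun l => ?_
  have hl : ∀ i, SmoothFun m W fun q => l (Module.finBasis ℝ B i * G q) :=
    fun i => (hG (l ∘ₗ LinearMap.mulLeft ℝ (Module.finBasis ℝ B i)))
  rw [(hF.mul hG).dual_valDeriv hp, map_add, dual_mul_eq l (F p)]
  simp only [dual_mul_eq l (F _)]
  rw [(dirDeriv_sum _ (fun i _ => ((hF.repr i).mul (hl i)).mdifferentiableAt hp) v).2]
  have : ∀ i, dirDeriv (fun q => (Module.finBasis ℝ B).repr (F q) i *
      l (Module.finBasis ℝ B i * G q)) p v =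
      dirDeriv (fun q => (Module.finBasis ℝ B).repr (F q) i) p v * l (Module.finBasis ℝ B i * G p)
      + (Module.finBasis ℝ B).repr (F p) i * l (Module.finBasis ℝ B i * valDeriv G p v) := by
    intro i
    rw [dirDeriv_mul ((hF.repr i).mdifferentiableAt hp) ((hl i).mdifferentiableAt hp)]
    congr 2
    exact (hG.dual_valDeriv hp v (l ∘ₗ LinearMap.mulLeft ℝ (Module.finBasis ℝ B i))).symm
  simp only [this, Finset.sum_add_distrib]
  congr 1
  rw [valDeriv, Finset.sum_mul, map_sum]
  simp only [smul_mul_assoc, map_smul, smul_eq_mul]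

end SmoothVal

/-! ### Functions on the supermanifold in a local frame -/

section LocalCoordinates

variable {U W V : Opens M} (b : ∀ p : M, Module.Basis (Fin n) ℝ (S p))

/-- The trivialization of `⋀S` given by a frame of `S`. -/
def triv (p : M) : ExteriorAlgebra ℝ (S p) →ₐ[ℝ] ExteriorAlgebra ℝ (Fin n → ℝ) :=
  ExteriorAlgebra.map (b p).equivFun.toLinearMap

/-- The inverse of the trivialization of `⋀S` given by a frame of `S`. -/
def trivSymm (p : M) : ExteriorAlgebra ℝ (Fin n → ℝ) →ₐ[ℝ] ExteriorAlgebra ℝ (S p) :=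
  ExteriorAlgebra.map (b p).equivFun.symm.toLinearMap

theorem trivSymm_triv (p : M) (x : ExteriorAlgebra ℝ (S p)) : trivSymm b p (triv b p x) = x := by
  have : (trivSymm b p).comp (triv b p) = AlgHom.id ℝ _ := by
    rw [trivSymm, triv, ExteriorAlgebra.map_comp_map,
      ← ExteriorAlgebra.map_id (R := ℝ) (M := S p)]
    congr 1
    ext x
    simp
  exact DFunLike.congr_fun this x

theorem triv_trivSymm (p : M) (x : ExteriorAlgebra ℝ (Fin n → ℝ)) :
    triv b p (trivSymm b p x) = x := by
  have : (triv b p).comp (trivSymm b p) = AlgHom.id ℝ _ := by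
    rw [trivSymm, triv, ExteriorAlgebra.map_comp_map,
      ← ExteriorAlgebra.map_id (R := ℝ) (M := Fin n → ℝ)]
    congr 1
    ext x
    simp
  exact DFunLike.congr_fun this x

theorem involute_exteriorι {E : Type*} [AddCommGroup E] [Module ℝ E] (v : E) :
    CliffordAlgebra.involute (ExteriorAlgebra.ι ℝ v) = -ExteriorAlgebra.ι ℝ v :=
  CliffordAlgebra.involute_ι _

theorem triv_involute (p : M) (x : ExteriorAlgebra ℝ (S p)) :
    triv b p (CliffordAlgebra.involute x) = CliffordAlgebra.involute (triv b p x) := by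
  have : (triv b p).comp CliffordAlgebra.involute = CliffordAlgebra.involute.comp (triv b p) := by
    refine ExteriorAlgebra.hom_ext (LinearMap.ext fun v => ?_)
    change triv b p (CliffordAlgebra.involute (ExteriorAlgebra.ι ℝ v)) =
      CliffordAlgebra.involute (triv b p (ExteriorAlgebra.ι ℝ v))
    rw [involute_exteriorι, map_neg, triv, ExteriorAlgebra.map_apply_ι, involute_exteriorι]
  exact DFunLike.congr_fun this x

/-- A section of `⋀S`, in the trivialization given by a frame of `S`. -/
def loc (f : RawFun S W) (p : M) : ExteriorAlgebra ℝ (Fin n → ℝ) :=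
  open Classical in if hp : p ∈ W then triv b p (f ⟨p, hp⟩) else 0

theorem loc_apply (f : RawFun S W) {p : M} (hp : p ∈ W) : loc b f p = triv b p (f ⟨p, hp⟩) :=
  dif_pos hp

variable {b}

theorem smoothFun_coord (hb : ∀ a, SmoothSec m n U fun p => b p a)
    {t : ∀ p : M, S p} (ht : SmoothSec m n V t) (hV : V ≤ U) (j : Fin n) :
    SmoothFun m V fun p => (b p).coord j (t p) :=
  contMDiffOn_coord b (fun j => (hb j).mono hV) ht j

/-- The generators of the sheaf of functions, smooth functions and smooth sections of `S`, have smooth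
coordinates in a smooth frame field. -/
theorem smoothVal_loc_of_generated (hb : ∀ a, SmoothSec m n U fun p => b p a)
    (hV : V ≤ U) {f : RawFun S V} (hf : f ∈ generated m n S V) :
    SmoothVal m V (loc b f) := by
  induction hf using Algebra.adjoin_induction with
  | mem f hf =>
    rcases hf with ⟨h, hh, rfl⟩ | ⟨t, ht, rfl⟩
    · refine (smoothVal_smul_const hh (1 : ExteriorAlgebra ℝ (Fin n → ℝ))).congr fun p hp => ?_
      rw [loc_apply b _ hp]
      change triv b p (algebraMap ℝ _ (h p)) = _
      rw [AlgHom.commutes, Algebra.algebraMap_eq_smul_one]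
    · have : ∀ p ∈ V, loc b (rawOfSec V t) p
          = ∑ j, (b p).coord j (t p) • ExteriorAlgebra.ι ℝ (Pi.single j (1 : ℝ)) := by
        intro p hp
        rw [loc_apply b _ hp]
        change triv b p (ExteriorAlgebra.ι ℝ (t p)) = _
        rw [triv, ExteriorAlgebra.map_apply_ι]
        simp only [← map_smul, ← map_sum]
        congr 1
        ext j
        simp [Finset.sum_apply, Pi.single_apply]
      refine SmoothVal.congr ?_ this
      intro l
      simp only [map_sum, map_smul, smul_eq_mul]
      exact SmoothFun.sum _ fun j _ => (smoothFun_coord hb ht hV j).mul (smoothFun_const _)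
  | algebraMap r =>
    refine (smoothVal_smul_const (smoothFun_const r)
      (1 : ExteriorAlgebra ℝ (Fin n → ℝ))).congr fun p hp => ?_
    rw [loc_apply b _ hp]
    change triv b p (algebraMap ℝ _ r) = _
    rw [AlgHom.commutes, Algebra.algebraMap_eq_smul_one]
  | add f g _ _ hf hg =>
    refine (hf.add hg).congr fun p hp => ?_
    rw [loc_apply b _ hp, loc_apply b _ hp, loc_apply b _ hp]
    exact map_add _ _ _
  | mul f g _ _ hf hg =>
    refine (hf.mul hg).congr fun p hp => ?_
    rw [loc_apply b _ hp, loc_apply b _ hp, loc_apply b _ hp]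
    exact map_mul _ _ _

/-- The components of a function on `M(S)` in a smooth frame of `S` are smooth. -/
theorem smoothVal_loc (hb : ∀ a, SmoothSec m n U fun p => b p a)
    (hW : W ≤ U) (f : superFun m n S W) : SmoothVal m W (loc b f.1) := by
  intro l p hp
  obtain ⟨V, hV, hpV, hf⟩ := f.2 p hp
  have h1 := smoothVal_loc_of_generated hb (hV.trans hW) hf l
  have h2 : SmoothFun m V fun p => l (loc b f.1 p) := h1.congr fun q hq => by
    rw [loc_apply b _ hq, loc_apply b _ (hV hq)]; rfl
  exact (ContMDiffOn.contMDiffAt h2 (V.isOpen.mem_nhds hpV)).contMDiffWithinAt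

theorem trivSymm_const_mem (hb : ∀ a, SmoothSec m n U fun p => b p a)
    (hW : W ≤ U) (x : ExteriorAlgebra ℝ (Fin n → ℝ)) :
    (fun p : W => trivSymm b p x) ∈ generated m n S W := by
  induction x using ExteriorAlgebra.induction with
  | algebraMap r =>
    convert algebraMap_mem (generated m n S W) r using 1
    ext p
    exact AlgHom.commutes _ _
  | ι v =>
    refine Algebra.subset_adjoin (Or.inr ⟨fun p => ∑ j, v j • b p j,
      SmoothSec.sum _ fun j _ => SmoothSec.smul (smoothFun_const _) ((hb j).mono hW), ?_⟩)
    ext p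
    change trivSymm b p (ExteriorAlgebra.ι ℝ v) = ExteriorAlgebra.ι ℝ _
    rw [trivSymm, ExteriorAlgebra.map_apply_ι]
    congr 1
    simp [Module.Basis.equivFun_symm_apply]
  | mul x y hx hy =>
    convert mul_mem hx hy using 1
    ext p
    exact map_mul _ _ _
  | add x y hx hy =>
    convert add_mem hx hy using 1
    ext p
    exact map_add _ _ _

/-- Sections of `⋀S` with smooth components in a smooth frame of `S` are functions on `M(S)`. -/
theorem trivSymm_mem (hb : ∀ a, SmoothSec m n U fun p => b p a)
    (hW : W ≤ U) {F : M → ExteriorAlgebra ℝ (Fin n → ℝ)}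
    (hF : SmoothVal m W F) : (fun p : W => trivSymm b p (F p)) ∈ superFun m n S W := by
  apply generated_le_superFun
  have : (fun p : W => trivSymm b p (F p)) = ∑ i, rawOfFun S W
      (fun p => (Module.finBasis ℝ (ExteriorAlgebra ℝ (Fin n → ℝ))).repr (F p) i) *
      fun p : W => trivSymm b p (Module.finBasis ℝ (ExteriorAlgebra ℝ (Fin n → ℝ)) i) := by
    ext p
    rw [Finset.sum_apply]
    conv_lhs => rw [← (Module.finBasis ℝ (ExteriorAlgebra ℝ (Fin n → ℝ))).sum_repr (F p)]
    rw [map_sum]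
    refine Finset.sum_congr rfl fun i _ => ?_
    rw [map_smul, Algebra.smul_def]
    rfl
  rw [this]
  exact sum_mem fun i _ => mul_mem (Algebra.subset_adjoin (Or.inl ⟨_, hF.repr i, rfl⟩))
    (trivSymm_const_mem hb hW _)

end LocalCoordinates

/-! ### Derivations of the sheaf of functions -/

section Derivations

variable {U W V : Opens M}

theorem endo_ext {X Y : Endo m n S U}
    (h : ∀ (W : Set.Iic U) (f : superFun m n S W.1) (p : W.1),
      ev m n W.1 p (X W f) = ev m n W.1 p (Y W f)) : X = Y :=
  funext fun W => LinearMap.ext fun f => superFun_ext fun p => h W f p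

theorem invol_invol (f : superFun m n S W) : invol W (invol W f) = f :=
  (isSuperComm_invol W).invol f

theorem even_eq_iff {X : Endo m n S U} :
    X.even = X ↔ ∀ (W : Set.Iic U) (f : superFun m n S W.1),
      X W (invol W.1 f) = invol W.1 (X W f) := by
  constructor
  · intro h W f
    have h1 : (1 / 2 : ℝ) • (X W f + invol W.1 (X W (invol W.1 f))) = X W f :=
      LinearMap.congr_fun (congrFun h W) f
    have h2 : invol W.1 (X W (invol W.1 f)) = X W f := by
      have : X W f + invol W.1 (X W (invol W.1 f)) = (2 : ℝ) • X W f := by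
        rw [← h1, smul_smul, mul_one_div_cancel two_ne_zero, one_smul, h1]
      rw [two_smul] at this
      exact add_left_cancel this
    rw [← h2, invol_invol]
  · intro h
    funext W
    refine LinearMap.ext fun f => ?_
    change (1 / 2 : ℝ) • (X W f + invol W.1 (X W (invol W.1 f))) = X W f
    rw [h, invol_invol, ← two_smul ℝ, smul_smul, one_div_mul_cancel two_ne_zero, one_smul]

theorem odd_eq_iff {X : Endo m n S U} :
    X.odd = X ↔ ∀ (W : Set.Iic U) (f : superFun m n S W.1),
      X W (invol W.1 f) = -invol W.1 (X W f) := by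
  constructor
  · intro h W f
    have h1 : (1 / 2 : ℝ) • (X W f - invol W.1 (X W (invol W.1 f))) = X W f :=
      LinearMap.congr_fun (congrFun h W) f
    have h2 : -invol W.1 (X W (invol W.1 f)) = X W f := by
      have : X W f + -invol W.1 (X W (invol W.1 f)) = (2 : ℝ) • X W f := by
        rw [← sub_eq_add_neg, ← h1, smul_smul, mul_one_div_cancel two_ne_zero, one_smul, h1]
      rw [two_smul] at this
      exact add_left_cancel this
    rw [← h2, map_neg, invol_invol, neg_neg]
  · intro h
    funext W
    refine LinearMap.ext fun f => ?_
    change (1 / 2 : ℝ) • (X W f - invol W.1 (X W (invol W.1 f))) = X W f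
    rw [h, map_neg, invol_invol, sub_neg_eq_add, ← two_smul ℝ, smul_smul,
      one_div_mul_cancel two_ne_zero, one_smul]

theorem odd_of_even {X : Endo m n S U} (h : X.even = X) : X.odd = 0 := by
  funext W
  refine LinearMap.ext fun f => ?_
  change (1 / 2 : ℝ) • (X W f - invol W.1 (X W (invol W.1 f))) = 0
  rw [even_eq_iff.1 h, invol_invol, sub_self, smul_zero]

theorem even_of_odd {X : Endo m n S U} (h : X.odd = X) : X.even = 0 := by
  funext W
  refine LinearMap.ext fun f => ?_
  change (1 / 2 : ℝ) • (X W f + invol W.1 (X W (invol W.1 f))) = 0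
  rw [odd_eq_iff.1 h, map_neg, invol_invol, add_neg_cancel, smul_zero]

/-- A (twisted) derivation of the sheaf of functions on `M(S)` is determined by its values on smooth
functions and smooth sections of `S`. -/
theorem der_unique {X Y : Endo m n S U} (hX : X.IsLocal) (hY : Y.IsLocal)
    (κ : ∀ W : Set.Iic U, superFun m n S W.1 → superFun m n S W.1)
    (hX' : ∀ W f g, X W (f * g) = X W f * g + κ W f * X W g)
    (hY' : ∀ W f g, Y W (f * g) = Y W f * g + κ W f * Y W g)
    (hfun : ∀ (W : Set.Iic U) (h : M → ℝ) (hh : SmoothFun m W.1 h),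
      X W (ofFun n S h hh) = Y W (ofFun n S h hh))
    (hsec : ∀ (W : Set.Iic U) (t : ∀ p : M, S p) (ht : SmoothSec m n W.1 t),
      X W (ofSec t ht) = Y W (ofSec t ht)) : X = Y := by
  refine endo_ext fun W f p => ?_
  obtain ⟨V, hV, hpV, hf⟩ := f.2 p p.2
  have key : ∀ (g : RawFun S V) (hg : g ∈ generated m n S V),
      X ⟨V, hV.trans W.2⟩ ⟨g, generated_le_superFun V hg⟩
        = Y ⟨V, hV.trans W.2⟩ ⟨g, generated_le_superFun V hg⟩ := by
    intro g hg
    induction hg using Algebra.adjoin_induction with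
    | mem g hg =>
      rcases hg with ⟨h, hh, rfl⟩ | ⟨t, ht, rfl⟩
      · exact hfun ⟨V, _⟩ h hh
      · exact hsec ⟨V, _⟩ t ht
    | algebraMap r => exact hfun ⟨V, _⟩ (fun _ => r) (smoothFun_const r)
    | add f g hf' hg' hf hg =>
      have : (⟨f + g, generated_le_superFun V (add_mem hf' hg')⟩ : superFun m n S V)
          = ⟨f, generated_le_superFun V hf'⟩ + ⟨g, generated_le_superFun V hg'⟩ := rfl
      rw [this, map_add, map_add, hf, hg]
    | mul f g hf' hg' hf hg =>
      have : (⟨f * g, generated_le_superFun V (mul_mem hf' hg')⟩ : superFun m n S V)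
          = ⟨f, generated_le_superFun V hf'⟩ * ⟨g, generated_le_superFun V hg'⟩ := rfl
      rw [this, hX', hY', hf, hg]
  have h1 := key _ hf
  have h2 : (⟨rawRes hV f.1, generated_le_superFun V hf⟩ : superFun m n S V) = res hV f := rfl
  rw [h2, hX ⟨V, hV.trans W.2⟩ W hV, hY ⟨V, hV.trans W.2⟩ W hV] at h1
  exact congrArg (ev m n V ⟨p, hpV⟩) h1

theorem isLocal_interior (σ : Covector m n S U) : (interior σ).IsLocal :=
  fun _ _ _ _ => superFun_ext fun _ => rfl

theorem isOddDer_interior (σ : Covector m n S U) : IsOddDer (interior σ) :=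
  ⟨isLocal_interior σ, odd_eq_iff.2 fun W => (isOddDeriv_interior σ W).odd,
    fun W => (isOddDeriv_interior σ W).leibniz⟩

theorem isVectorField_interior (σ : Covector m n S U) : IsVectorField (interior σ) := by
  refine ⟨0, interior σ, ⟨fun _ _ _ _ => (map_zero _).symm, ?_, ?_⟩, isOddDer_interior σ,
    (zero_add _).symm⟩
  · exact even_eq_iff.2 fun W f => (map_zero (invol W.1)).symm
  · intro W f g
    change (0 : superFun m n S W.1) = 0 * g + f * 0
    rw [zero_mul, mul_zero, add_zero]

theorem interior_ofFun (σ : Covector m n S U) (W : Set.Iic U) (h : M → ℝ)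
    (hh : SmoothFun m W.1 h) : interior σ W (ofFun n S h hh) = 0 :=
  superFun_ext fun _ => CliffordAlgebra.contractLeft_algebraMap _ _ _

theorem interior_ofSec (σ : Covector m n S U) (W : Set.Iic U) (t : ∀ p : M, S p)
    (ht : SmoothSec m n W.1 t) :
    interior σ W (ofSec t ht) = ofFun n S _ (σ.smooth W.1 W.2 t ht) :=
  superFun_ext fun _ => CliffordAlgebra.contractLeft_ι _ _ _

end Derivations

/-! ### Covariant differentiation of functions on the supermanifold -/

section Nabla

variable {U : Opens M} {b : ∀ p : M, Module.Basis (Fin n) ℝ (S p)}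
  (hb : ∀ a, SmoothSec m n U fun p => b p a)
  {DS : CovariantDerivative (𝓡 m) (EuclideanSpace ℝ (Fin n)) S}
  (hDS : ∀ (W : Opens M) (Y : ∀ p : M, TangentSpace (𝓡 m) p) (t : ∀ p : M, S p),
    SmoothVec W Y → SmoothSec m n W t → SmoothSec m n W fun p => DS t p (Y p))
  {Y : ∀ p : M, TangentSpace (𝓡 m) p} (hY : SmoothVec U Y)

/-- The covector field dual to a frame field of `S`. -/
def coordCovector (hb : ∀ a, SmoothSec m n U fun p => b p a) (j : Fin n) : Covector m n S U where
  toFun p := (b p).coord j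
  smooth _ hW _ ht := smoothFun_coord hb ht hW j

include hb hDS in
/-- The derivative of a smooth function along `Y` is smooth. Since `S` has positive rank, it is a
coefficient in the Leibniz rule for `∇_Y (h • b₀)`, all other terms of which are smooth. -/
theorem smoothFun_dirDeriv (hn : 0 < n) {W : Opens M} (hW : W ≤ U) (hY : SmoothVec W Y)
    {h : M → ℝ} (hh : SmoothFun m W h) : SmoothFun m W fun p => dirDeriv h p (Y p) := by
  have h0 := (hb ⟨0, hn⟩).mono hW
  have h1 := hDS W Y _ hY (h0.smul hh)
  have h2 := (hDS W Y _ hY h0).smul hh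
  have h3 := h1.add (h2.smul (smoothFun_const (-1)))
  refine (smoothFun_coord hb h3 hW ⟨0, hn⟩).congr fun p hp => ?_
  rw [cov_smul DS hh h0 hp]
  simp

variable (hdir : ∀ W ≤ U, ∀ h : M → ℝ, SmoothFun m W h → SmoothFun m W fun p => dirDeriv h p (Y p))

include hb hdir in
theorem smoothVal_valDeriv_loc {W : Opens M} (hW : W ≤ U) (f : superFun m n S W) :
    SmoothVal m W fun p => valDeriv (loc b f.1) p (Y p) := by
  intro l
  exact (hdir W hW _ (smoothVal_loc hb hW f l)).congr fun p hp =>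
    (smoothVal_loc hb hW f).dual_valDeriv hp (Y p) l

/-- The derivative along `Y` of the components in a frame field of `S`. -/
def flatPart (hb : ∀ a, SmoothSec m n U fun p => b p a)
    (hdir : ∀ W ≤ U, ∀ h : M → ℝ, SmoothFun m W h → SmoothFun m W fun p => dirDeriv h p (Y p)) :
    Endo m n S U := fun W =>
  { toFun := fun f => ⟨fun p => trivSymm b p (valDeriv (loc b f.1) p (Y p)),
      trivSymm_mem hb W.2 (smoothVal_valDeriv_loc hb hdir W.2 f)⟩
    map_add' := fun f g => by
      refine superFun_ext fun p => ?_
      change trivSymm b p (valDeriv (loc b (f + g).1) p (Y p)) =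
        trivSymm b p (valDeriv (loc b f.1) p (Y p)) + trivSymm b p (valDeriv (loc b g.1) p (Y p))
      rw [← map_add, ← (smoothVal_loc hb W.2 f).valDeriv_add (smoothVal_loc hb W.2 g) p.2]
      congr 1
      refine valDeriv_congr p.2 (fun q hq => ?_) _
      rw [loc_apply b _ hq, loc_apply b _ hq, loc_apply b _ hq, ← map_add]
      rfl
    map_smul' := fun c f => by
      refine superFun_ext fun p => ?_
      change trivSymm b p (valDeriv (loc b (c • f).1) p (Y p)) =
        c • trivSymm b p (valDeriv (loc b f.1) p (Y p))
      rw [← map_smul]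
      congr 1
      refine (valDeriv_congr (G := fun q => (c • LinearMap.id) (loc b f.1 q)) p.2
        (fun q hq => ?_) _).trans ((smoothVal_loc hb W.2 f).valDeriv_map _ p.2 _)
      rw [loc_apply b _ hq, loc_apply b _ hq, LinearMap.smul_apply, LinearMap.id_apply, ← map_smul]
      rfl }

/-- The derivative along `Y` of a frame field of `S`, extended to a derivation of `⋀S`. -/
def connPart (hb : ∀ a, SmoothSec m n U fun p => b p a)
    (hDS : ∀ (W : Opens M) (Y : ∀ p : M, TangentSpace (𝓡 m) p) (t : ∀ p : M, S p),
      SmoothVec W Y → SmoothSec m n W t → SmoothSec m n W fun p => DS t p (Y p))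
    (hY : SmoothVec U Y) : Endo m n S U := fun W =>
  ∑ j, LinearMap.mulLeft ℝ (res W.2 (ofSec _ (hDS U Y _ hY (hb j)))) ∘ₗ
    interior (coordCovector hb j) W

theorem ev_flatPart (W : Set.Iic U) (f : superFun m n S W.1) (p : W.1) :
    ev m n W.1 p (flatPart hb hdir W f) = trivSymm b p (valDeriv (loc b f.1) p (Y p)) := rfl

theorem ev_connPart (W : Set.Iic U) (f : superFun m n S W.1) (p : W.1) :
    ev m n W.1 p (connPart hb hDS hY W f) = ∑ j, ExteriorAlgebra.ι ℝ (DS (fun q => b q j) p (Y p)) *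
      CliffordAlgebra.contractLeft ((b p).coord j) (ev m n W.1 p f) := by
  rw [connPart, LinearMap.sum_apply, map_sum]
  rfl

/-- The vector field `∇_Y` on `M(S)`, for a vector field `Y` over the domain of a frame field of
`S`. -/
def nabla : Endo m n S U := flatPart hb hdir + connPart hb hDS hY

theorem ev_nabla (W : Set.Iic U) (f : superFun m n S W.1) (p : W.1) :
    ev m n W.1 p (nabla hb hDS hY hdir W f) = trivSymm b p (valDeriv (loc b f.1) p (Y p)) +
      ∑ j, ExteriorAlgebra.ι ℝ (DS (fun q => b q j) p (Y p)) *
      CliffordAlgebra.contractLeft ((b p).coord j) (ev m n W.1 p f) := by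
  rw [← ev_connPart hb hDS hY, ← ev_flatPart hb hdir, ← map_add]
  rfl

theorem isEvenDer_nabla : IsEvenDer (nabla hb hDS hY hdir) := by
  refine ⟨fun V W h f => superFun_ext fun p => ?_,
    even_eq_iff.2 fun W f => superFun_ext fun p => ?_,
    fun W f g => superFun_ext fun p => ?_⟩
  · rw [ev_res, ev_nabla, ev_nabla]
    congr 2
    exact valDeriv_congr (W := V.1) p.2 (fun q hq => by
      rw [loc_apply b _ hq, loc_apply b _ (h hq)]; rfl) _
  · rw [ev_invol, ev_nabla, ev_nabla, map_add, map_sum]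
    congr 1
    · have h1 : valDeriv (loc b (invol W.1 f).1) p (Y p)
          = CliffordAlgebra.involute (valDeriv (loc b f.1) p (Y p)) := by
        refine (valDeriv_congr (G := fun q => (CliffordAlgebra.involute :
          ExteriorAlgebra ℝ (Fin n → ℝ) →ₐ[ℝ] _).toLinearMap (loc b f.1 q)) p.2
          (fun q hq => ?_) _).trans ((smoothVal_loc hb W.2 f).valDeriv_map _ p.2 _)
        rw [loc_apply b _ hq, loc_apply b _ hq]
        exact triv_involute b q _
      rw [h1]
      have h2 := triv_involute b p (trivSymm b p (valDeriv (loc b f.1) p (Y p)))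
      rw [triv_trivSymm] at h2
      rw [← h2, trivSymm_triv]
    · refine Finset.sum_congr rfl fun j _ => ?_
      rw [ev_invol, involute_contractLeft, map_mul, involute_exteriorι, mul_neg, neg_mul]
  · rw [map_add, map_mul (ev m n W.1 p) _ g, map_mul (ev m n W.1 p) f, ev_nabla, ev_nabla, ev_nabla]
    have h1 : valDeriv (loc b (f * g).1) p (Y p) = valDeriv (loc b f.1) p (Y p) * loc b g.1 p +
        loc b f.1 p * valDeriv (loc b g.1) p (Y p) := by
      rw [← (smoothVal_loc hb W.2 f).valDeriv_mul (smoothVal_loc hb W.2 g) p.2]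
      refine valDeriv_congr p.2 (fun q hq => ?_) _
      rw [loc_apply b _ hq, loc_apply b _ hq, loc_apply b _ hq, ← map_mul]
      rfl
    have h2 : ∀ f : superFun m n S W.1, trivSymm b p (loc b f.1 p) = ev m n W.1 p f := by
      intro f
      rw [loc_apply b _ p.2, trivSymm_triv]; rfl
    rw [h1, map_add, map_mul, map_mul, h2, h2, add_mul, mul_add]
    have h3 : ∀ j, ExteriorAlgebra.ι ℝ (DS (fun q => b q j) p (Y p)) *
        CliffordAlgebra.contractLeft ((b p).coord j) (ev m n W.1 p (f * g)) =
        ExteriorAlgebra.ι ℝ (DS (fun q => b q j) p (Y p)) *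
          CliffordAlgebra.contractLeft ((b p).coord j) (ev m n W.1 p f) * ev m n W.1 p g +
        ev m n W.1 p f * (ExteriorAlgebra.ι ℝ (DS (fun q => b q j) p (Y p)) *
          CliffordAlgebra.contractLeft ((b p).coord j) (ev m n W.1 p g)) := by
      intro j
      rw [map_mul]
      have e1 := raw_leibniz ((b p).coord j) (ev m n W.1 p f) (ev m n W.1 p g)
      rw [e1, mul_add, ← mul_assoc, ← mul_assoc, ← mul_assoc, ι_mul_eq_involute_mul _
        (CliffordAlgebra.involute _), CliffordAlgebra.involute_involute]
    simp only [h3, Finset.sum_add_distrib, Finset.sum_mul, Finset.mul_sum]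
    abel

/-- The derivation `nabla` is `∇_Y`: it restricts to `Y` on smooth functions, and on smooth sections of
`S` the Leibniz rule in the frame field yields the covariant derivative. -/
theorem isNabla_nabla : IsNabla DS Y (nabla hb hDS hY hdir) := by
  refine ⟨isEvenDer_nabla hb hDS hY hdir, fun W h hh => ?_, fun W t ht => ?_⟩
  · funext p
    refine (ev_nabla hb hDS hY hdir W _ p).trans ?_
    have h1 : valDeriv (loc b (ofFun n S h hh).1) p (Y p)
        = dirDeriv h p (Y p) • (1 : ExteriorAlgebra ℝ (Fin n → ℝ)) := by
      rw [← valDeriv_smul_const hh _ p.2]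
      refine valDeriv_congr p.2 (fun q hq => ?_) _
      rw [loc_apply b _ hq]
      change triv b q (algebraMap ℝ _ (h q)) = _
      rw [AlgHom.commutes, Algebra.algebraMap_eq_smul_one]
    have h2 : ∀ j, CliffordAlgebra.contractLeft ((b p).coord j)
        (ev m n W.1 p (ofFun n S h hh)) = 0 :=
      fun j => CliffordAlgebra.contractLeft_algebraMap _ _ _
    rw [h1, map_smul, map_one]
    simp only [h2, mul_zero, Finset.sum_const_zero, add_zero]
    exact (Algebra.algebraMap_eq_smul_one _).symm
  · funext p
    refine (ev_nabla hb hDS hY hdir W _ p).trans ?_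
    have hc := fun j => smoothFun_coord hb ht W.2 j
    have h1 : valDeriv (loc b (ofSec t ht).1) p (Y p) = ExteriorAlgebra.ι ℝ
        (fun j => dirDeriv (fun q => (b q).coord j (t q)) p (Y p)) := by
      have e1 : SmoothVal m W.1 fun q => fun j => (b q).coord j (t q) := by
        intro l
        have : ∀ v : Fin n → ℝ, l v = ∑ j, v j * l (Pi.single j 1) := by
          intro v
          conv_lhs => rw [pi_eq_sum_univ' v]
          rw [map_sum]
          simp only [map_smul, smul_eq_mul]
        have h' : (fun q => l (fun j => (b q).coord j (t q))) =
            fun q => ∑ j, (b q).coord j (t q) * l (Pi.single j 1) := funext fun q => this _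
        rw [h']
        exact SmoothFun.sum _ fun j _ => (hc j).mul (smoothFun_const _)
      refine (valDeriv_congr (G := fun q => ExteriorAlgebra.ι ℝ
        (fun j => (b q).coord j (t q))) p.2 (fun q hq => ?_) _).trans
        ((e1.valDeriv_map (ExteriorAlgebra.ι ℝ) p.2 (Y p)).trans ?_)
      · rw [loc_apply b _ hq]
        change triv b q (ExteriorAlgebra.ι ℝ (t q)) = _
        rw [triv, ExteriorAlgebra.map_apply_ι]
        rfl
      · congr 1
        funext j
        exact e1.dual_valDeriv p.2 (Y p) (LinearMap.proj j)
    have h2 : ∀ j, CliffordAlgebra.contractLeft ((b p).coord j)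
        (ev m n W.1 p (ofSec t ht)) = algebraMap ℝ _ ((b p).coord j (t p)) :=
      fun j => CliffordAlgebra.contractLeft_ι _ _ _
    rw [h1, trivSymm, ExteriorAlgebra.map_apply_ι]
    simp only [h2]
    have h3 : t = fun q => ∑ j, (b q).coord j (t q) • b q j := by
      funext q
      exact ((b q).sum_repr (t q)).symm
    have h4 : DS t p (Y p) = ∑ j, ((b p).coord j (t p) • DS (fun q => b q j) p (Y p) +
        dirDeriv (fun q => (b q).coord j (t q)) p (Y p) • b p j) := by
      conv_lhs => rw [h3]
      exact cov_sum DS _ (fun j _ => hc j) (fun j _ => (hb j).mono W.2) p.2 _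
    change _ = ExteriorAlgebra.ι ℝ (DS t p (Y p))
    rw [h4, Finset.sum_add_distrib, map_add, add_comm, map_sum]
    congr 1
    · refine Finset.sum_congr rfl fun j _ => ?_
      rw [map_smul, ← Algebra.commutes, Algebra.smul_def]
    · congr 1
      simp [Module.Basis.equivFun_symm_apply]

end Nabla

/-! ### Sign rules for supermatrices -/

section Signs

variable {R : Type*} [Ring R] [Algebra ℝ R] (τ : R →ₐ[ℝ] R)

/-- The sign `(-1)^{deg i}` of an index. -/
def paritySign (i : Fin m ⊕ Fin n) : ℝ := if i.isLeft then 1 else -1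

theorem paritySign_inl (i : Fin m) : paritySign (Sum.inl i : Fin m ⊕ Fin n) = 1 := rfl

theorem paritySign_inr (i : Fin n) : paritySign (Sum.inr i : Fin m ⊕ Fin n) = -1 := rfl

theorem paritySign_mul_self (i : Fin m ⊕ Fin n) : paritySign i * paritySign i = 1 := by
  rcases i with i | i
  · rw [paritySign_inl, one_mul]
  · rw [paritySign_inr, neg_one_mul, neg_neg]

theorem bracket_even_aux {A : Type*} [Ring A] (X Y : A) :
    X * Y - (Y * 0 + Y * X + 0 * 0 - 0 * X) = X * Y - Y * X := by
  simp

theorem bracket_odd_aux {A : Type*} [Ring A] (X Y : A) :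
    X * Y - (0 * 0 + 0 * X + Y * 0 - Y * X) = X * Y + Y * X := by
  simp

variable {τ}

theorem SEven.tau_twist {h : Matrix (Fin m ⊕ Fin n) (Fin m ⊕ Fin n) R} (hh : SEven τ h) (i j) :
    τ (twist τ i (h i j)) = (paritySign j * paritySign i) • twist τ i (h i j) := by
  rw [← twist_tau, hh i j]
  rcases i with i | i <;> rcases j with j | j <;> simp [paritySign]

variable (τ)

/-- The entries of `d h + x * h`, for an odd derivation `d` and a supermatrix `x` which is concentrated
in the lower left block and has even entries. -/
theorem twist_matDer_add (hτ : IsSuperComm τ) {d : R →ₗ[ℝ] R} (hd : ∀ a, d (τ a) = -τ (d a))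
    {h x : Matrix (Fin m ⊕ Fin n) (Fin m ⊕ Fin n) R}
    (hx0 : ∀ k i, ¬(k.isLeft = false ∧ i.isLeft = true) → x k i = 0)
    (hx1 : ∀ k i, τ (x k i) = x k i) (k j) :
    twist τ k ((matDer d h + x * h) k j) =
      d (twist τ k (h k j)) + ∑ i, τ (twist τ i (h i j)) * twist τ k (x k i) := by
  rw [Matrix.add_apply, map_add, Matrix.mul_apply, map_sum]
  congr 1
  · rw [matDer_apply]
    rcases k with k | k <;> simp [hd]
  · refine Finset.sum_congr rfl fun i _ => ?_
    rcases k with k | k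
    · simp [hx0 (Sum.inl k) i (by simp)]
    · rcases i with i | i
      · simp only [twist_inl, twist_inr, hx1, map_mul, AlgHom.id_apply]
        exact hτ.even_comm _ _ (hx1 _ _)
      · simp [hx0 (Sum.inr k) (Sum.inr i) (by simp)]

/-- The signs in the Leibniz rule for the supercommutator of an odd vector field with a product of a
frame and an even supermatrix. -/
theorem sum_lie_aux (a e D Xe w : Fin m ⊕ Fin n → R) (j : Fin m ⊕ Fin n)
    (c : Fin m ⊕ Fin n → Fin m ⊕ Fin n → R)
    (ha : ∀ i, τ (a i) = (paritySign j * paritySign i) • a i)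
    (hX : ∀ i, Xe i = paritySign i • w i + ∑ k, c k i * e k) :
    ∑ i, (D i * e i + τ (a i) * Xe i) - paritySign j • ∑ i, a i * w i =
      ∑ k, (D k + ∑ i, τ (a i) * c k i) * e k := by
  have h1 : ∀ i, τ (a i) * paritySign i • w i = paritySign j • (a i * w i) := by
    intro i
    rw [ha, smul_mul_smul_comm, mul_assoc, paritySign_mul_self, mul_one]
  simp only [hX, mul_add, h1, Finset.sum_add_distrib, add_mul, Finset.sum_mul, Finset.mul_sum,
    Finset.smul_sum, ← mul_assoc]
  rw [Finset.sum_comm (f := fun i k => τ (a k) * c i k * e i)]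
  abel

end Signs

/-! ### Tuples of vector fields and supermatrices -/

section Tuples

variable {U W V : Opens M}

/-- `U` as an open subset of itself. -/
abbrev whole (U : Opens M) : Set.Iic U := ⟨U, Set.mem_Iic.2 le_rfl⟩

theorem invol_res (h : V ≤ W) (f : superFun m n S W) : invol V (res h f) = res h (invol W f) := rfl

theorem rightMul_of_even {X : Endo m n S U} (hX : X.even = X) (a : superFun m n S U) :
    rightMul X a = Endo.mulBy a * X := by
  rw [rightMul, hX, odd_of_even hX, mul_zero, add_zero]

theorem rightMul_of_odd {X : Endo m n S U} (hX : X.odd = X) (a : superFun m n S U) :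
    rightMul X a = Endo.mulBy (invol U a) * X := by
  rw [rightMul, hX, even_of_odd hX, mul_zero, zero_add]

/-- The first `m` members of the tuple are even and the others odd. -/
structure IsHomogeneous (E : Fin m ⊕ Fin n → Endo m n S U) : Prop where
  even : ∀ i, (E (Sum.inl i)).even = E (Sum.inl i)
  odd : ∀ j, (E (Sum.inr j)).odd = E (Sum.inr j)

theorem IsHomogeneous.rightMul {E : Fin m ⊕ Fin n → Endo m n S U} (hE : IsHomogeneous E) (i)
    (a : superFun m n S U) : rightMul (E i) a = Endo.mulBy (twist (invol U) i a) * E i := by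
  rcases i with i | i
  · exact rightMul_of_even (hE.even i) a
  · exact rightMul_of_odd (hE.odd i) a

theorem IsHomogeneous.apply_invol {E : Fin m ⊕ Fin n → Endo m n S U} (hE : IsHomogeneous E) (i)
    (W : Set.Iic U) (f : superFun m n S W.1) :
    E i W (invol W.1 f) = paritySign i • invol W.1 (E i W f) := by
  rcases i with i | i
  · rw [paritySign_inl, one_smul]; exact even_eq_iff.1 (hE.even i) W f
  · rw [paritySign_inr, neg_smul, one_smul]; exact odd_eq_iff.1 (hE.odd i) W f

theorem isHomogeneous_of {E : Fin m ⊕ Fin n → Endo m n S U}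
    (h : ∀ i (W : Set.Iic U) (f : superFun m n S W.1),
      E i W (invol W.1 f) = paritySign i • invol W.1 (E i W f)) :
    IsHomogeneous E :=
  ⟨fun i => even_eq_iff.2 fun W f => (h (Sum.inl i) W f).trans (one_smul ℝ _),
    fun i => odd_eq_iff.2 fun W f => (h (Sum.inr i) W f).trans (neg_one_smul ℝ _)⟩

theorem IsHomogeneous.tupleMul_apply {E : Fin m ⊕ Fin n → Endo m n S U} (hE : IsHomogeneous E)
    (x : SMat m n S U) (j) (W : Set.Iic U) (f : superFun m n S W.1) :
    tupleMul E x j W f = ∑ i, res (Set.mem_Iic.1 W.2) (twist (invol U) i (x i j)) * E i W f := by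
  simp only [tupleMul, hE.rightMul, Finset.sum_apply, LinearMap.sum_apply]
  rfl

theorem IsHomogeneous.tupleMul {E : Fin m ⊕ Fin n → Endo m n S U} (hE : IsHomogeneous E)
    {h : SMat m n S U} (hh : SEven (invol U) h) : IsHomogeneous (tupleMul E h) := by
  refine isHomogeneous_of fun j W f => ?_
  rw [hE.tupleMul_apply, hE.tupleMul_apply, map_sum, Finset.smul_sum]
  refine Finset.sum_congr rfl fun i _ => ?_
  rw [map_mul, invol_res, hh.tau_twist, hE.apply_invol, map_smul, smul_mul_assoc, mul_smul_comm,
    smul_smul, ← mul_assoc, paritySign_mul_self, one_mul]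

/-- The right action of even supermatrices on homogeneous tuples is compatible with products. -/
theorem IsHomogeneous.tupleMul_tupleMul {E : Fin m ⊕ Fin n → Endo m n S U} (hE : IsHomogeneous E)
    {h : SMat m n S U} (hh : SEven (invol U) h) (x : SMat m n S U) :
    SpinSuper.tupleMul (SpinSuper.tupleMul E h) x = SpinSuper.tupleMul E (h * x) := by
  funext j W
  refine LinearMap.ext fun f => ?_
  rw [(hE.tupleMul hh).tupleMul_apply, hE.tupleMul_apply]
  simp only [hE.tupleMul_apply, Matrix.mul_apply, map_sum, Finset.mul_sum, Finset.sum_mul, map_mul]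
  rw [Finset.sum_comm]
  refine Finset.sum_congr rfl fun i _ => Finset.sum_congr rfl fun k _ => ?_
  rw [← mul_assoc, ← map_mul, ← map_mul]
  congr 2
  have hτ := isSuperComm_invol (m := m) (n := n) (S := S) U
  by_cases hik : i.isLeft = k.isLeft
  · rw [twist_eq _ hik.symm]
    refine (hτ.even_comm _ _ ?_).symm
    rw [← twist_tau, hh i k, if_pos hik]
  · rw [hτ.odd_comm (twist (invol U) i (h i k)), ← twist_tau,
      twist_ne _ hτ hik]
    rw [← twist_tau, hh i k, if_neg hik, map_neg]

theorem tupleMul_one {E : Fin m ⊕ Fin n → Endo m n S U} (hE : IsHomogeneous E) :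
    tupleMul E 1 = E := by
  funext j W
  refine LinearMap.ext fun f => ?_
  rw [hE.tupleMul_apply, Finset.sum_eq_single j]
  · rw [Matrix.one_apply_eq, map_one, map_one, one_mul]
  · intro i _ hij
    rw [Matrix.one_apply_ne hij, map_zero, map_zero, zero_mul]
  · simp

theorem superBracket_of_odd {X : Endo m n S U} (hX : X.odd = X)
    {E : Fin m ⊕ Fin n → Endo m n S U} (hE : IsHomogeneous E) (j) (W : Set.Iic U)
    (f : superFun m n S W.1) :
    superBracket X (E j) W f = X W (E j W f) - paritySign j • E j W (X W f) := by
  rcases j with j | j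
  · have h1 : superBracket X (E (Sum.inl j)) = X * E (Sum.inl j) - E (Sum.inl j) * X := by
      rw [superBracket, hX, even_of_odd hX, hE.even, odd_of_even (hE.even j)]
      exact bracket_even_aux (A := Endo m n S U) _ _
    rw [h1, paritySign_inl, one_smul]
    rfl
  · have h1 : superBracket X (E (Sum.inr j)) = X * E (Sum.inr j) + E (Sum.inr j) * X := by
      rw [superBracket, hX, even_of_odd hX, hE.odd, even_of_odd (hE.odd j)]
      exact bracket_odd_aux (A := Endo m n S U) _ _
    rw [h1, paritySign_inr, neg_one_smul, sub_neg_eq_add]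
    rfl

/-- The Lie derivative of `E h` along an odd vector field. -/
theorem lieDer_tupleMul {X : Endo m n S U} (hX : IsOddDer X)
    {E : Fin m ⊕ Fin n → Endo m n S U} (hE : IsHomogeneous E)
    {h : SMat m n S U} (hh : SEven (invol U) h) {x : SMat m n S U} (hx : lieDer X E = tupleMul E x)
    (hx0 : ∀ k i, ¬(k.isLeft = false ∧ i.isLeft = true) → x k i = 0)
    (hx1 : ∀ k i, invol U (x k i) = x k i) :
    lieDer X (tupleMul E h) = tupleMul E (matDer (X (whole U)) h + x * h) := by
  have hτ := isSuperComm_invol (m := m) (n := n) (S := S) U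
  funext j W
  refine LinearMap.ext fun f => ?_
  have hW := Set.mem_Iic.1 W.2
  have h1 : ∀ i, X W (E i W f) = paritySign i • E i W (X W f) +
      ∑ k, res hW (twist (invol U) k (x k i)) * E k W f := by
    intro i
    have := LinearMap.congr_fun (congrFun (congrFun hx i) W) f
    rw [lieDer, superBracket_of_odd hX.2.1 hE, hE.tupleMul_apply] at this
    rw [← this]; abel
  rw [lieDer, superBracket_of_odd hX.2.1 (hE.tupleMul hh), hE.tupleMul_apply, hE.tupleMul_apply,
    hE.tupleMul_apply, map_sum]
  simp only [hX.2.2]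
  rw [sum_lie_aux (invol W.1) (fun i => res hW (twist (invol U) i (h i j))) _ _ _ _ _
    (fun k i => res hW (twist (invol U) k (x k i))) (fun i => ?_) h1]
  · refine Finset.sum_congr rfl fun k _ => ?_
    congr 1
    rw [twist_matDer_add _ hτ (odd_eq_iff.1 hX.2.1 (whole U)) hx0 hx1, map_add, map_sum]
    refine congrArg₂ (· + ·) (hX.1 W (whole U) hW _) ?_
    · refine Finset.sum_congr rfl fun i _ => ?_
      rw [map_mul]
      rfl
  · rw [invol_res, hh.tau_twist, map_smul]

end Tuples

/-! ### Independence of a frame of vector fields -/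

section Independence

variable {U : Opens M}

/-- Every covector at a point is the differential of a smooth function. -/
theorem exists_dirDeriv_eq (p : M) (α : Module.Dual ℝ (TangentSpace (𝓡 m) p)) :
    ∃ W : Opens M, p ∈ W ∧ ∃ h : M → ℝ, SmoothFun m W h ∧ ∀ v, dirDeriv h p v = α v := by
  obtain ⟨L, hL⟩ := isInvertible_mfderiv_extChartAt (I := 𝓡 m) (mem_extChartAt_source p)
  let α' : EuclideanSpace ℝ (Fin m) →L[ℝ] ℝ :=
    LinearMap.toContinuousLinearMap (α ∘ₗ L.symm.toLinearEquiv.toLinearMap)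
  refine ⟨⟨(chartAt (EuclideanSpace ℝ (Fin m)) p).source, (chartAt _ p).open_source⟩,
    mem_chart_source _ p, fun q => α' (extChartAt (𝓡 m) p q), ?_, fun v => ?_⟩
  · exact α'.contMDiff.comp_contMDiffOn contMDiffOn_extChartAt
  · have h1 : MDifferentiableAt (𝓡 m) 𝓘(ℝ, EuclideanSpace ℝ (Fin m)) (extChartAt (𝓡 m) p) p :=
      mdifferentiableAt_extChartAt (mem_chart_source _ p)
    have h2 := mfderiv_comp p (α'.contMDiff (n := 1)|>.mdifferentiable one_ne_zero _) h1
    change mfderiv (𝓡 m) 𝓘(ℝ, ℝ) (α' ∘ extChartAt (𝓡 m) p) p v = _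
    rw [h2]
    change mfderiv 𝓘(ℝ, EuclideanSpace ℝ (Fin m)) 𝓘(ℝ, ℝ) α' _
      (mfderiv (𝓡 m) 𝓘(ℝ, EuclideanSpace ℝ (Fin m)) (extChartAt (𝓡 m) p) p v) = _
    rw [mfderiv_eq_fderiv, α'.fderiv]
    have h3 := congrArg (fun T => T v) hL
    change α (L.symm (mfderiv (𝓡 m) 𝓘(ℝ, EuclideanSpace ℝ (Fin m)) (extChartAt (𝓡 m) p) p v)) = _
    rw [← h3]
    exact congrArg α (L.symm_apply_apply v)

/-- The data of the tuple of vector fields dual to a frame field: the vector fields `∇_{Y_i}` and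
the interior multiplications with the covector fields `σ_j`, where `Y_i(p)` is a basis of `T_p M`
and `σ_j(p)` is dual to the basis `b(p)` of `S_p`. -/
structure IsDualTuple (DS : CovariantDerivative (𝓡 m) (EuclideanSpace ℝ (Fin n)) S)
    (Y : Fin m → ∀ p : M, TangentSpace (𝓡 m) p)
    (b : ∀ p : M, Module.Basis (Fin n) ℝ (S p)) (E : Fin m ⊕ Fin n → Endo m n S U) : Prop where
  smoothVec : ∀ i, SmoothVec U (Y i)
  smoothSec : ∀ a, SmoothSec m n U fun p => b p a
  indep : ∀ p, LinearIndependent ℝ fun i => Y i p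
  isNabla : ∀ i, IsNabla DS (Y i) (E (Sum.inl i))
  isInterior : ∀ j, ∃ σ : Covector m n S U, (∀ p, σ.toFun p = (b p).coord j) ∧
    E (Sum.inr j) = interior σ

variable {DS : CovariantDerivative (𝓡 m) (EuclideanSpace ℝ (Fin n)) S}
  {Y : Fin m → ∀ p : M, TangentSpace (𝓡 m) p}
  {b : ∀ p : M, Module.Basis (Fin n) ℝ (S p)} {E : Fin m ⊕ Fin n → Endo m n S U}

theorem IsDualTuple.isHomogeneous (hE : IsDualTuple DS Y b E) : IsHomogeneous E := by
  refine ⟨fun i => (hE.isNabla i).1.2.1, fun j => ?_⟩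
  obtain ⟨σ, _, h⟩ := hE.isInterior j
  rw [h]
  exact (isOddDer_interior σ).2.1

theorem IsDualTuple.inl_ofFun (hE : IsDualTuple DS Y b E) (i : Fin m) (W : Set.Iic U) {h : M → ℝ}
    (hh : SmoothFun m W.1 h) (p : W.1) : ev m n W.1 p (E (Sum.inl i) W (ofFun n S h hh)) =
      algebraMap ℝ _ (dirDeriv h p (Y i p)) :=
  congrFun ((hE.isNabla i).2.1 W h hh) p

theorem IsDualTuple.inl_ofSec (hE : IsDualTuple DS Y b E) (i : Fin m) (W : Set.Iic U)
    {t : ∀ p : M, S p} (ht : SmoothSec m n W.1 t) (p : W.1) :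
    ev m n W.1 p (E (Sum.inl i) W (ofSec t ht)) = ExteriorAlgebra.ι ℝ (DS t p (Y i p)) :=
  congrFun ((hE.isNabla i).2.2 W t ht) p

theorem IsDualTuple.inr_ofFun (hE : IsDualTuple DS Y b E) (j : Fin n) (W : Set.Iic U) {h : M → ℝ}
    (hh : SmoothFun m W.1 h) : E (Sum.inr j) W (ofFun n S h hh) = 0 := by
  obtain ⟨σ, _, hσ⟩ := hE.isInterior j
  rw [hσ]
  exact interior_ofFun σ W h hh

theorem IsDualTuple.inr_ofSec (hE : IsDualTuple DS Y b E) (j : Fin n) (W : Set.Iic U)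
    {t : ∀ p : M, S p} (ht : SmoothSec m n W.1 t) (p : W.1) :
    ev m n W.1 p (E (Sum.inr j) W (ofSec t ht)) = algebraMap ℝ _ ((b p).coord j (t p)) := by
  obtain ⟨σ, hσ', hσ⟩ := hE.isInterior j
  rw [hσ, interior_ofSec, ← hσ']
  rfl

/-- A dual tuple is a frame: its members are linearly independent over the functions on `M(S)`. -/
theorem IsDualTuple.tupleMul_injective (hE : IsDualTuple DS Y b E) {x y : SMat m n S U}
    (h : tupleMul E x = tupleMul E y) : x = y := by
  have hτ := isSuperComm_invol (m := m) (n := n) (S := S) U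
  suffices hz : ∀ z : SMat m n S U, (∀ j, ∀ (W : Set.Iic U) (f : superFun m n S W.1),
      ∑ i, res (Set.mem_Iic.1 W.2) (twist (invol U) i (z i j)) * E i W f = 0) → z = 0 by
    refine sub_eq_zero.1 (hz (x - y) fun j W f => ?_)
    have h1 := LinearMap.congr_fun (congrFun (congrFun h j) W) f
    rw [hE.isHomogeneous.tupleMul_apply, hE.isHomogeneous.tupleMul_apply, ← sub_eq_zero] at h1
    rw [← h1, ← Finset.sum_sub_distrib]
    refine Finset.sum_congr rfl fun i _ => ?_
    rw [Matrix.sub_apply, map_sub, map_sub, sub_mul]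
  intro z hz
  ext1 i j
  suffices h1 : twist (invol U) i (z i j) = 0 by
    rw [← twist_twist _ hτ i (z i j), h1, map_zero]
    rfl
  refine superFun_ext fun p => ?_
  rw [map_zero]
  have hl : ∀ i, ev m n U p (twist (invol U) (Sum.inl i : Fin m ⊕ Fin n)
      (z (Sum.inl i) j)) = 0 := by
    intro i
    have hcard : Fintype.card (Fin m) = Module.finrank ℝ (TangentSpace (𝓡 m) p.1) := by
      change _ = Module.finrank ℝ (EuclideanSpace ℝ (Fin m))
      simp
    let c := basisOfLinearIndependentOfCardEqFinrank' _ (hE.indep p) hcard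
    have hα' : ∀ k, c.coord i (Y k p) = if k = i then 1 else 0 := by
      intro k
      have : Y k p = c k := (congrFun
        (coe_basisOfLinearIndependentOfCardEqFinrank' (fun k => Y k p.1)
          (hE.indep p) hcard) k).symm
      rw [this, c.coord_apply, c.repr_self, Finsupp.single_apply]
    obtain ⟨W, hpW, h, hh, hα⟩ := exists_dirDeriv_eq p.1 (c.coord i)
    have hhW : SmoothFun m (U ⊓ W) h := hh.mono inf_le_right
    let W' : Set.Iic U := ⟨U ⊓ W, Set.mem_Iic.2 inf_le_left⟩
    let p' : W'.1 := ⟨p, p.2, hpW⟩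
    have h3 : ∀ k, ev m n W'.1 p' (E (Sum.inl k) W' (ofFun n S h hhW)) =
        algebraMap ℝ _ (if k = i then 1 else 0) := fun k =>
      (hE.inl_ofFun k W' hhW p').trans (congrArg _ ((hα _).trans (hα' k)))
    have h2 := congrArg (ev m n W'.1 p') (hz j W' (ofFun n S h hhW))
    rw [map_zero, map_sum, Fintype.sum_sum_type] at h2
    simp only [map_mul, h3, hE.inr_ofFun _ W' hhW, map_zero, mul_zero, Finset.sum_const_zero,
      add_zero] at h2
    rw [Finset.sum_eq_single i] at h2
    · rw [if_pos rfl, map_one, mul_one] at h2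
      exact h2
    · intro k _ hk
      rw [if_neg hk, map_zero, mul_zero]
    · intro h; exact absurd (Finset.mem_univ i) h
  rcases i with i | i
  · exact hl i
  · have h2 := congrArg (ev m n U p) (hz j (whole U) (ofSec _ (hE.smoothSec i)))
    rw [map_zero, map_sum, Fintype.sum_sum_type] at h2
    have h3 : ∀ k, ev m n U p (res (Set.mem_Iic.1 (whole U).2)
        (twist (invol U) (Sum.inl k : Fin m ⊕ Fin n) (z (Sum.inl k) j))) = 0 := hl
    have h4 : ∀ k, (b p).coord k (b p i) = if i = k then 1 else 0 := by
      intro k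
      rw [Module.Basis.coord_apply, Module.Basis.repr_self, Finsupp.single_apply]
    simp only [map_mul, hE.inr_ofSec _ (whole U) (hE.smoothSec i), h3, zero_mul,
      Finset.sum_const_zero, zero_add] at h2
    rw [Finset.sum_eq_single i] at h2
    · rw [h4, if_pos rfl, map_one, mul_one] at h2
      exact h2
    · intro k _ hk
      rw [h4, if_neg (Ne.symm hk), map_zero, mul_zero]
    · intro h; exact absurd (Finset.mem_univ i) h

end Independence

/-! ### Supermatrices of smooth functions -/

section FunctionMatrices

variable {U : Opens M}

theorem invol_ofFun {W : Opens M} {h : M → ℝ} (hh : SmoothFun m W h) :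
    invol W (ofFun n S h hh) = ofFun n S h hh :=
  superFun_ext fun _ => AlgHom.commutes _ _

theorem ev_ofFun {W : Opens M} {h : M → ℝ} (hh : SmoothFun m W h) (p : W) :
    ev m n W p (ofFun n S h hh) = algebraMap ℝ _ (h p) := rfl

theorem ofFun_mul_comm {W : Opens M} {h : M → ℝ} (hh : SmoothFun m W h) (f : superFun m n S W) :
    ofFun n S h hh * f = f * ofFun n S h hh :=
  (isSuperComm_invol W).even_comm _ _ (invol_ofFun hh)

theorem twist_ofFun {W : Opens M} {h : M → ℝ} (hh : SmoothFun m W h) (i : Fin m ⊕ Fin n) :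
    twist (invol W) i (ofFun n S h hh) = ofFun n S h hh := by
  rcases i with i | i
  · rfl
  · exact invol_ofFun hh

variable (S) in
/-- A matrix of smooth functions on `U`, as a supermatrix. -/
def funMat (U : Opens M) (C : M → Matrix (Fin m ⊕ Fin n) (Fin m ⊕ Fin n) ℝ)
    (hC : ∀ i j, SmoothFun m U fun p => C p i j) : SMat m n S U :=
  Matrix.of fun i j => ofFun n S (fun p => C p i j) (hC i j)

theorem tupleMul_funMat_apply {E : Fin m ⊕ Fin n → Endo m n S U} (hE : IsHomogeneous E)
    {C : M → Matrix (Fin m ⊕ Fin n) (Fin m ⊕ Fin n) ℝ} (hC : ∀ i j, SmoothFun m U fun p => C p i j)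
    (j) (W : Set.Iic U) (f : superFun m n S W.1) : tupleMul E (funMat S U C hC) j W f =
      ∑ i, ofFun n S (fun p => C p i j) ((hC i j).mono (Set.mem_Iic.1 W.2)) * E i W f := by
  rw [hE.tupleMul_apply]
  refine Finset.sum_congr rfl fun i _ => ?_
  congr 1
  exact congrArg (res (Set.mem_Iic.1 W.2)) (twist_ofFun (hC i j) i)

theorem isLocal_tupleMul_funMat {E : Fin m ⊕ Fin n → Endo m n S U} (hE : IsHomogeneous E)
    (hE' : ∀ i, (E i).IsLocal)
    {C : M → Matrix (Fin m ⊕ Fin n) (Fin m ⊕ Fin n) ℝ} (hC : ∀ i j, SmoothFun m U fun p => C p i j)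
    (j) : (tupleMul E (funMat S U C hC) j).IsLocal := by
  intro V W h f
  rw [tupleMul_funMat_apply hE, tupleMul_funMat_apply hE, map_sum]
  refine Finset.sum_congr rfl fun i _ => ?_
  rw [hE' i V W h, map_mul]
  rfl

/-- Multiplying a tuple by a matrix of functions preserves the Leibniz rule, with the sign given by
`κ`, if all members of the tuple which enter obey it. -/
theorem leibniz_tupleMul_funMat {E : Fin m ⊕ Fin n → Endo m n S U} (hE : IsHomogeneous E)
    {C : M → Matrix (Fin m ⊕ Fin n) (Fin m ⊕ Fin n) ℝ} (hC : ∀ i j, SmoothFun m U fun p => C p i j)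
    (j) (W : Set.Iic U) (κ : superFun m n S W.1 → superFun m n S W.1)
    (hκ : ∀ i, (∀ f g, E i W (f * g) = E i W f * g + κ f * E i W g) ∨ ∀ p, C p i j = 0)
    (f g : superFun m n S W.1) : tupleMul E (funMat S U C hC) j W (f * g) =
      tupleMul E (funMat S U C hC) j W f * g + κ f * tupleMul E (funMat S U C hC) j W g := by
  rw [tupleMul_funMat_apply hE, tupleMul_funMat_apply hE, tupleMul_funMat_apply hE,
    Finset.sum_mul, Finset.mul_sum, ← Finset.sum_add_distrib]
  refine Finset.sum_congr rfl fun i _ => ?_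
  rcases hκ i with h | h
  · rw [h, mul_add, mul_assoc, ← mul_assoc (κ f), ← ofFun_mul_comm, mul_assoc]
  · have h0 : ofFun n S (fun p => C p i j) ((hC i j).mono (Set.mem_Iic.1 W.2)) = 0 :=
      superFun_ext fun p => (congrArg (algebraMap ℝ _) (h p)).trans (map_zero _)
    simp only [h0, zero_mul, mul_zero, add_zero]

end FunctionMatrices

/-! ### Lie derivatives and changes of dual tuples -/

section DualTuples

variable {U : Opens M} {DS : CovariantDerivative (𝓡 m) (EuclideanSpace ℝ (Fin n)) S}
  {Y Y' : Fin m → ∀ p : M, TangentSpace (𝓡 m) p}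
  {b b' : ∀ p : M, Module.Basis (Fin n) ℝ (S p)} {E E' : Fin m ⊕ Fin n → Endo m n S U}

theorem IsDualTuple.isLocal (hE : IsDualTuple DS Y b E) (i) : (E i).IsLocal := by
  rcases i with i | i
  · exact (hE.isNabla i).1.1
  · obtain ⟨σ, _, h⟩ := hE.isInterior i
    rw [h]
    exact isLocal_interior σ

theorem IsDualTuple.inl_leibniz (hE : IsDualTuple DS Y b E) (i : Fin m) (W : Set.Iic U)
    (f g : superFun m n S W.1) :
    E (Sum.inl i) W (f * g) = E (Sum.inl i) W f * g + f * E (Sum.inl i) W g :=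
  (hE.isNabla i).1.2.2 W f g

theorem IsDualTuple.inr_leibniz (hE : IsDualTuple DS Y b E) (i : Fin n) (W : Set.Iic U)
    (f g : superFun m n S W.1) :
    E (Sum.inr i) W (f * g) = E (Sum.inr i) W f * g + invol W.1 f * E (Sum.inr i) W g := by
  obtain ⟨σ, _, h⟩ := hE.isInterior i
  rw [h]
  exact (isOddDer_interior σ).2.2 W f g

theorem IsDualTuple.ev_tupleMul_ofFun (hE : IsDualTuple DS Y b E)
    {C : M → Matrix (Fin m ⊕ Fin n) (Fin m ⊕ Fin n) ℝ} (hC : ∀ i j, SmoothFun m U fun p => C p i j)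
    (j) (W : Set.Iic U) {h : M → ℝ} (hh : SmoothFun m W.1 h) (p : W.1) :
    ev m n W.1 p (tupleMul E (funMat S U C hC) j W (ofFun n S h hh)) =
      algebraMap ℝ _ (∑ i, C p (Sum.inl i) j * dirDeriv h p (Y i p)) := by
  rw [tupleMul_funMat_apply hE.isHomogeneous, Fintype.sum_sum_type, map_add, map_sum, map_sum,
    map_sum]
  simp only [hE.inr_ofFun _ W hh, mul_zero, map_zero, Finset.sum_const_zero, add_zero]
  refine Finset.sum_congr rfl fun i _ => ?_
  rw [map_mul, hE.inl_ofFun, ev_ofFun, map_mul]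

theorem IsDualTuple.ev_tupleMul_ofSec (hE : IsDualTuple DS Y b E)
    {C : M → Matrix (Fin m ⊕ Fin n) (Fin m ⊕ Fin n) ℝ} (hC : ∀ i j, SmoothFun m U fun p => C p i j)
    (j) (W : Set.Iic U) {t : ∀ p : M, S p} (ht : SmoothSec m n W.1 t) (p : W.1) :
    ev m n W.1 p (tupleMul E (funMat S U C hC) j W (ofSec t ht)) =
      ExteriorAlgebra.ι ℝ (∑ i, C p (Sum.inl i) j • DS t p (Y i p)) +
      algebraMap ℝ _ (∑ i, C p (Sum.inr i) j * (b p).coord i (t p)) := by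
  rw [tupleMul_funMat_apply hE.isHomogeneous, Fintype.sum_sum_type, map_add, map_sum, map_sum,
    map_sum, map_sum]
  congr 1
  · refine Finset.sum_congr rfl fun i _ => ?_
    rw [map_mul, hE.inl_ofSec, ev_ofFun, map_smul, Algebra.smul_def]
  · refine Finset.sum_congr rfl fun i _ => ?_
    rw [map_mul, hE.inr_ofSec, ev_ofFun, map_mul]

set_option maxHeartbeats 1000000 in
/-- The Lie derivative of a dual tuple along the interior multiplication with a covector field
`σ`, where the matrix `C` describes the covariant derivatives of `σ`. -/
theorem IsDualTuple.lieDer_interior (hE : IsDualTuple DS Y b E) (σ : Covector m n S U)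
    {C : M → Matrix (Fin m ⊕ Fin n) (Fin m ⊕ Fin n) ℝ} (hC : ∀ i j, SmoothFun m U fun p => C p i j)
    (hC0 : ∀ p k i, ¬(k.isLeft = false ∧ i.isLeft = true) → C p k i = 0)
    (hσ : ∀ i, ∀ W ≤ U, ∀ t : ∀ p : M, S p, SmoothSec m n W t → ∀ p ∈ W,
      σ.toFun p (DS t p (Y i p)) - dirDeriv (fun q => σ.toFun q (t q)) p (Y i p) =
        ∑ j, C p (Sum.inr j) (Sum.inl i) * (b p).coord j (t p)) :
    lieDer (interior σ) E = tupleMul E (funMat S U C hC) := by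
  have hX := isOddDer_interior σ
  funext j
  rcases j with j | j
  · have hD : ∀ W f, superBracket (interior σ) (E (Sum.inl j)) W f =
        interior σ W (E (Sum.inl j) W f) - E (Sum.inl j) W (interior σ W f) := by
      intro W f
      rw [superBracket_of_odd hX.2.1 hE.isHomogeneous, paritySign_inl, one_smul]
    refine der_unique (X := lieDer (interior σ) E (Sum.inl j)) ?_
      (isLocal_tupleMul_funMat hE.isHomogeneous hE.isLocal hC _) (fun W => invol W.1) ?_ ?_ ?_ ?_
    · intro V W h f
      rw [lieDer, hD, hD, hE.isLocal _ V W h, hX.1 V W h, hX.1 V W h, hE.isLocal _ V W h, map_sub]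
    · intro W f g
      have h1 : E (Sum.inl j) W (invol W.1 f) = invol W.1 (E (Sum.inl j) W f) :=
        even_eq_iff.1 (hE.isHomogeneous.even j) W f
      rw [lieDer, hD, hD, hD, hE.inl_leibniz, map_add, hX.2.2, hX.2.2, hX.2.2, map_add,
        hE.inl_leibniz, hE.inl_leibniz, h1, sub_mul, mul_sub]
      abel
    · refine fun W f g => leibniz_tupleMul_funMat hE.isHomogeneous hC _ W _ (fun i => ?_) f g
      rcases i with i | i
      · exact Or.inr fun p => hC0 p _ _ (by simp)
      · exact Or.inl (hE.inr_leibniz i W)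
    · intro W h hh
      refine superFun_ext fun p => ?_
      rw [lieDer, hD, map_sub, ev_interior, hE.ev_tupleMul_ofFun, interior_ofFun, map_zero,
        map_zero, hE.inl_ofFun, CliffordAlgebra.contractLeft_algebraMap, sub_zero,
        Finset.sum_eq_zero, map_zero]
      intro i _
      rw [hC0 _ _ _ (by simp), zero_mul]
    · intro W t ht
      refine superFun_ext fun p => ?_
      have h1 : ev m n W.1 p (interior σ W (E (Sum.inl j) W (ofSec t ht))) =
          algebraMap ℝ _ (σ.toFun p (DS t p (Y j p))) := by
        rw [ev_interior, hE.inl_ofSec]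
        exact CliffordAlgebra.contractLeft_ι _ _ _
      rw [lieDer, hD, map_sub, h1, hE.ev_tupleMul_ofSec, interior_ofSec, hE.inl_ofFun, ← map_sub,
        hσ j W.1 (Set.mem_Iic.1 W.2) t ht p p.2, Finset.sum_eq_zero (f := fun i =>
        C p (Sum.inl i) (Sum.inl j) • _), map_zero, zero_add]
      intro i _
      rw [hC0 _ _ _ (by simp), zero_smul]
  · funext W
    refine LinearMap.ext fun f => ?_
    obtain ⟨σ', _, h⟩ := hE.isInterior j
    rw [lieDer, superBracket_of_odd hX.2.1 hE.isHomogeneous, paritySign_inr,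
      tupleMul_funMat_apply hE.isHomogeneous, h, neg_one_smul, sub_neg_eq_add]
    refine superFun_ext fun p => ?_
    rw [map_add, ev_interior, ev_interior, ev_interior, ev_interior,
      CliffordAlgebra.contractLeft_comm,
      neg_add_cancel, map_sum, Finset.sum_eq_zero]
    intro i _
    rw [map_mul, ev_ofFun, hC0 _ _ _ (by simp), map_zero, zero_mul]

/-- Dual tuples are related by the matrix of functions which relates the vector fields and the
covector fields. -/
theorem IsDualTuple.eq_tupleMul (hE : IsDualTuple DS Y b E) (hE' : IsDualTuple DS Y' b' E')
    {C : M → Matrix (Fin m ⊕ Fin n) (Fin m ⊕ Fin n) ℝ} (hC : ∀ i j, SmoothFun m U fun p => C p i j)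
    (hC0 : ∀ p k i, k.isLeft ≠ i.isLeft → C p k i = 0)
    (hY : ∀ p ∈ U, ∀ i, Y' i p = ∑ k, C p (Sum.inl k) (Sum.inl i) • Y k p)
    (hb : ∀ p ∈ U, ∀ j v, (b' p).coord j v = ∑ k, C p (Sum.inr k) (Sum.inr j) * (b p).coord k v) :
    E' = tupleMul E (funMat S U C hC) := by
  funext j
  rcases j with j | j
  · refine der_unique (hE'.isLocal _)
      (isLocal_tupleMul_funMat hE.isHomogeneous hE.isLocal hC _) (fun W f => f)
      (hE'.inl_leibniz j) ?_ ?_ ?_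
    · refine fun W f g => leibniz_tupleMul_funMat hE.isHomogeneous hC _ W (fun f => f)
        (fun i => ?_) f g
      rcases i with i | i
      · exact Or.inl (hE.inl_leibniz i W)
      · exact Or.inr fun p => hC0 p _ _ (by simp)
    · intro W h hh
      refine superFun_ext fun p => ?_
      rw [hE.ev_tupleMul_ofFun, hE'.inl_ofFun, hY p (W.2 p.2)]
      refine congrArg (algebraMap ℝ _) ((map_sum _ _ _).trans ?_)
      exact Finset.sum_congr rfl fun i _ => (map_smul _ _ _).trans rfl
    · intro W t ht
      refine superFun_ext fun p => ?_
      rw [hE.ev_tupleMul_ofSec, hE'.inl_ofSec, hY p (W.2 p.2), map_sum,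
        Finset.sum_eq_zero (f := fun i =>
        C p (Sum.inr i) (Sum.inl j) * _), map_zero, add_zero]
      · simp only [map_smul]
      · intro i _
        rw [hC0 _ _ _ (by simp), zero_mul]
  · refine der_unique (hE'.isLocal _)
      (isLocal_tupleMul_funMat hE.isHomogeneous hE.isLocal hC _) (fun W => invol W.1)
      (hE'.inr_leibniz j) ?_ ?_ ?_
    · refine fun W f g => leibniz_tupleMul_funMat hE.isHomogeneous hC _ W _ (fun i => ?_) f g
      rcases i with i | i
      · exact Or.inr fun p => hC0 p _ _ (by simp)
      · exact Or.inl (hE.inr_leibniz i W)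
    · intro W h hh
      refine superFun_ext fun p => ?_
      rw [hE.ev_tupleMul_ofFun, hE'.inr_ofFun, map_zero, Finset.sum_eq_zero, map_zero]
      intro i _
      rw [hC0 _ _ _ (by simp), zero_mul]
    · intro W t ht
      refine superFun_ext fun p => ?_
      rw [hE.ev_tupleMul_ofSec, hE'.inr_ofSec, hb p (W.2 p.2), Finset.sum_eq_zero (f := fun i =>
        C p (Sum.inl i) (Sum.inr j) • _), map_zero, zero_add]
      intro i _
      rw [hC0 _ _ _ (by simp), zero_smul]

end DualTuples

theorem finiteDimensional_fiber {B : Type*} [TopologicalSpace B] (F : Type*) [NormedAddCommGroup F]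
    [NormedSpace ℝ F] [FiniteDimensional ℝ F] {E : B → Type*} [TopologicalSpace (TotalSpace F E)]
    [∀ p, TopologicalSpace (E p)] [∀ p, AddCommGroup (E p)] [∀ p, Module ℝ (E p)]
    [FiberBundle F E] [VectorBundle ℝ F E] (p : B) : FiniteDimensional ℝ (E p) :=
  ((trivializationAt F E p).continuousLinearEquivAt ℝ p
    (mem_baseSet_trivializationAt _ _ p)).symm.toLinearEquiv.finiteDimensional

/-! ### The sheaf of groups -/

section GroupSheaf

variable {U V W : Opens M}

variable (m n) in
/-- Evaluation of supermatrices at a point of `M`. -/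
def evMat (U : Opens M) (p : U) : SMat m n S U →ₐ[ℝ]
    Matrix (Fin m ⊕ Fin n) (Fin m ⊕ Fin n) (ExteriorAlgebra ℝ (S p)) :=
  (ev m n U p).mapMatrix

variable (m n) in
/-- Restriction of supermatrices. -/
def resMat (h : V ≤ U) : SMat m n S U →ₐ[ℝ] SMat m n S V := (res h).mapMatrix

theorem evMat_apply (p : U) (x : SMat m n S U) (i j) : evMat m n U p x i j = ev m n U p (x i j) :=
  rfl

theorem evMat_ext {x y : SMat m n S U} (h : ∀ p, evMat m n U p x = evMat m n U p y) : x = y := by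
  ext1 i j
  exact superFun_ext fun p => congrFun (congrFun (h p) i) j

theorem evMat_resMat (h : V ≤ U) (p : V) (x : SMat m n S U) :
    evMat m n V p (resMat m n h x) = evMat m n U ⟨p, h p.2⟩ x := rfl

theorem ev_twist (p : U) (i : Fin m ⊕ Fin n) (a : superFun m n S U) :
    ev m n U p (twist (invol U) i a) = twist CliffordAlgebra.involute i (ev m n U p a) := by
  rcases i with i | i <;> rfl

theorem sEven_iff_evMat {x : SMat m n S U} :
    SEven (invol U) x ↔ ∀ p, SEven CliffordAlgebra.involute (evMat m n U p x) := by
  constructor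
  · intro h p i j
    rw [evMat_apply, ← ev_invol, h i j]
    split_ifs
    · rfl
    · rw [map_neg]
  · intro h i j
    refine superFun_ext fun p => ?_
    rw [ev_invol, ← evMat_apply, h p i j]
    split_ifs
    · rfl
    · rw [map_neg]; rfl

/-- Membership in `𝔤 ⊗ 𝒜` is a pointwise condition. -/
theorem mem_glin_iff_evMat {𝔤 : Submodule ℝ (Matrix (Fin m ⊕ Fin n) (Fin m ⊕ Fin n) ℝ)}
    {x : SMat m n S U} :
    x ∈ glin (invol U) 𝔤 ↔ ∀ p, evMat m n U p x ∈ glin CliffordAlgebra.involute 𝔤 := by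
  have key : ∀ (l : Matrix (Fin m ⊕ Fin n) (Fin m ⊕ Fin n) ℝ) (p : U),
      ev m n U p (∑ i, ∑ j, l i j • twist (invol U) i (x i j)) =
        ∑ i, ∑ j, l i j • twist CliffordAlgebra.involute i (evMat m n U p x i j) := by
    intro l p
    simp only [map_sum, map_smul, ev_twist, evMat_apply]
  constructor
  · intro h p l hl
    rw [← key, h l hl, map_zero]
  · intro h l hl
    refine superFun_ext fun p => ?_
    rw [key, h p l hl, map_zero]

theorem evMat_matDer (σ : Covector m n S U) (x : SMat m n S U) (p : U) :
    evMat m n U p (matDer (interior σ (whole U)) x) =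
      matDer (CliffordAlgebra.contractLeft (σ.toFun p)) (evMat m n U p x) := by
  ext i j
  rw [evMat_apply, matDer_apply, matDer_apply]
  split_ifs
  · rfl
  · rw [map_neg]; rfl

theorem IsExp.isWExp {Y h : SMat m n S U} (H : IsExp Y h) (p : U) :
    IsWExp (evMat m n U p Y) (evMat m n U p h) := by
  intro l
  have hl : ∀ x : SMat m n S U, l (evMat m n U p x) =
      ∑ i, ∑ j, (l ∘ₗ Matrix.singleLinearMap ℝ i j) ((x i j).1 p) := by
    intro x
    conv_lhs => rw [Matrix.matrix_eq_sum_single (evMat m n U p x)]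
    simp only [map_sum]
    rfl
  simp only [← map_pow, hl, Finset.mul_sum]
  exact hasSum_sum fun i _ => hasSum_sum fun j _ => H p i j _

theorem IsExp.resMat {Y h : SMat m n S U} (H : IsExp Y h) (hV : V ≤ U) :
    IsExp (resMat m n hV Y) (resMat m n hV h) := by
  intro p i j l
  simp only [← map_pow]
  exact H ⟨p, hV p.2⟩ i j l

variable {Δ : SpinorModule m n} {g₀ : PseudoMetric m M} {P : SpinStructure S Δ g₀}
  {DS : CovariantDerivative (𝓡 m) (EuclideanSpace ℝ (Fin n)) S} (g₁ : SpinorForm P DS)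

theorem SpinorForm.lieTensor_eq (U : Opens M) : g₁.lieTensor U = glin (invol U) g₁.lieAlg := by
  rw [glin_eq_span _ (isSuperComm_invol U), SpinorForm.lieTensor]
  congr 1
  ext y
  refine exists_congr fun x => and_congr_right fun _ => exists_congr fun a => ?_
  have : tensor x a = tens (invol U) x a := by
    ext1 i j
    rcases i with i | i <;> rfl
  rw [this]

theorem SpinorForm.resMat_mem_expGroup (hV : V ≤ U) {u : (SMat m n S U)ˣ} (hu : u ∈ g₁.expGroup U) :
    Units.map (resMat m n (S := S) hV : SMat m n S U →* SMat m n S V) u ∈ g₁.expGroup V := by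
  induction hu using Subgroup.closure_induction with
  | mem u hu =>
    obtain ⟨Y, hY, hYe, hexp⟩ := hu
    refine Subgroup.subset_closure ⟨resMat m n hV Y, ?_, ?_, hexp.resMat hV⟩
    · rw [g₁.lieTensor_eq, mem_glin_iff_evMat] at hY ⊢
      exact fun p => hY ⟨p, hV p.2⟩
    · intro i j
      change res hV (invol U (Y i j)) = _
      rw [hYe i j]
      split_ifs
      · rfl
      · exact map_neg _ _
  | one => rw [map_one]; exact one_mem _
  | mul u v _ _ hu hv => rw [map_mul]; exact mul_mem hu hv
  | inv u _ hu => rw [map_inv]; exact inv_mem hu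

theorem SpinorForm.isGroupElt_of_mem_expGroup (hg : IsSuperLie g₁.lieAlg) {u : (SMat m n S U)ˣ}
    (hu : u ∈ g₁.expGroup U) (p : U) : IsGroupElt CliffordAlgebra.involute g₁.lieAlg
      (evMat m n U p u) (evMat m n U p ((u⁻¹ : (SMat m n S U)ˣ) : SMat m n S U)) := by
  have := finiteDimensional_fiber (EuclideanSpace ℝ (Fin n)) (E := S) p.1
  induction hu using Subgroup.closure_induction with
  | mem u hu =>
    obtain ⟨Y, hY, hYe, hexp⟩ := hu
    rw [g₁.lieTensor_eq, mem_glin_iff_evMat] at hY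
    refine isGroupElt_exp isSuperComm_involute hg (hY p) (sEven_iff_evMat.1 hYe p)
      (hexp.isWExp p) ?_ ?_
    · rw [← map_mul, Units.mul_inv, map_one]
    · rw [← map_mul, Units.inv_mul, map_one]
  | one => rw [inv_one, Units.val_one, map_one]; exact IsGroupElt.one
  | mul u v _ _ hu hv =>
    rw [mul_inv_rev, Units.val_mul, Units.val_mul, map_mul, map_mul]
    exact hu.mul hv
  | inv u _ hu => rw [inv_inv]; exact hu.inv

theorem SpinorForm.mem_groupSheaf_iff {h : SMat m n S U} : h ∈ g₁.groupSheaf U ↔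
    ∀ p ∈ U, ∃ W : Opens M, ∃ hW : W ≤ U, p ∈ W ∧ ∃ u ∈ g₁.expGroup W,
      (u : SMat m n S W) = resMat m n hW h := Iff.rfl

theorem SpinorForm.one_mem_groupSheaf : (1 : SMat m n S U) ∈ g₁.groupSheaf U :=
  g₁.mem_groupSheaf_iff.2 fun _ hp =>
    ⟨U, le_rfl, hp, 1, one_mem _, by rw [map_one, Units.val_one]⟩

theorem SpinorForm.mul_mem_groupSheaf {h k : SMat m n S U} (hh : h ∈ g₁.groupSheaf U)
    (hk : k ∈ g₁.groupSheaf U) : h * k ∈ g₁.groupSheaf U := by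
  refine g₁.mem_groupSheaf_iff.2 fun p hp => ?_
  obtain ⟨V, hV, hpV, u, hu, hu'⟩ := g₁.mem_groupSheaf_iff.1 hh p hp
  obtain ⟨W, hW, hpW, v, hv, hv'⟩ := g₁.mem_groupSheaf_iff.1 hk p hp
  refine ⟨V ⊓ W, inf_le_left.trans hV, ⟨hpV, hpW⟩, _, mul_mem
    (g₁.resMat_mem_expGroup (inf_le_left : V ⊓ W ≤ V) hu)
    (g₁.resMat_mem_expGroup (inf_le_right : V ⊓ W ≤ W) hv), ?_⟩
  rw [Units.val_mul, map_mul]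
  congr 1
  · exact congrArg (SpinSuper.resMat m n inf_le_left) hu'
  · exact congrArg (SpinSuper.resMat m n inf_le_right) hv'

/-- Sections of the sheaf of groups are invertible, and the inverses are sections as well. -/
theorem SpinorForm.exists_inv_groupSheaf (hg : IsSuperLie g₁.lieAlg) {h : SMat m n S U}
    (hh : h ∈ g₁.groupSheaf U) : ∃ h' ∈ g₁.groupSheaf U, ∀ p,
      IsGroupElt CliffordAlgebra.involute g₁.lieAlg (evMat m n U p h) (evMat m n U p h') := by
  have hloc := g₁.mem_groupSheaf_iff.1 hh
  have hpt : ∀ p : U, ∃ k, IsGroupElt CliffordAlgebra.involute g₁.lieAlg (evMat m n U p h) k := by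
    intro p
    obtain ⟨W, hW, hpW, u, hu, hu'⟩ := hloc p p.2
    have h1 := g₁.isGroupElt_of_mem_expGroup hg hu ⟨p, hpW⟩
    rw [hu', evMat_resMat] at h1
    exact ⟨_, h1⟩
  choose k hk using hpt
  -- the pointwise inverses agree with the local ones
  have hval : ∀ (W : Opens M) (hW : W ≤ U) (u : (SMat m n S W)ˣ),
      (u : SMat m n S W) = resMat m n hW h →
      ∀ p : W, evMat m n W p ((u⁻¹ : (SMat m n S W)ˣ) : SMat m n S W) = k ⟨p, hW p.2⟩ := by
    intro W hW u hu p
    refine left_inv_eq_right_inv (a := evMat m n W p u) ?_ ?_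
    · rw [← map_mul, Units.inv_mul, map_one]
    · rw [hu, evMat_resMat]; exact (hk _).mul_inv
  have hmem : ∀ i j, (fun p : U => k p i j) ∈ superFun m n S U := by
    intro i j
    refine mem_superFun_of_local fun p hp => ?_
    obtain ⟨W, hW, hpW, u, hu, hu'⟩ := hloc p hp
    refine ⟨W, hW, hpW, ?_⟩
    have : rawRes hW (fun p : U => k p i j) = ((u⁻¹ : (SMat m n S W)ˣ) : SMat m n S W) i j := by
      funext q
      exact (congrFun (congrFun (hval W hW u hu' q) i) j).symm
    rw [this]
    exact Subtype.property _
  refine ⟨Matrix.of fun i j => ⟨_, hmem i j⟩, g₁.mem_groupSheaf_iff.2 fun p hp => ?_, fun p => hk p⟩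
  obtain ⟨W, hW, hpW, u, hu, hu'⟩ := hloc p hp
  exact ⟨W, hW, hpW, u⁻¹, inv_mem hu, evMat_ext fun q => hval W hW u hu' q⟩

end GroupSheaf

/-! ### Logarithms of matrices -/

/-- Near the unit of a Banach algebra, the exponential map has an analytic local inverse. -/
theorem exists_analytic_log (𝔸 : Type*) [NormedRing 𝔸] [NormedAlgebra ℝ 𝔸] [CompleteSpace 𝔸] :
    ∃ L : 𝔸 → 𝔸, ∃ s : Set 𝔸, IsOpen s ∧ (1 : 𝔸) ∈ s ∧ L 1 = 0 ∧ (∀ x ∈ s, AnalyticAt ℝ L x) ∧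
      (∀ x ∈ s, NormedSpace.exp (L x) = x) ∧
      ∃ t ∈ 𝓝 (0 : 𝔸), Set.InjOn (NormedSpace.exp : 𝔸 → 𝔸) t := by
  have h1 : ContDiffAt ℝ ω (NormedSpace.exp : 𝔸 → 𝔸) 0 := (NormedSpace.exp_analytic 0).contDiffAt
  have h2 : HasFDerivAt (NormedSpace.exp : 𝔸 → 𝔸)
      ((ContinuousLinearEquiv.refl ℝ 𝔸 : 𝔸 ≃L[ℝ] 𝔸) : 𝔸 →L[ℝ] 𝔸) 0 := hasFDerivAt_exp_zero
  have hω : (ω : WithTop ℕ∞) ≠ 0 := by simp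
  let e := h1.toOpenPartialHomeomorph _ h2 hω
  have he : ∀ x, e x = NormedSpace.exp x := fun x => rfl
  have h0 : (0 : 𝔸) ∈ e.source := h1.mem_toOpenPartialHomeomorph_source h2 hω
  have he0 : e 0 = 1 := (he 0).trans NormedSpace.exp_zero
  have ht : (1 : 𝔸) ∈ e.target := he0 ▸ e.map_source h0
  have h3 : AnalyticAt ℝ e.symm 1 := by
    have := h1.to_localInverse h2 hω
    rw [NormedSpace.exp_zero] at this
    exact this.analyticAt
  refine ⟨e.symm, e.target ∩ {x | AnalyticAt ℝ e.symm x}, e.open_target.inter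
    (isOpen_analyticAt ℝ _), ⟨ht, h3⟩, ?_, fun x hx => hx.2, fun x hx => ?_,
    e.source, e.open_source.mem_nhds h0, e.injOn⟩
  · rw [← he0, e.left_inv h0]
  · rw [← he, e.right_inv hx.1]

/-- Smooth maps into finite dimensional normed spaces. -/
theorem smoothVal_iff {E : Type*} [NormedAddCommGroup E] [NormedSpace ℝ E] [FiniteDimensional ℝ E]
    {W : Opens M} {F : M → E} : SmoothVal m W F ↔ ContMDiffOn (𝓡 m) 𝓘(ℝ, E) ∞ F W := by
  constructor
  · intro h
    have h1 : ∀ i, ContMDiffOn (𝓡 m) 𝓘(ℝ, E) ∞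
        (fun p => (Module.finBasis ℝ E).repr (F p) i • Module.finBasis ℝ E i) W :=
      fun i => ContMDiffOn.smul (h.repr i) contMDiffOn_const
    have h2 := contMDiffOn_finsetSum (t := Finset.univ) fun i _ => h1 i
    exact h2.congr fun p _ => ((Module.finBasis ℝ E).sum_repr (F p)).symm
  · intro h l
    exact (LinearMap.toContinuousLinearMap l).contMDiff.comp_contMDiffOn h

variable (m M) in
/-- The logarithm of matrices near the identity, as a smooth map. -/
theorem exists_matrix_log (d : ℕ) :
    ∃ L : Matrix (Fin d) (Fin d) ℝ → Matrix (Fin d) (Fin d) ℝ,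
      ∃ s : Set (Matrix (Fin d) (Fin d) ℝ), IsOpen s ∧ 1 ∈ s ∧ L 1 = 0 ∧ ContinuousOn L s ∧
      (∀ x ∈ s, NormedSpace.exp (L x) = x) ∧
      (∃ t ∈ 𝓝 (0 : Matrix (Fin d) (Fin d) ℝ), Set.InjOn NormedSpace.exp t) ∧
      ∀ (W : Opens M) (k : M → Matrix (Fin d) (Fin d) ℝ), SmoothVal m W k → (∀ q ∈ W, k q ∈ s) →
        SmoothVal m W fun q => L (k q) := by
  let : NormedRing (Matrix (Fin d) (Fin d) ℝ) := Matrix.linftyOpNormedRing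
  let : NormedAlgebra ℝ (Matrix (Fin d) (Fin d) ℝ) := Matrix.linftyOpNormedAlgebra
  obtain ⟨L, s, hs, h1, hL1, hL, hexp, ht⟩ := exists_analytic_log (Matrix (Fin d) (Fin d) ℝ)
  refine ⟨L, s, hs, h1, hL1, fun x hx => (hL x hx).continuousAt.continuousWithinAt, hexp, ht,
    fun W k hk hks => ?_⟩
  rw [smoothVal_iff] at hk ⊢
  intro q hq
  exact ContMDiffAt.comp_contMDiffWithinAt q
    (hL _ (hks q hq)).contDiffAt.contMDiffAt (hk q hq)

/-! ### Logarithms in the spin group -/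

section SpinLog

variable (Δ : SpinorModule m n)

theorem continuous_matrix_exp {d : ℕ} :
    Continuous (NormedSpace.exp : Matrix (Fin d) (Fin d) ℝ → Matrix (Fin d) (Fin d) ℝ) := by
  let : NormedRing (Matrix (Fin d) (Fin d) ℝ) := Matrix.linftyOpNormedRing
  let : NormedAlgebra ℝ (Matrix (Fin d) (Fin d) ℝ) := Matrix.linftyOpNormedAlgebra
  let : NormedAlgebra ℚ (Matrix (Fin d) (Fin d) ℝ) := NormedAlgebra.restrictScalars ℚ ℝ _
  exact NormedSpace.exp_continuous

/-- If `exp A` is an isometry and the exponential map is injective on a set which contains `-A`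
and the adjoint of `A`, then `A` is skew-adjoint. -/
theorem SpinorModule.mem_so_of_exp {A : Matrix (Fin m) (Fin m) ℝ}
    {t : Set (Matrix (Fin m) (Fin m) ℝ)} (ht : Set.InjOn NormedSpace.exp t) (h1 : -A ∈ t)
    (h2 : Matrix.diagonal Δ.ε * A.transpose * Matrix.diagonal Δ.ε ∈ t)
    (hA : (NormedSpace.exp A).transpose * Matrix.diagonal Δ.ε * NormedSpace.exp A =
      Matrix.diagonal Δ.ε) : A ∈ Δ.so := by
  have hε := Δ.diagonal_mul_self
  have h3 : Matrix.diagonal Δ.ε * A.transpose * Matrix.diagonal Δ.ε = -A := by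
    refine ht h2 h1 ?_
    have e1 := exp_semiconj (B := Matrix.diagonal Δ.ε)
      (X := Matrix.diagonal Δ.ε * A.transpose * Matrix.diagonal Δ.ε) (Y := A.transpose) (by
        rw [← mul_assoc, ← mul_assoc, hε, one_mul])
    have e2 : NormedSpace.exp A * NormedSpace.exp (-A) = 1 := by
      rw [← Matrix.exp_add_of_commute A (-A) (Commute.neg_right (Commute.refl _)), add_neg_cancel,
        NormedSpace.exp_zero]
    calc NormedSpace.exp (Matrix.diagonal Δ.ε * A.transpose * Matrix.diagonal Δ.ε)
        = Matrix.diagonal Δ.ε * ((NormedSpace.exp A).transpose * Matrix.diagonal Δ.ε *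
            NormedSpace.exp A) * NormedSpace.exp (-A) := by
          rw [Matrix.exp_transpose] at e1
          generalize Matrix.diagonal Δ.ε * A.transpose * Matrix.diagonal Δ.ε = X at e1 ⊢
          rw [← one_mul (NormedSpace.exp X), ← hε, mul_assoc, e1]
          simp only [mul_assoc, e2, mul_one]
      _ = NormedSpace.exp (-A) := by rw [hA, hε, one_mul]
  change A.transpose * Matrix.diagonal Δ.ε + Matrix.diagonal Δ.ε * A = 0
  have h4 : A = -(Matrix.diagonal Δ.ε * A.transpose * Matrix.diagonal Δ.ε) := by rw [h3, neg_neg]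
  have h5 : Matrix.diagonal Δ.ε * A = -(A.transpose * Matrix.diagonal Δ.ε) := by
    conv_lhs => rw [h4]
    rw [mul_neg, ← mul_assoc, ← mul_assoc, hε, one_mul]
  rw [h5, add_neg_cancel]

/-- An element of the spin group over an exponential in `SO`, which is close to the corresponding
exponential of the spin representation, is equal to it. The quotient of the two is an even element
of the Clifford algebra which commutes with all vectors, thus a scalar, and it preserves a non-zero
bilinear form. -/
theorem SpinorModule.eq_exp_spinRep {B : Matrix (Fin n) (Fin n) ℝ} (hB : Δ.IsCompatible B)
    (hB0 : B ≠ 0) {A : Matrix (Fin m) (Fin m) ℝ} (hA : A ∈ Δ.so)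
    {g : (Matrix (Fin m) (Fin m) ℝ)ˣ × (Matrix (Fin n) (Fin n) ℝ)ˣ} (hg : g ∈ Δ.spinGroup)
    (h1 : (g.1 : Matrix (Fin m) (Fin m) ℝ) = NormedSpace.exp A) {i : Fin n}
    (hi : 0 < ((g.2 : Matrix (Fin n) (Fin n) ℝ) * NormedSpace.exp (-Δ.spinRep A)) i i) :
    (g.2 : Matrix (Fin n) (Fin n) ℝ) = NormedSpace.exp (Δ.spinRep A) := by
  let k : (Matrix (Fin m) (Fin m) ℝ)ˣ × (Matrix (Fin n) (Fin n) ℝ)ˣ :=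
    ((Matrix.isUnit_exp (-A)).unit, (Matrix.isUnit_exp (Δ.spinRep (-A))).unit)
  have hk : k ∈ Δ.spinGroup := Δ.exp_mem_spinGroup (neg_mem hA) rfl rfl
  have hx := mul_mem hg hk
  have e1 : NormedSpace.exp A * NormedSpace.exp (-A) = 1 := by
    rw [← Matrix.exp_add_of_commute A (-A) (Commute.neg_right (Commute.refl _)), add_neg_cancel,
      NormedSpace.exp_zero]
  have e2 : NormedSpace.exp (-Δ.spinRep A) * NormedSpace.exp (Δ.spinRep A) = 1 := by
    rw [← Matrix.exp_add_of_commute (-Δ.spinRep A) (Δ.spinRep A)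
      (Commute.neg_left (Commute.refl _)), neg_add_cancel, NormedSpace.exp_zero]
  have hx1 : ((g * k).1 : Matrix (Fin m) (Fin m) ℝ) = 1 := by
    rw [Prod.fst_mul, Units.val_mul, h1]; exact e1
  have hx2 : ((g * k).2 : Matrix (Fin n) (Fin n) ℝ) =
      (g.2 : Matrix (Fin n) (Fin n) ℝ) * NormedSpace.exp (-Δ.spinRep A) := by
    rw [Prod.snd_mul, Units.val_mul, ← map_neg]; rfl
  have hc : ∀ l, Δ.γ l * ((g * k).2 : Matrix (Fin n) (Fin n) ℝ) =
      ((g * k).2 : Matrix (Fin n) (Fin n) ℝ) * Δ.γ l := by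
    intro l
    rw [SpinorModule.spinGroup_γ hx, hx1]
    simp [Matrix.one_apply]
  obtain ⟨c, hc⟩ := Δ.scalar_of_even (Δ.spinGroup_mem_evenAlg hx).1 hc
  have hBx := hB.spinGroup hx
  rw [hc, Matrix.transpose_smul, Matrix.transpose_one, Matrix.smul_mul, one_mul, Matrix.mul_smul,
    mul_one, smul_smul] at hBx
  have hcc : c * c = 1 := by
    have : (c * c - 1) • B = 0 := by rw [sub_smul, one_smul, hBx, sub_self]
    exact sub_eq_zero.1 ((smul_eq_zero.1 this).resolve_right hB0)
  have hcpos : 0 < c := by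
    rw [← hx2, hc] at hi
    simpa using hi
  have hc1 : c = 1 := by nlinarith
  rw [hc1, one_smul, hx2] at hc
  calc (g.2 : Matrix (Fin n) (Fin n) ℝ) = (g.2 : Matrix (Fin n) (Fin n) ℝ) *
        NormedSpace.exp (-Δ.spinRep A) * NormedSpace.exp (Δ.spinRep A) := by
          rw [mul_assoc, e2, mul_one]
    _ = _ := by rw [hc, one_mul]

variable (M) in
/-- Logarithms of the elements of the spin group near the unit. -/
theorem SpinorModule.exists_log {B : Matrix (Fin n) (Fin n) ℝ} (hB : Δ.IsCompatible B)
    (hB0 : B ≠ 0) : ∃ L : Matrix (Fin m) (Fin m) ℝ → Matrix (Fin m) (Fin m) ℝ,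
      ∃ N ∈ 𝓝 (1 : Matrix (Fin m) (Fin m) ℝ × Matrix (Fin n) (Fin n) ℝ),
      (∀ g ∈ Δ.spinGroup, ((g.1 : Matrix (Fin m) (Fin m) ℝ), (g.2 : Matrix (Fin n) (Fin n) ℝ)) ∈ N →
        L g.1 ∈ Δ.so ∧ (g.1 : Matrix (Fin m) (Fin m) ℝ) = NormedSpace.exp (L g.1) ∧
        (g.2 : Matrix (Fin n) (Fin n) ℝ) = NormedSpace.exp (Δ.spinRep (L g.1))) ∧
      ∀ (W : Opens M) (k : M → Matrix (Fin m) (Fin m) ℝ) (k' : M → Matrix (Fin n) (Fin n) ℝ),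
        SmoothVal m W k → (∀ q ∈ W, (k q, k' q) ∈ N) → SmoothVal m W fun q => L (k q) := by
  obtain ⟨L, s, hs, h1, hL1, hL, hexp, ⟨t, ht, htinj⟩, hsm⟩ := exists_matrix_log m M m
  have hL' : ContinuousAt L 1 := hL.continuousAt (hs.mem_nhds h1)
  have hp1 : Filter.Tendsto (fun x : Matrix (Fin m) (Fin m) ℝ × Matrix (Fin n) (Fin n) ℝ => L x.1)
      (𝓝 1) (𝓝 0) := by
    have : ContinuousAt (fun x : Matrix (Fin m) (Fin m) ℝ × Matrix (Fin n) (Fin n) ℝ => L x.1) 1 :=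
      ContinuousAt.comp (f := Prod.fst) (g := L) hL' continuousAt_fst
    have h := this.tendsto
    rwa [show L (1 : Matrix (Fin m) (Fin m) ℝ × Matrix (Fin n) (Fin n) ℝ).1 = 0 from hL1] at h
  have i0 : Fin n := ⟨0, Δ.pos⟩
  have ev1 : ∀ᶠ x : Matrix (Fin m) (Fin m) ℝ × Matrix (Fin n) (Fin n) ℝ in 𝓝 1, x.1 ∈ s :=
    continuousAt_fst.eventually (hs.mem_nhds h1)
  have ev2 : ∀ᶠ x : Matrix (Fin m) (Fin m) ℝ × Matrix (Fin n) (Fin n) ℝ in 𝓝 1, -L x.1 ∈ t := by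
    have := hp1.neg
    rw [neg_zero] at this
    exact this.eventually ht
  have ev3 : ∀ᶠ x : Matrix (Fin m) (Fin m) ℝ × Matrix (Fin n) (Fin n) ℝ in 𝓝 1,
      Matrix.diagonal Δ.ε * (L x.1).transpose * Matrix.diagonal Δ.ε ∈ t := by
    have hc : Continuous fun A : Matrix (Fin m) (Fin m) ℝ =>
        Matrix.diagonal Δ.ε * A.transpose * Matrix.diagonal Δ.ε := by fun_prop
    have := (hc.tendsto 0).comp hp1
    rw [Matrix.transpose_zero, mul_zero, zero_mul] at this
    exact this.eventually ht
  have ev4 : ∀ᶠ x : Matrix (Fin m) (Fin m) ℝ × Matrix (Fin n) (Fin n) ℝ in 𝓝 1,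
      0 < (x.2 * NormedSpace.exp (-Δ.spinRep (L x.1))) i0 i0 := by
    have hc : Continuous fun A : Matrix (Fin m) (Fin m) ℝ => NormedSpace.exp (-Δ.spinRep A) :=
      continuous_matrix_exp.comp (LinearMap.continuous_of_finiteDimensional _).neg
    have h2 := (hc.tendsto 0).comp hp1
    rw [map_zero, neg_zero, NormedSpace.exp_zero] at h2
    have h3 : Filter.Tendsto (fun x : Matrix (Fin m) (Fin m) ℝ × Matrix (Fin n) (Fin n) ℝ => x.2)
      (𝓝 1) (𝓝 1) := continuousAt_snd
    have h4 := h3.mul h2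
    rw [mul_one] at h4
    have h5 : Continuous fun A : Matrix (Fin n) (Fin n) ℝ => A i0 i0 := by fun_prop
    have h6 := (h5.tendsto 1).comp h4
    rw [Matrix.one_apply_eq] at h6
    exact h6.eventually (lt_mem_nhds one_pos)
  refine ⟨L, _, (ev1.and (ev2.and (ev3.and ev4))), fun g hg hgN => ?_, fun W k k' hk hkN =>
    hsm W k hk fun q hq => (hkN q hq).1⟩
  obtain ⟨e1, e2, e3, e4⟩ := hgN
  have hA : L g.1 ∈ Δ.so := Δ.mem_so_of_exp htinj e2 e3 (by
    rw [hexp _ e1]; exact SpinorModule.spinGroup_orth hg)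
  exact ⟨hA, (hexp _ e1).symm, Δ.eq_exp_spinRep hB hB0 hA hg (hexp _ e1).symm e4⟩

end SpinLog

/-! ### The Lie superalgebra of an extension -/

section LieAlg

variable {Δ : SpinorModule m n} {g₀ : PseudoMetric m M} {P : SpinStructure S Δ g₀}
  {DS : CovariantDerivative (𝓡 m) (EuclideanSpace ℝ (Fin n)) S} (g₁ : SpinorForm P DS)

/-- The matrix of the form in a frame. -/
def SpinorForm.mat (p : M) (f : Frame m n S p) : Matrix (Fin n) (Fin n) ℝ :=
  Matrix.of fun a b => g₁.form p (f.2 a) (f.2 b)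

theorem SpinorForm.form_eq_mat (p : M) (f : Frame m n S p) (s t : S p) :
    g₁.form p s t = ∑ a, ∑ b, f.2.repr s a * f.2.repr t b * g₁.mat p f a b := by
  conv_lhs => rw [← f.2.sum_repr s, ← f.2.sum_repr t]
  simp only [map_sum, LinearMap.sum_apply, map_smul, LinearMap.smul_apply, smul_eq_mul,
    Finset.mul_sum]
  rw [Finset.sum_comm]
  refine Finset.sum_congr rfl fun a _ => Finset.sum_congr rfl fun b _ => ?_
  rw [SpinorForm.mat, Matrix.of_apply]; ring

theorem SpinStructure.ρ_apply (P : SpinStructure S Δ g₀) {p : M} {f : Frame m n S p}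
    (hf : f ∈ P.frames p) (i : Fin m) (s : S p) (a : Fin n) :
    f.2.repr (P.ρ p (f.1 i) s) a = (Δ.γ i).mulVec (fun b => f.2.repr s b) a := by
  conv_lhs => rw [← f.2.sum_repr s]
  simp only [map_sum, map_smul, P.ρ_frame p f hf, Finsupp.coe_finsetSum, Finset.sum_apply,
    Finsupp.smul_apply, Module.Basis.repr_self, smul_eq_mul, Matrix.mulVec, dotProduct]
  refine Finset.sum_congr rfl fun b _ => ?_
  simp [Finsupp.single_apply, mul_comm]

theorem SpinorForm.isCompatible_mat {p : M} {f : Frame m n S p} (hf : f ∈ P.frames p) :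
    Δ.IsCompatible (g₁.mat p f) := by
  obtain ⟨σ, τ, _, hτ, _, hρ, _⟩ := g₁.suitable p
  refine ⟨τ, by rcases hτ with rfl | rfl <;> norm_num, fun i => ?_⟩
  ext a b
  have h := hρ (f.1 i) (f.2 a) (f.2 b)
  rw [P.ρ_frame p f hf, P.ρ_frame p f hf] at h
  simp only [map_sum, LinearMap.sum_apply, map_smul, LinearMap.smul_apply, smul_eq_mul] at h
  rw [Matrix.mul_apply, Matrix.smul_apply, Matrix.mul_apply, smul_eq_mul]
  refine h.trans ?_
  congr 1
  exact Finset.sum_congr rfl fun c _ => mul_comm _ _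

theorem SpinorForm.mat_ne_zero (p : M) (f : Frame m n S p) : g₁.mat p f ≠ 0 := by
  intro h
  have h1 : f.2 ⟨0, Δ.pos⟩ = 0 := (g₁.nondeg p).1 _ fun t => by
    rw [g₁.form_eq_mat p f, h]; simp
  exact f.2.ne_zero _ h1

/-- The odd matrix of a spinor `s` in a spin frame. -/
theorem SpinorForm.bracket_eq_oddMat {p : M} {f : Frame m n S p} (hf : f ∈ P.frames p) (s : S p) :
    (Matrix.of fun j i => f.1.coord i (g₁.bracket p s (f.2 j))) =
      Δ.oddMat (g₁.mat p f) fun a => f.2.repr s a := by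
  ext j i
  have h1 : ∀ v, g₀.form p (g₁.bracket p s (f.2 j)) v = g₁.form p (P.ρ p v s) (f.2 j) := by
    intro v
    exact LinearMap.BilinForm.apply_toDual_symm_apply _ v
  have h2 : ∀ w, f.1.coord i w = Δ.ε i * g₀.form p w (f.1 i) := by
    intro w
    conv_rhs => rw [← f.1.sum_repr w]
    simp only [map_sum, LinearMap.sum_apply, map_smul, LinearMap.smul_apply, smul_eq_mul,
      P.orthonormal p f hf]
    simp only [mul_ite, mul_zero, Finset.sum_ite_eq', Finset.mem_univ, if_true]
    rw [mul_left_comm, Δ.ε_mul_self, mul_one]; rfl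
  rw [Matrix.of_apply, h2, h1, SpinorModule.oddMat_apply, g₁.form_eq_mat p f]
  congr 1
  simp only [Matrix.vecMul, dotProduct, P.ρ_apply hf, Module.Basis.repr_self]
  refine Finset.sum_congr rfl fun a _ => ?_
  simp [Finsupp.single_apply]

/-- The odd part of the Lie superalgebra is stable under `𝔰𝔭𝔦𝔫` by equivariance of `π`. -/
theorem SpinorForm.isSuperLie_lieAlg : IsSuperLie g₁.lieAlg := by
  refine ⟨?_, ?_, ?_⟩
  · rintro _ ⟨A, hA, C, hC, rfl⟩
    refine ⟨A, hA, 0, zero_mem _, ?_⟩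
    ext i j
    rcases i with i | i <;> rcases j with j | j <;> simp [realDiag]
  · rintro _ ⟨A, hA, C, hC, rfl⟩ _ ⟨A', hA', C', hC', rfl⟩ hx
    have hC0 : C = 0 := by
      ext j i
      exact hx (Sum.inr j) (Sum.inl i) (by simp)
    subst hC0
    refine ⟨_, SpinorModule.so_bracket hA hA', C' * A.transpose - (Δ.spinRep A).transpose * C', ?_,
      ?_⟩
    · clear hx
      unfold SpinorForm.oddPart at hC' ⊢
      induction hC' using Submodule.span_induction with
      | zero => simp
      | add C D _ _ hC hD =>
        rw [Matrix.add_mul, Matrix.mul_add, add_sub_add_comm]; exact add_mem hC hD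
      | smul c C _ hC =>
        rw [Matrix.smul_mul, Matrix.mul_smul, ← smul_sub]; exact Submodule.smul_mem _ _ hC
      | mem C hC =>
        obtain ⟨p, f, hf, s, rfl⟩ := hC
        rw [g₁.bracket_eq_oddMat hf, SpinorModule.oddMat_bracket (g₁.isCompatible_mat hf) hA]
        refine Submodule.subset_span ⟨p, f, hf,
          f.2.equivFun.symm ((Δ.spinRep A).mulVec fun a => f.2.repr s a), ?_⟩
        rw [g₁.bracket_eq_oddMat hf]
        congr 1
        funext a
        exact (congrFun (f.2.equivFun.apply_symm_apply _) a).symm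
    · rw [SpinorModule.spinRep_bracket hA, Matrix.fromBlocks_multiply, Matrix.fromBlocks_multiply]
      simp only [Matrix.transpose_sub, Matrix.transpose_mul, Matrix.mul_zero, Matrix.zero_mul,
        add_zero, zero_add, Matrix.neg_mul, Matrix.mul_neg, neg_neg, neg_sub]
      rw [sub_eq_add_neg, Matrix.fromBlocks_neg, Matrix.fromBlocks_add]
      congr 1
      · abel
      · abel
  · rintro _ ⟨A, hA, C, hC, rfl⟩ _ ⟨A', hA', C', hC', rfl⟩ hx hy
    have e1 : ∀ {A C}, RealOdd (Matrix.fromBlocks (-A.transpose) 0 C (-(Δ.spinRep A).transpose)) →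
        Matrix.fromBlocks (-A.transpose) 0 C (-(Δ.spinRep A).transpose) =
        Matrix.fromBlocks 0 0 C 0 := by
      intro A C h
      ext i j
      rcases i with i | i <;> rcases j with j | j
      · simpa using h (Sum.inl i) (Sum.inl j) rfl
      · rfl
      · rfl
      · simpa using h (Sum.inr i) (Sum.inr j) rfl
    rw [e1 hx, e1 hy, Matrix.fromBlocks_multiply]
    simp

end LieAlg

/-! ### Matrices of smooth functions as supermatrices -/

section FunMat

variable {U V W : Opens M}

theorem evMat_funMat {C : M → Matrix (Fin m ⊕ Fin n) (Fin m ⊕ Fin n) ℝ}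
    (hC : ∀ i j, SmoothFun m U fun p => C p i j) (p : U) :
    evMat m n U p (funMat S U C hC) = (algebraMap ℝ (ExteriorAlgebra ℝ (S p))).mapMatrix (C p) :=
  rfl

theorem funMat_mul_eq {C D F : M → Matrix (Fin m ⊕ Fin n) (Fin m ⊕ Fin n) ℝ}
    (hC : ∀ i j, SmoothFun m U fun p => C p i j) (hD : ∀ i j, SmoothFun m U fun p => D p i j)
    (hF : ∀ i j, SmoothFun m U fun p => F p i j) (h : ∀ p ∈ U, C p * D p = F p) :
    funMat S U C hC * funMat S U D hD = funMat S U F hF :=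
  evMat_ext fun p => by rw [map_mul, evMat_funMat, evMat_funMat, evMat_funMat, ← map_mul, h p p.2]

theorem funMat_eq_one {C : M → Matrix (Fin m ⊕ Fin n) (Fin m ⊕ Fin n) ℝ}
    (hC : ∀ i j, SmoothFun m U fun p => C p i j) (h : ∀ p ∈ U, C p = 1) : funMat S U C hC = 1 :=
  evMat_ext fun p => by rw [evMat_funMat, h p p.2, map_one, map_one]

theorem resMat_funMat {C : M → Matrix (Fin m ⊕ Fin n) (Fin m ⊕ Fin n) ℝ}
    (hC : ∀ i j, SmoothFun m U fun p => C p i j) (hV : V ≤ U) :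
    resMat m n hV (funMat S U C hC) = funMat S V C fun i j => (hC i j).mono hV :=
  rfl

theorem sEven_funMat {C : M → Matrix (Fin m ⊕ Fin n) (Fin m ⊕ Fin n) ℝ}
    (hC : ∀ i j, SmoothFun m U fun p => C p i j) (h : ∀ p ∈ U, RealEven (C p)) :
    SEven (invol U) (funMat S U C hC) := by
  intro i j
  rw [show invol U (funMat S U C hC i j) = funMat S U C hC i j from invol_ofFun (hC i j)]
  split_ifs with hij
  · rfl
  · have : funMat S U C hC i j = 0 := superFun_ext fun p => by
      rw [map_zero]
      refine (ev_ofFun (hC i j) p).trans ?_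
      rw [h p p.2 i j hij, map_zero]
    rw [this, neg_zero]

/-- A real matrix belongs to `𝔤 ⊗ R` only if it belongs to `𝔤`: linear forms which vanish on `𝔤`
separate `𝔤` from its complement. -/
theorem map_algebraMap_mem_glin {R : Type*} [Ring R] [Algebra ℝ R] [Nontrivial R] (τ : R →ₐ[ℝ] R)
    {𝔤 : Submodule ℝ (Matrix (Fin m ⊕ Fin n) (Fin m ⊕ Fin n) ℝ)}
    {x : Matrix (Fin m ⊕ Fin n) (Fin m ⊕ Fin n) ℝ} :
    (algebraMap ℝ R).mapMatrix x ∈ glin τ 𝔤 ↔ x ∈ 𝔤 := by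
  have key : ∀ l : Matrix (Fin m ⊕ Fin n) (Fin m ⊕ Fin n) ℝ,
      ∑ i, ∑ j, l i j • twist τ i ((algebraMap ℝ R).mapMatrix x i j) =
        algebraMap ℝ R (∑ i, ∑ j, l i j * x i j) := by
    intro l
    simp only [RingHom.mapMatrix_apply, Matrix.map_apply, AlgHom.commutes, map_sum, map_mul,
      Algebra.smul_def]
  constructor
  · intro h
    refine mem_of_forall_dual fun l hl => ?_
    have hl' : ∀ y : Matrix (Fin m ⊕ Fin n) (Fin m ⊕ Fin n) ℝ,
        l y = ∑ i, ∑ j, l (Matrix.single i j 1) * y i j := by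
      intro y
      conv_lhs => rw [Matrix.matrix_eq_sum_single y]
      simp only [map_sum]
      refine Finset.sum_congr rfl fun i _ => Finset.sum_congr rfl fun j _ => ?_
      rw [mul_comm, ← smul_eq_mul, ← map_smul, Matrix.smul_single, smul_eq_mul, mul_one]
    have h1 := h (Matrix.of fun i j => l (Matrix.single i j 1)) fun y hy => by
      rw [← hl y hy, hl' y]; rfl
    rw [key, map_eq_zero_iff _ (FaithfulSMul.algebraMap_injective ℝ R)] at h1
    rw [hl' x]; exact h1
  · intro h l hl
    rw [key, hl x h, map_zero]

variable {Δ : SpinorModule m n} {g₀ : PseudoMetric m M} {P : SpinStructure S Δ g₀}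
  {DS : CovariantDerivative (𝓡 m) (EuclideanSpace ℝ (Fin n)) S} (g₁ : SpinorForm P DS)

theorem SpinorForm.funMat_mem_lieTensor {C : M → Matrix (Fin m ⊕ Fin n) (Fin m ⊕ Fin n) ℝ}
    (hC : ∀ i j, SmoothFun m U fun p => C p i j) :
    funMat S U C hC ∈ g₁.lieTensor U ↔ ∀ p ∈ U, C p ∈ g₁.lieAlg := by
  rw [g₁.lieTensor_eq, mem_glin_iff_evMat]
  simp only [evMat_funMat, map_algebraMap_mem_glin]
  exact ⟨fun h p hp => h ⟨p, hp⟩, fun h p => h p p.2⟩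

/-- A field of exponentials of even elements of `𝔤` with smooth logarithm belongs to the group
generated by the exponentials of `𝔤 ⊗ 𝒜(U)`. -/
theorem SpinorForm.exp_mem_expGroup {Y h h' : M → Matrix (Fin m ⊕ Fin n) (Fin m ⊕ Fin n) ℝ}
    (hY : ∀ i j, SmoothFun m U fun p => Y p i j) (hh : ∀ i j, SmoothFun m U fun p => h p i j)
    (hh' : ∀ i j, SmoothFun m U fun p => h' p i j)
    (hY1 : ∀ p ∈ U, Y p ∈ g₁.lieAlg) (hY2 : ∀ p ∈ U, RealEven (Y p))
    (hexp : ∀ p ∈ U, IsWExp (Y p) (h p)) (h1 : ∀ p ∈ U, h p * h' p = 1)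
    (h2 : ∀ p ∈ U, h' p * h p = 1) :
    ∃ u ∈ g₁.expGroup U, (u : SMat m n S U) = funMat S U h hh := by
  have one : ∀ i j, SmoothFun m U fun _ => (1 : Matrix (Fin m ⊕ Fin n) (Fin m ⊕ Fin n) ℝ) i j :=
    fun i j => smoothFun_const _
  refine ⟨⟨funMat S U h hh, funMat S U h' hh', ?_, ?_⟩, ?_, rfl⟩
  · rw [funMat_mul_eq hh hh' one h1, funMat_eq_one one fun _ _ => rfl]
  · rw [funMat_mul_eq hh' hh one h2, funMat_eq_one one fun _ _ => rfl]
  · refine Subgroup.subset_closure ⟨funMat S U Y hY, (g₁.funMat_mem_lieTensor hY).2 hY1,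
      sEven_funMat hY hY2, fun p i j l => ?_⟩
    let a := (Algebra.ofId ℝ (ExteriorAlgebra ℝ (S p))).mapMatrix (m := Fin m ⊕ Fin n)
    have h3 := (hexp p p.2) (l ∘ₗ Matrix.entryLinearMap ℝ _ i j ∘ₗ a.toLinearMap)
    have h4 : ∀ N, evMat m n U p (funMat S U Y hY ^ N) = a (Y p ^ N) := fun N => by
      rw [map_pow, map_pow]; rfl
    have h5 : ∀ N, l (((funMat S U Y hY ^ N) i j).1 p) =
        (l ∘ₗ Matrix.entryLinearMap ℝ _ i j ∘ₗ a.toLinearMap) (Y p ^ N) := fun N =>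
      congrArg (fun x => l (x i j)) (h4 N)
    simp only [h5]
    exact h3

theorem isWExp_fromBlocks (A : Matrix (Fin m) (Fin m) ℝ) (B : Matrix (Fin n) (Fin n) ℝ) :
    IsWExp (Matrix.fromBlocks A 0 0 B)
      (Matrix.fromBlocks (NormedSpace.exp A) 0 0 (NormedSpace.exp B)) := by
  intro l
  let i1 : Matrix (Fin m) (Fin m) ℝ →ₗ[ℝ] Matrix (Fin m ⊕ Fin n) (Fin m ⊕ Fin n) ℝ :=
    { toFun := fun X => Matrix.fromBlocks X 0 0 0
      map_add' := fun X Y => by simp [Matrix.fromBlocks_add]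
      map_smul' := fun c X => by simp [Matrix.fromBlocks_smul] }
  let i2 : Matrix (Fin n) (Fin n) ℝ →ₗ[ℝ] Matrix (Fin m ⊕ Fin n) (Fin m ⊕ Fin n) ℝ :=
    { toFun := fun X => Matrix.fromBlocks 0 0 0 X
      map_add' := fun X Y => by simp [Matrix.fromBlocks_add]
      map_smul' := fun c X => by simp [Matrix.fromBlocks_smul] }
  have e : ∀ X Y, Matrix.fromBlocks X 0 0 Y = i1 X + i2 Y := fun X Y => by
    simp [i1, i2, Matrix.fromBlocks_add]
  have h := (isWExp_matrix A (l ∘ₗ i1)).add (isWExp_matrix B (l ∘ₗ i2))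
  simp only [Matrix.fromBlocks_diagonal_pow]
  simp only [e, map_add, mul_add]
  exact h

end FunMat

/-! ### Changes of spin frames -/

section Transition

variable {Δ : SpinorModule m n} {g₀ : PseudoMetric m M} {P : SpinStructure S Δ g₀}
  {DS : CovariantDerivative (𝓡 m) (EuclideanSpace ℝ (Fin n)) S} (g₁ : SpinorForm P DS)
  {U : Opens M}

/-- The matrix on `V^*` of an endomorphism of `V` which preserves `TM` and `S`. -/
def dualBlock (x : Matrix (Fin m) (Fin m) ℝ × Matrix (Fin n) (Fin n) ℝ) :
    Matrix (Fin m ⊕ Fin n) (Fin m ⊕ Fin n) ℝ :=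
  Matrix.fromBlocks x.1.transpose 0 0 x.2.transpose

theorem dualBlock_mul (x y : Matrix (Fin m) (Fin m) ℝ × Matrix (Fin n) (Fin n) ℝ) :
    dualBlock (x * y) = dualBlock y * dualBlock x := by
  simp [dualBlock, Matrix.fromBlocks_multiply]

theorem dualBlock_one :
    dualBlock (1 : Matrix (Fin m) (Fin m) ℝ × Matrix (Fin n) (Fin n) ℝ) = 1 := by
  simp [dualBlock]

theorem realEven_dualBlock (x : Matrix (Fin m) (Fin m) ℝ × Matrix (Fin n) (Fin n) ℝ) :
    RealEven (dualBlock x) := by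
  rintro (i | i) (j | j) h
  · exact absurd rfl h
  · rfl
  · rfl
  · exact absurd rfl h

theorem isWExp_dualBlock (A : Matrix (Fin m) (Fin m) ℝ) (B : Matrix (Fin n) (Fin n) ℝ) :
    IsWExp (dualBlock (A, B)) (dualBlock (NormedSpace.exp A, NormedSpace.exp B)) := by
  rw [dualBlock, dualBlock, ← Matrix.exp_transpose, ← Matrix.exp_transpose]
  exact isWExp_fromBlocks _ _

theorem smoothFun_dualBlock {x : M → Matrix (Fin m) (Fin m) ℝ × Matrix (Fin n) (Fin n) ℝ}
    (h1 : ∀ i j, SmoothFun m U fun p => (x p).1 i j)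
    (h2 : ∀ i j, SmoothFun m U fun p => (x p).2 i j) (i j) :
    SmoothFun m U fun p => dualBlock (x p) i j := by
  rcases i with i | i <;> rcases j with j | j
  · exact h1 j i
  · exact smoothFun_const 0
  · exact smoothFun_const 0
  · exact h2 j i

theorem SpinorForm.dualBlock_mem_lieAlg {A : Matrix (Fin m) (Fin m) ℝ} (hA : A ∈ Δ.so) :
    dualBlock (A, Δ.spinRep A) ∈ g₁.lieAlg :=
  ⟨-A, neg_mem hA, 0, zero_mem _, by simp [dualBlock]⟩

/-- The constant elements of the structure group. -/
theorem SpinorForm.const_mem_expGroup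
    {g : (Matrix (Fin m) (Fin m) ℝ)ˣ × (Matrix (Fin n) (Fin n) ℝ)ˣ} (hg : g ∈ Δ.spinGroup) :
    ∃ u ∈ g₁.expGroup U, (u : SMat m n S U) =
      funMat S U (fun _ => dualBlock (g.1.1, g.2.1)) fun _ _ => smoothFun_const _ := by
  have hc : ∀ x : Matrix (Fin m) (Fin m) ℝ × Matrix (Fin n) (Fin n) ℝ, ∀ i j,
      SmoothFun m U fun _ => dualBlock x i j := fun _ _ _ => smoothFun_const _
  induction hg using Subgroup.closure_induction with
  | mem g hg =>
    obtain ⟨A, hA, h1, h2⟩ := hg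
    refine g₁.exp_mem_expGroup (hc (A, Δ.spinRep A)) _ (hc (g.1⁻¹.1, g.2⁻¹.1))
      (fun _ _ => g₁.dualBlock_mem_lieAlg hA) (fun _ _ => realEven_dualBlock _) (fun _ _ => ?_)
      (fun _ _ => ?_) (fun _ _ => ?_)
    · rw [h1, h2]; exact isWExp_dualBlock _ _
    · rw [← dualBlock_mul, ← dualBlock_one]; congr 1; simp
    · rw [← dualBlock_mul, ← dualBlock_one]; congr 1; simp
  | one => exact ⟨1, one_mem _, (funMat_eq_one _ fun _ _ => dualBlock_one).symm⟩
  | mul g k _ _ hg hk =>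
    obtain ⟨u, hu, hu'⟩ := hg
    obtain ⟨v, hv, hv'⟩ := hk
    refine ⟨v * u, mul_mem hv hu, ?_⟩
    rw [Units.val_mul, hu', hv']
    exact funMat_mul_eq _ _ _ fun _ _ => (dualBlock_mul _ _).symm
  | inv g _ hg =>
    obtain ⟨u, hu, hu'⟩ := hg
    refine ⟨u⁻¹, inv_mem hu, ?_⟩
    have : funMat S U (fun _ => dualBlock (g.1⁻¹.1, g.2⁻¹.1)) (hc _) * (u : SMat m n S U) = 1 := by
      rw [hu', funMat_mul_eq (hc _) (hc _) (hc 1), funMat_eq_one _ fun _ _ => dualBlock_one]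
      intro _ _
      rw [← dualBlock_mul]; congr 1; simp
    exact (Units.eq_inv_of_mul_eq_one_right this).symm

/-- The matrices of a frame in another frame. -/
def frameMat {p : M} (f f' : Frame m n S p) :
    Matrix (Fin m) (Fin m) ℝ × Matrix (Fin n) (Fin n) ℝ :=
  (f'.1.toMatrix f.1, f'.2.toMatrix f.2)

theorem frameMat_mul {p : M} (f f' f'' : Frame m n S p) :
    frameMat f' f'' * frameMat f f' = frameMat f f'' := by
  simp only [frameMat, Prod.mk_mul_mk, Module.Basis.toMatrix_mul_toMatrix]

theorem frameMat_self {p : M} (f : Frame m n S p) : frameMat f f = 1 := by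
  simp only [frameMat, Module.Basis.toMatrix_self]; rfl

theorem smoothFun_frameMat {f f' : ∀ p : M, Frame m n S p} (hf : SmoothFrame U f)
    (hf' : SmoothFrame U f') : (∀ i j, SmoothFun m U fun p => (frameMat (f p) (f' p)).1 i j) ∧
      ∀ i j, SmoothFun m U fun p => (frameMat (f p) (f' p)).2 i j :=
  ⟨fun i j => hf'.coord_vec (hf.1 j) le_rfl i, fun i j => hf'.coord_sec (hf.2 j) le_rfl i⟩

/-- Two spin frames at a point differ by an element of the spin group. -/
theorem SpinStructure.exists_spinGroup_frameMat (P : SpinStructure S Δ g₀) {p : M}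
    {f f' : Frame m n S p} (hf : f ∈ P.frames p)
    (hf' : f' ∈ P.frames p) : ∃ g ∈ Δ.spinGroup, frameMat f f' = (g.1.1, g.2.1) := by
  obtain ⟨g, hg, h1, h2⟩ := (P.torsor p f' hf' f).1 hf
  refine ⟨g, hg, Prod.ext ?_ ?_⟩
  · ext i j
    simp [frameMat, Module.Basis.toMatrix_apply, h1, Finsupp.single_apply]
  · ext i j
    simp [frameMat, Module.Basis.toMatrix_apply, h2, Finsupp.single_apply]

theorem smoothVal_matrix {a b : ℕ} {k : M → Matrix (Fin a) (Fin b) ℝ}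
    (h : ∀ i j, SmoothFun m U fun p => k p i j) : SmoothVal m U k := by
  intro l
  have : ∀ p, l (k p) = ∑ i, ∑ j, k p i j * l (Matrix.single i j 1) := by
    intro p
    conv_lhs => rw [Matrix.matrix_eq_sum_single (k p)]
    simp only [map_sum]
    refine Finset.sum_congr rfl fun i _ => Finset.sum_congr rfl fun j _ => ?_
    rw [← smul_eq_mul, ← map_smul, Matrix.smul_single, smul_eq_mul, mul_one]
  simp only [this]
  exact SmoothFun.sum _ fun i _ => SmoothFun.sum _ fun j _ => (h i j).mul (smoothFun_const _)

theorem SmoothVal.entry {a b : ℕ} {k : M → Matrix (Fin a) (Fin b) ℝ} (h : SmoothVal m U k) (i j) :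
    SmoothFun m U fun p => k p i j :=
  h (Matrix.entryLinearMap ℝ ℝ i j)

/-- The change of spin frames is a section of the sheaf of groups of the supergroup `G`. -/
theorem SpinorForm.transition_mem_groupSheaf {f f' : ∀ p : M, Frame m n S p}
    (hf : P.IsFrameField U f) (hf' : P.IsFrameField U f') :
    funMat S U (fun p => dualBlock (frameMat (f p) (f' p)))
      (smoothFun_dualBlock (smoothFun_frameMat hf.1 hf'.1).1 (smoothFun_frameMat hf.1 hf'.1).2) ∈
      g₁.groupSheaf U := by
  refine g₁.mem_groupSheaf_iff.2 fun p hp => ?_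
  obtain ⟨L, N, hN, hL, hLs⟩ := SpinorModule.exists_log M Δ (g₁.isCompatible_mat (hf.2 p hp))
    (g₁.mat_ne_zero p (f p))
  obtain ⟨g, hg, hgp⟩ := P.exists_spinGroup_frameMat (hf.2 p hp) (hf'.2 p hp)
  let c : Matrix (Fin m) (Fin m) ℝ × Matrix (Fin n) (Fin n) ℝ := (g⁻¹.1.1, g⁻¹.2.1)
  let c' : Matrix (Fin m) (Fin m) ℝ × Matrix (Fin n) (Fin n) ℝ := (g.1.1, g.2.1)
  have hcc : c * c' = 1 := by simp [c, c']
  have hcc' : c' * c = 1 := by simp [c, c']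
  -- the quotient of the change of frames by its value at `p`
  let w := fun q : M => c * frameMat (f q) (f' q)
  let w' := fun q : M => frameMat (f' q) (f q) * c'
  have hs := smoothFun_frameMat hf.1 hf'.1
  have hs' := smoothFun_frameMat hf'.1 hf.1
  have hw1 : SmoothVal m U fun q => (w q).1 :=
    (smoothVal_matrix hs.1).map (LinearMap.mulLeft ℝ c.1)
  have hw2 : SmoothVal m U fun q => (w q).2 :=
    (smoothVal_matrix hs.2).map (LinearMap.mulLeft ℝ c.2)
  have hw1' : SmoothVal m U fun q => (w' q).1 :=
    (smoothVal_matrix hs'.1).map (LinearMap.mulRight ℝ c'.1)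
  have hw2' : SmoothVal m U fun q => (w' q).2 :=
    (smoothVal_matrix hs'.2).map (LinearMap.mulRight ℝ c'.2)
  have hww' : ∀ q, w q * w' q = 1 := fun q => by
    simp only [w, w']
    rw [mul_assoc, ← mul_assoc (frameMat _ _), frameMat_mul, frameMat_self, one_mul, hcc]
  have hw'w : ∀ q, w' q * w q = 1 := fun q => by
    simp only [w, w']
    rw [mul_assoc, ← mul_assoc c', hcc', one_mul, frameMat_mul, frameMat_self]
  have hcont : ContinuousAt w p := by
    have hent : ∀ {h : M → ℝ}, SmoothFun m U h → ContinuousAt h p := fun hh =>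
      (hh.mdifferentiableAt hp).continuousAt
    refine ContinuousAt.prodMk ?_ ?_
    · exact continuousAt_pi.2 fun i => continuousAt_pi.2 fun j => hent (hw1.entry i j)
    · exact continuousAt_pi.2 fun i => continuousAt_pi.2 fun j => hent (hw2.entry i j)
  have hwp : w p = 1 := by simp only [w]; rw [hgp]; exact hcc
  have hmem : {q | w q ∈ N} ∩ U ∈ 𝓝 p :=
    Filter.inter_mem (hcont (by rw [hwp]; exact hN)) (U.isOpen.mem_nhds hp)
  obtain ⟨V', hV', hV'o, hpV⟩ := mem_nhds_iff.1 hmem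
  let V : Opens M := ⟨V', hV'o⟩
  have hVU : V ≤ U := fun q hq => (hV' hq).2
  have hVN : ∀ q ∈ V, ((w q).1, (w q).2) ∈ N := fun q hq => (hV' hq).1
  have hLw : SmoothVal m V fun q => L (w q).1 :=
    hLs V (fun q => (w q).1) (fun q => (w q).2) (hw1.mono hVU) hVN
  have hlog : ∀ q ∈ V, L (w q).1 ∈ Δ.so ∧ w q = (NormedSpace.exp (L (w q).1),
      NormedSpace.exp (Δ.spinRep (L (w q).1))) := by
    intro q hq
    obtain ⟨k, hk, hkq⟩ := P.exists_spinGroup_frameMat (hf.2 q (hVU hq)) (hf'.2 q (hVU hq))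
    have hwq : w q = ((g⁻¹ * k).1.1, (g⁻¹ * k).2.1) := by simp only [w]; rw [hkq]; rfl
    have := hVN q hq
    have h3 := hL (g⁻¹ * k) (mul_mem (inv_mem hg) hk) (by rw [hwq] at this; exact this)
    rw [hwq]
    exact ⟨h3.1, Prod.ext h3.2.1 h3.2.2⟩
  obtain ⟨u, hu, hu'⟩ := g₁.exp_mem_expGroup (U := V)
    (Y := fun q => dualBlock (L (w q).1, Δ.spinRep (L (w q).1)))
    (h := fun q => dualBlock (w q)) (h' := fun q => dualBlock (w' q))
    (smoothFun_dualBlock hLw.entry (hLw.map Δ.spinRep).entry)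
    (smoothFun_dualBlock (hw1.mono hVU).entry (hw2.mono hVU).entry)
    (smoothFun_dualBlock (hw1'.mono hVU).entry (hw2'.mono hVU).entry)
    (fun q hq => g₁.dualBlock_mem_lieAlg (hlog q hq).1) (fun q _ => realEven_dualBlock _)
    (fun q hq => by
      have := isWExp_dualBlock (L (w q).1) (Δ.spinRep (L (w q).1))
      rwa [← (hlog q hq).2] at this)
    (fun q _ => by rw [← dualBlock_mul, hw'w, dualBlock_one])
    (fun q _ => by rw [← dualBlock_mul, hww', dualBlock_one])
  obtain ⟨v, hv, hv'⟩ := g₁.const_mem_expGroup (U := V) hg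
  refine ⟨V, hVU, hpV, u * v, mul_mem hu hv, ?_⟩
  rw [Units.val_mul, hu', hv', resMat_funMat]
  refine funMat_mul_eq _ _ _ fun q _ => ?_
  rw [← dualBlock_mul]
  congr 1
  change c' * (c * _) = _
  rw [← mul_assoc, hcc', one_mul]

end Transition

/-! ### Spin tuples and small open sets -/

section SpinTuples

variable {Δ : SpinorModule m n} {g₀ : PseudoMetric m M} {P : SpinStructure S Δ g₀}
  {DS : CovariantDerivative (𝓡 m) (EuclideanSpace ℝ (Fin n)) S} (g₁ : SpinorForm P DS)
  {U : Opens M}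

variable (g₀) in
/-- The vector fields which correspond to the coframe of a frame field of `TM`. -/
def dualVec (f : ∀ p : M, Frame m n S p) (i : Fin m) (p : M) : TangentSpace (𝓡 m) p :=
  g₀.sharp p ((f p).1.coord i)

theorem form_sharp (p : M) (α : Module.Dual ℝ (TangentSpace (𝓡 m) p)) (v : TangentSpace (𝓡 m) p) :
    g₀.form p (g₀.sharp p α) v = α v :=
  LinearMap.BilinForm.apply_toDual_symm_apply _ v

theorem sharp_eq {p : M} {α : Module.Dual ℝ (TangentSpace (𝓡 m) p)} {w : TangentSpace (𝓡 m) p}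
    (h : ∀ v, g₀.form p w v = α v) : g₀.sharp p α = w := by
  refine sub_eq_zero.1 ((g₀.nondeg p).1 _ fun v => ?_)
  rw [map_sub, LinearMap.sub_apply, form_sharp, h, sub_self]

theorem SpinStructure.form_frame (P : SpinStructure S Δ g₀) {p : M} {f : Frame m n S p}
    (hf : f ∈ P.frames p) (i : Fin m) (v : TangentSpace (𝓡 m) p) :
    g₀.form p (f.1 i) v = Δ.ε i * f.1.coord i v := by
  conv_lhs => rw [← f.1.sum_repr v]
  simp only [map_sum, map_smul, smul_eq_mul, P.orthonormal p f hf, mul_ite, mul_zero,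
    Finset.sum_ite_eq, Finset.mem_univ, if_true]
  exact mul_comm _ _

theorem dualVec_eq {f : ∀ p : M, Frame m n S p} {p : M} (hf : f p ∈ P.frames p) (i : Fin m) :
    dualVec g₀ f i p = Δ.ε i • (f p).1 i :=
  sharp_eq fun v => by
    rw [map_smul, LinearMap.smul_apply, P.form_frame hf, smul_eq_mul, ← mul_assoc, Δ.ε_mul_self,
      one_mul]

theorem smoothVec_dualVec {f : ∀ p : M, Frame m n S p} (hf : P.IsFrameField U f) (i : Fin m) :
    SmoothVec U (dualVec g₀ f i) :=
  ((hf.1.1 i).smul (smoothFun_const (Δ.ε i))).congr fun p hp => by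
    rw [dualVec_eq (hf.2 p hp)]

theorem linearIndependent_dualVec (f : ∀ p : M, Frame m n S p) (p : M) :
    LinearIndependent ℝ fun i => dualVec g₀ f i p := by
  have h : LinearIndependent ℝ fun i => (f p).1.coord i := by
    rw [← (f p).1.coe_dualBasis]; exact (f p).1.dualBasis.linearIndependent
  exact h.map' ((g₀.form p).toDual (g₀.nondeg p)).symm.toLinearMap (LinearEquiv.ker _)

theorem SpinStructure.IsFrameField.isDualTuple {f : ∀ p : M, Frame m n S p}
    (hf : P.IsFrameField U f) {E : Fin m ⊕ Fin n → Endo m n S U}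
    (h1 : ∀ i, IsNabla DS (fun p => g₀.sharp p ((f p).1.coord i)) (E (Sum.inl i)))
    (h2 : ∀ j, ∃ σ : Covector m n S U, (∀ p, σ.toFun p = (f p).2.coord j) ∧
      E (Sum.inr j) = interior σ) : IsDualTuple DS (dualVec g₀ f) (fun p => (f p).2) E where
  smoothVec := smoothVec_dualVec hf
  smoothSec := hf.1.2
  indep := linearIndependent_dualVec f
  isNabla := h1
  isInterior := h2

/-- A spin frame field defines a tuple of vector fields on `M(S)`. -/
theorem SpinStructure.IsFrameField.exists_isDualTuple
    (hDS : ∀ (W : Opens M) (Y : ∀ p : M, TangentSpace (𝓡 m) p) (t : ∀ p : M, S p),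
      SmoothVec W Y → SmoothSec m n W t → SmoothSec m n W fun p => DS t p (Y p))
    {f : ∀ p : M, Frame m n S p} (hf : P.IsFrameField U f) : ∃ E, IsSpinTuple P DS U E ∧
      IsDualTuple DS (dualVec g₀ f) (fun p => (f p).2) E := by
  have hdir : ∀ i, ∀ W ≤ U, ∀ h : M → ℝ, SmoothFun m W h →
      SmoothFun m W fun p => dirDeriv h p (dualVec g₀ f i p) := fun i W hW h hh =>
    smoothFun_dirDeriv hf.1.2 hDS Δ.pos hW ((smoothVec_dualVec hf i).mono hW) hh
  have h1 : ∀ i, IsNabla DS (dualVec g₀ f i)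
      (nabla hf.1.2 hDS (smoothVec_dualVec hf i) (hdir i)) := fun i =>
    isNabla_nabla _ _ _ _
  let E : Fin m ⊕ Fin n → Endo m n S U :=
    Sum.elim (fun i => nabla hf.1.2 hDS (smoothVec_dualVec hf i) (hdir i))
      (fun j => interior (coordCovector hf.1.2 j))
  have h2 : ∀ j, ∃ σ : Covector m n S U, (∀ p, σ.toFun p = (f p).2.coord j) ∧
      E (Sum.inr j) = interior σ := fun j => ⟨coordCovector hf.1.2 j, fun _ => rfl, rfl⟩
  exact ⟨E, ⟨f, hf, h1, h2⟩, hf.isDualTuple h1 h2⟩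

/-- Two spin tuples over the same open set differ by a section of the sheaf of groups. -/
theorem SpinorForm.exists_eq_tupleMul {f f' : ∀ p : M, Frame m n S p} (hf : P.IsFrameField U f)
    (hf' : P.IsFrameField U f') {E E' : Fin m ⊕ Fin n → Endo m n S U}
    (hE : IsDualTuple DS (dualVec g₀ f) (fun p => (f p).2) E)
    (hE' : IsDualTuple DS (dualVec g₀ f') (fun p => (f' p).2) E') :
    ∃ h ∈ g₁.groupSheaf U, E' = tupleMul E h := by
  refine ⟨_, g₁.transition_mem_groupSheaf hf hf', hE.eq_tupleMul hE' _
    (fun p => realEven_dualBlock _) (fun p hp i => ?_) (fun p hp j v => ?_)⟩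
  · refine sharp_eq fun v => ?_
    have : v = ∑ k, (f p).1.coord k v • (f p).1 k := ((f p).1.sum_repr v).symm
    conv_rhs => rw [this]
    simp only [map_sum, LinearMap.sum_apply, map_smul, LinearMap.smul_apply]
    refine Finset.sum_congr rfl fun k _ => ?_
    rw [dualVec, form_sharp, smul_eq_mul, smul_eq_mul, mul_comm]
    rfl
  · have : v = ∑ k, (f p).2.coord k v • (f p).2 k := ((f p).2.sum_repr v).symm
    conv_lhs => rw [this]
    simp only [map_sum, map_smul]
    refine Finset.sum_congr rfl fun k _ => ?_
    rw [smul_eq_mul, mul_comm]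
    rfl

variable {g₁} in
theorem SpinorForm.sEven_of_mem_groupSheaf {h : SMat m n S U} (hh : h ∈ g₁.groupSheaf U) :
    SEven (invol U) h := by
  obtain ⟨h', _, hp⟩ := g₁.exists_inv_groupSheaf g₁.isSuperLie_lieAlg hh
  exact sEven_iff_evMat.2 fun p => (hp p).even

theorem SpinorForm.exists_mul_eq_one {h : SMat m n S U} (hh : h ∈ g₁.groupSheaf U) :
    ∃ h' ∈ g₁.groupSheaf U, h * h' = 1 ∧ h' * h = 1 := by
  obtain ⟨h', hh', hp⟩ := g₁.exists_inv_groupSheaf g₁.isSuperLie_lieAlg hh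
  refine ⟨h', hh', evMat_ext fun p => ?_, evMat_ext fun p => ?_⟩
  · rw [map_mul, (hp p).mul_inv, map_one]
  · rw [map_mul, (hp p).inv_mul, map_one]

/-- The domains of spin frame fields are small. -/
theorem SpinorForm.isSmall
    (hDS : ∀ (W : Opens M) (Y : ∀ p : M, TangentSpace (𝓡 m) p) (t : ∀ p : M, S p),
      SmoothVec W Y → SmoothSec m n W t → SmoothSec m n W fun p => DS t p (Y p))
    {f : ∀ p : M, Frame m n S p} (hf : P.IsFrameField U f) : g₁.IsSmall U := by
  obtain ⟨E₀, hE₀, hd⟩ := hf.exists_isDualTuple hDS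
  have hm : ∀ E ∈ g₁.gStructure U, ∃ h ∈ g₁.groupSheaf U, E = tupleMul E₀ h := by
    rintro _ ⟨E₁, ⟨f', hf', h1, h2⟩, h, hh, rfl⟩
    obtain ⟨k, hk, rfl⟩ := g₁.exists_eq_tupleMul hf hf' hd (hf'.isDualTuple h1 h2)
    exact ⟨k * h, g₁.mul_mem_groupSheaf hk hh,
      hd.isHomogeneous.tupleMul_tupleMul (sEven_of_mem_groupSheaf hk) h⟩
  refine ⟨⟨E₀, E₀, hE₀, 1, g₁.one_mem_groupSheaf, (tupleMul_one hd.isHomogeneous).symm⟩,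
    fun E hE => ?_⟩
  obtain ⟨h, hh, rfl⟩ := hm E hE
  have hmul := hd.isHomogeneous.tupleMul_tupleMul (sEven_of_mem_groupSheaf hh)
  obtain ⟨h', hh', h1, h2⟩ := g₁.exists_mul_eq_one hh
  refine ⟨fun k hk => ⟨E₀, hE₀, h * k, g₁.mul_mem_groupSheaf hh hk, hmul k⟩, fun E' hE' => ?_⟩
  obtain ⟨k, hk, rfl⟩ := hm E' hE'
  refine ⟨h' * k, ⟨g₁.mul_mem_groupSheaf hh' hk, ?_⟩, ?_⟩
  · rw [hmul, ← mul_assoc, h1, one_mul]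
  · rintro x ⟨_, hx⟩
    rw [hmul] at hx
    rw [hd.tupleMul_injective hx, ← mul_assoc, h2, one_mul]

end SpinTuples

/-! ### The matrix of a parallel form in spin frames -/

section Parallel

variable {U : Opens M}

/-- A smooth function whose differential vanishes is locally constant. -/
theorem eventually_eq_of_dirDeriv_eq_zero {h : M → ℝ} (hh : SmoothFun m U h)
    (h0 : ∀ p ∈ U, ∀ v : TangentSpace (𝓡 m) p, dirDeriv h p v = 0) {p : M} (hp : p ∈ U) :
    ∀ᶠ q in 𝓝 p, h q = h p := by
  let e := extChartAt (𝓡 m) p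
  have hto : IsOpen e.target := isOpen_extChartAt_target p
  have hso : IsOpen (e.target ∩ e.symm ⁻¹' U) :=
    (continuousOn_extChartAt_symm p).isOpen_inter_preimage hto U.isOpen
  have hps : e p ∈ e.target ∩ e.symm ⁻¹' U :=
    ⟨mem_extChartAt_target p, by
      rw [Set.mem_preimage, extChartAt_to_inv]; exact hp⟩
  obtain ⟨r, hr, hball⟩ := Metric.isOpen_iff.1 hso _ hps
  have hF : ∀ y ∈ Metric.ball (e p) r, HasFDerivAt (h ∘ e.symm)
      (0 : EuclideanSpace ℝ (Fin m) →L[ℝ] ℝ) y := by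
    intro y hy
    have hy' := hball hy
    have h1 : MDifferentiableAt 𝓘(ℝ, EuclideanSpace ℝ (Fin m)) (𝓡 m) e.symm y :=
      ((contMDiffOn_extChartAt_symm (n := ∞) p).contMDiffAt (hto.mem_nhds hy'.1)).mdifferentiableAt
        (by simp)
    have h2 : MDifferentiableAt (𝓡 m) 𝓘(ℝ, ℝ) h (e.symm y) := hh.mdifferentiableAt hy'.2
    have h3 : mfderiv (𝓡 m) 𝓘(ℝ, ℝ) h (e.symm y) = 0 := ContinuousLinearMap.ext (h0 _ hy'.2)
    have h4 := h2.hasMFDerivAt.comp y h1.hasMFDerivAt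
    rw [h3] at h4
    have h5 := h4.hasFDerivAt
    rwa [ContinuousLinearMap.zero_comp] at h5
  have hconst : ∀ y ∈ Metric.ball (e p) r, h (e.symm y) = h p := by
    intro y hy
    have := (convex_ball (e p) r).is_const_of_fderivWithin_eq_zero (𝕜 := ℝ) (f := h ∘ e.symm)
      (fun y hy => (hF y hy).differentiableAt.differentiableWithinAt) (fun y hy => by
        rw [fderivWithin_of_isOpen Metric.isOpen_ball hy, (hF y hy).fderiv]) hy
      (Metric.mem_ball_self hr)
    rw [Function.comp_apply, Function.comp_apply, extChartAt_to_inv] at this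
    exact this
  have h1 : ∀ᶠ q in 𝓝 p, e q ∈ Metric.ball (e p) r :=
    (continuousAt_extChartAt p).eventually (Metric.ball_mem_nhds _ hr)
  filter_upwards [h1, extChartAt_source_mem_nhds (I := 𝓡 m) p] with q hq hqs
  rw [← hconst _ hq, e.left_inv hqs]

variable {Δ : SpinorModule m n} {g₀ : PseudoMetric m M} {P : SpinStructure S Δ g₀}
  {DS : CovariantDerivative (𝓡 m) (EuclideanSpace ℝ (Fin n)) S} (g₁ : SpinorForm P DS)

/-- The matrix of a suitable form is the same in all spin frames at a point. -/
theorem SpinorForm.mat_eq {p : M} {f f' : Frame m n S p} (hf : f ∈ P.frames p)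
    (hf' : f' ∈ P.frames p) : g₁.mat p f' = g₁.mat p f := by
  obtain ⟨k, hk, -, h2⟩ := (P.torsor p f hf f').1 hf'
  rw [← (g₁.isCompatible_mat hf).spinGroup hk]
  ext a b
  simp only [SpinorForm.mat, Matrix.of_apply, h2, map_sum, map_smul, LinearMap.sum_apply,
    LinearMap.smul_apply, smul_eq_mul, Matrix.mul_apply, Matrix.transpose_apply, Finset.sum_mul]
  refine Finset.sum_congr rfl fun j _ => ?_
  rw [Finset.mul_sum]
  refine Finset.sum_congr rfl fun i _ => ?_
  ring

variable {D : CovariantDerivative (𝓡 m) (EuclideanSpace ℝ (Fin m))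
      (fun p : M => TangentSpace (𝓡 m) p)}

/-- The connection matrix of the Levi-Civita connection in a spin frame field. -/
theorem IsLeviCivita.mem_so (hD : IsLeviCivita g₀ D) {f : ∀ p : M, Frame m n S p}
    (hf : P.IsFrameField U f) {p : M} (hp : p ∈ U) (v : TangentSpace (𝓡 m) p) :
    (Matrix.of fun k i => (f p).1.coord k (D (fun q => (f q).1 i) p v)) ∈ Δ.so := by
  refine Δ.so_of_apply fun i k => ?_
  have h1 := hD.metric U _ _ (hf.1.1 i) (hf.1.1 k) p hp v
  have h2 : dirDeriv (fun q => g₀.form q ((f q).1 i) ((f q).1 k)) p v = 0 := by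
    rw [dirDeriv_congr hp (fun q hq => P.orthonormal q (f q) (hf.2 q hq) i k), dirDeriv_const]
  rw [h2, g₀.symm, P.form_frame (hf.2 p hp), P.form_frame (hf.2 p hp)] at h1
  simp only [Matrix.of_apply]
  linarith

/-- The connection matrix of the spin connection in a spin frame field. -/
theorem IsSpinConnection.coord_eq (hDS : IsSpinConnection P D DS) {f : ∀ p : M, Frame m n S p}
    (hf : P.IsFrameField U f) {p : M} (hp : p ∈ U) (v : TangentSpace (𝓡 m) p) (a b : Fin n) :
    (f p).2.repr (DS (fun q => (f q).2 a) p v) b =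
      Δ.spinRep (Matrix.of fun k i => (f p).1.coord k (D (fun q => (f q).1 i) p v)) b a := by
  have h1 : ∀ i, D (fun q => (f q).1 i) p v =
      ∑ k, (f p).1.coord k (D (fun q => (f q).1 i) p v) • (f p).1 k :=
    fun i => ((f p).1.sum_repr _).symm
  rw [hDS.induced U f hf p hp v a, SpinorModule.spinRep_apply]
  simp only [map_smul, map_sum, Finsupp.smul_apply, Matrix.smul_apply, Finsupp.coe_finsetSum,
    Finset.sum_apply, Matrix.sum_apply]
  congr 1
  refine Finset.sum_congr rfl fun i _ => ?_
  conv_lhs => rw [h1 i]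
  simp only [map_smul, map_sum, Finsupp.smul_apply, Finsupp.coe_finsetSum, LinearMap.sum_apply,
    LinearMap.smul_apply, Finset.sum_apply, P.ρ_apply (hf.2 p hp), Matrix.of_apply,
    smul_eq_mul, mul_assoc]
  rw [Finset.mul_sum]
  refine Finset.sum_congr rfl fun k _ => ?_
  congr 2
  rw [Matrix.mulVec, dotProduct, Matrix.mul_apply]
  refine Finset.sum_congr rfl fun c _ => ?_
  congr 1
  rw [Matrix.mulVec, dotProduct, Finset.sum_eq_single a]
  · simp
  · intro j _ hj; simp [hj.symm]
  · simp

/-- The matrix of a parallel suitable form in spin frames is locally constant. -/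
theorem SpinorForm.eventually_mat_eq (hD : IsLeviCivita g₀ D) (hDS : IsSpinConnection P D DS)
    (p : M) : ∀ᶠ q in 𝓝 p, ∀ f ∈ P.frames p, ∀ f' ∈ P.frames q, g₁.mat q f' = g₁.mat p f := by
  obtain ⟨W, hpW, f, hfs, hfP⟩ := P.local_section p
  have hf : P.IsFrameField W f := ⟨hfs, hfP⟩
  have h1 : ∀ a b, ∀ᶠ q in 𝓝 p, g₁.mat q (f q) a b = g₁.mat p (f p) a b := by
    intro a b
    refine eventually_eq_of_dirDeriv_eq_zero (U := W) (h := fun q => g₁.mat q (f q) a b)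
      (g₁.smooth W _ _ (hfs.2 a) (hfs.2 b)) (fun q hq v => ?_) hpW
    refine (g₁.parallel W _ _ (hfs.2 a) (hfs.2 b) q hq v).trans ?_
    have h2 := congrFun (congrFun
      ((g₁.isCompatible_mat (hfP q hq)).spinRep (hD.mem_so hf hq v)) a) b
    rw [Matrix.mul_apply, Matrix.neg_apply, Matrix.mul_apply] at h2
    rw [g₁.form_eq_mat q (f q), g₁.form_eq_mat q (f q)]
    simp only [hDS.coord_eq hf hq, Module.Basis.repr_self, Finsupp.single_apply, mul_ite, mul_one,
      mul_zero, ite_mul, one_mul, zero_mul, Finset.sum_ite_eq, Finset.mem_univ, if_true,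
      Finset.sum_ite_irrel, Finset.sum_const_zero, Matrix.transpose_apply] at h2 ⊢
    simp only [mul_comm (g₁.mat q (f q) a _)] at h2
    linarith
  have h3 : ∀ᶠ q in 𝓝 p, ∀ a b, g₁.mat q (f q) a b = g₁.mat p (f p) a b :=
    Filter.eventually_all.2 fun a => Filter.eventually_all.2 fun b => h1 a b
  filter_upwards [h3, W.isOpen.mem_nhds hpW] with q hq hqW g hg g' hg'
  rw [g₁.mat_eq (hfP q hqW) hg', g₁.mat_eq (hfP p hpW) hg]
  ext a b
  exact hq a b

theorem SpinStructure.frames_nonempty (P : SpinStructure S Δ g₀) (p : M) :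
    (P.frames p).Nonempty := by
  obtain ⟨W, hpW, f, _, hfP⟩ := P.local_section p
  exact ⟨f p, hfP p hpW⟩

/-- On a connected manifold, the matrix of a parallel suitable form is the same in all spin
frames. -/
theorem SpinorForm.mat_const [PreconnectedSpace M] (hD : IsLeviCivita g₀ D)
    (hDS : IsSpinConnection P D DS) {p q : M} {f : Frame m n S p} (hf : f ∈ P.frames p)
    {f' : Frame m n S q} (hf' : f' ∈ P.frames q) : g₁.mat q f' = g₁.mat p f := by
  choose F hF using fun p => P.frames_nonempty p
  have h : IsLocallyConstant fun p => g₁.mat p (F p) :=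
    (IsLocallyConstant.iff_eventually_eq _).2 fun p =>
      (g₁.eventually_mat_eq hD hDS p).mono fun q hq => hq _ (hF p) _ (hF q)
  rw [g₁.mat_eq (hF q) hf', g₁.mat_eq (hF p) hf]
  exact h.apply_eq_of_preconnectedSpace q p

/-- On a connected manifold the odd part of the Lie superalgebra consists of the odd matrices of
spinors in any single spin frame. -/
theorem SpinorForm.exists_of_mem_oddPart [PreconnectedSpace M] (hD : IsLeviCivita g₀ D)
    (hDS : IsSpinConnection P D DS) {p : M} {f : Frame m n S p} (hf : f ∈ P.frames p)
    {C : Matrix (Fin n) (Fin m) ℝ} (hC : C ∈ g₁.oddPart) :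
    ∃ t, C = Δ.oddMat (g₁.mat p f) t := by
  unfold SpinorForm.oddPart at hC
  induction hC using Submodule.span_induction with
  | mem C hC =>
    obtain ⟨q, f', hf', s, rfl⟩ := hC
    exact ⟨_, by rw [g₁.bracket_eq_oddMat hf', g₁.mat_const hD hDS hf hf']⟩
  | zero => exact ⟨0, by ext j i; simp [SpinorModule.oddMat_apply]⟩
  | add C C' _ _ hC hC' =>
    obtain ⟨t, rfl⟩ := hC
    obtain ⟨t', rfl⟩ := hC'
    refine ⟨t + t', ?_⟩
    ext j i
    simp [SpinorModule.oddMat_apply, Matrix.mulVec_add, Matrix.add_vecMul, mul_add]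
  | smul c C _ hC =>
    obtain ⟨t, rfl⟩ := hC
    refine ⟨c • t, ?_⟩
    ext j i
    simp [SpinorModule.oddMat_apply, Matrix.mulVec_smul, Matrix.smul_vecMul]
    ring

end Parallel

/-! ### Twistor spinors and Killing vector fields -/

section Twistor

variable {Δ : SpinorModule m n} {g₀ : PseudoMetric m M} {P : SpinStructure S Δ g₀}
  {DS : CovariantDerivative (𝓡 m) (EuclideanSpace ℝ (Fin n)) S} (g₁ g₁' : SpinorForm P DS)
  {U : Opens M} {s : ∀ p : M, S p}

variable (P DS) in
/-- `s` is a twistor spinor: its covariant derivative is `v ↦ ρ(v) t` for a spinor `t`. -/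
def IsTwistor (s : ∀ p : M, S p) : Prop :=
  ∀ p, ∃ t : S p, ∀ v, DS s p v = P.ρ p v t

theorem SpinorForm.coord_bracket {p : M} {f : Frame m n S p} (hf : f ∈ P.frames p) (i : Fin m)
    (t w : S p) :
    f.1.coord i (g₁.bracket p t w) = Δ.ε i * g₁.form p (P.ρ p (f.1 i) t) w := by
  have h1 : g₀.form p (g₁.bracket p t w) (f.1 i) = g₁.form p (P.ρ p (f.1 i) t) w :=
    form_sharp p _ _
  rw [← h1, g₀.symm, P.form_frame hf, ← mul_assoc, Δ.ε_mul_self, one_mul]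

/-- The matrix of the Lie derivative along `X_s` of the tuple of a spin frame field. -/
def SpinorForm.derMat (s : ∀ p : M, S p) (f : ∀ p : M, Frame m n S p) (p : M) :
    Matrix (Fin m ⊕ Fin n) (Fin m ⊕ Fin n) ℝ :=
  Matrix.fromBlocks 0 0
    (Matrix.of fun j i => -g₁.form p (DS s p (dualVec g₀ f i p)) ((f p).2 j)) 0

theorem SpinorForm.smoothFun_derMat
    (hDS : ∀ (W : Opens M) (Y : ∀ p : M, TangentSpace (𝓡 m) p) (t : ∀ p : M, S p),
      SmoothVec W Y → SmoothSec m n W t → SmoothSec m n W fun p => DS t p (Y p))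
    (hs : SmoothSec m n ⊤ s) {f : ∀ p : M, Frame m n S p} (hf : P.IsFrameField U f) (i j) :
    SmoothFun m U fun p => g₁.derMat s f p i j := by
  rcases i with i | i <;> rcases j with j | j
  · exact smoothFun_const 0
  · exact smoothFun_const 0
  · refine ((g₁.smooth U _ _ (hDS U _ s (smoothVec_dualVec hf j) (hs.mono le_top))
      (hf.1.2 i)).mul (smoothFun_const (-1))).congr fun p _ => ?_
    rw [mul_neg_one]; rfl
  · exact smoothFun_const 0

theorem SpinorForm.derMat_eq_zero (f : ∀ p : M, Frame m n S p) (p : M) (k i : Fin m ⊕ Fin n)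
    (h : ¬(k.isLeft = false ∧ i.isLeft = true)) : g₁.derMat s f p k i = 0 := by
  rcases k with k | k <;> rcases i with i | i
  · rfl
  · rfl
  · exact absurd ⟨rfl, rfl⟩ h
  · rfl

/-- The section `s^*` over an open set. -/
def SpinorForm.flatOn (s : ∀ p : M, S p) (hs : SmoothSec m n ⊤ s) (U : Opens M) :
    Covector m n S U where
  toFun p := g₁.form p (s p)
  smooth _ _ t ht := g₁.smooth _ s t (hs.mono le_top) ht

theorem SpinorForm.restrict_spinorField (hs : SmoothSec m n ⊤ s) :
    (g₁.spinorField s hs).restrict le_top = interior (g₁.flatOn s hs U) := rfl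

/-- The Lie derivative along `X_s` of the tuple of a spin frame field is given by the covariant
derivative of `s`, since `g₁` is parallel. -/
theorem SpinorForm.lieDer_spinorField
    (hDS : ∀ (W : Opens M) (Y : ∀ p : M, TangentSpace (𝓡 m) p) (t : ∀ p : M, S p),
      SmoothVec W Y → SmoothSec m n W t → SmoothSec m n W fun p => DS t p (Y p))
    (hs : SmoothSec m n ⊤ s) {f : ∀ p : M, Frame m n S p} (hf : P.IsFrameField U f)
    {E : Fin m ⊕ Fin n → Endo m n S U}
    (hE : IsDualTuple DS (dualVec g₀ f) (fun p => (f p).2) E) :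
    lieDer (interior (g₁.flatOn s hs U)) E =
      tupleMul E (funMat S U (g₁.derMat s f) (g₁.smoothFun_derMat hDS hs hf)) := by
  refine hE.lieDer_interior _ _ (g₁.derMat_eq_zero f) fun i W _ t ht p hp => ?_
  have h1 := g₁.parallel W s t (hs.mono le_top) ht p hp (dualVec g₀ f i p)
  have h2 : g₁.form p (DS s p (dualVec g₀ f i p)) (t p) = ∑ j,
      g₁.form p (DS s p (dualVec g₀ f i p)) ((f p).2 j) * (f p).2.coord j (t p) := by
    conv_lhs => rw [← (f p).2.sum_repr (t p)]
    simp only [map_sum, map_smul, smul_eq_mul]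
    exact Finset.sum_congr rfl fun j _ => mul_comm _ _
  change g₁.form p (s p) _ - dirDeriv (fun q => g₁.form q (s q) (t q)) p _ =
    ∑ j, -g₁.form p (DS s p (dualVec g₀ f i p)) ((f p).2 j) * (f p).2.coord j (t p)
  simp only [neg_mul, Finset.sum_neg_distrib, ← h2]
  linarith

/-- For a twistor spinor, the matrix of the Lie derivative is in the Lie superalgebra of any
extension of the metric. -/
theorem SpinorForm.derMat_mem_lieAlg (hs : IsTwistor P DS s) {f : ∀ p : M, Frame m n S p} {p : M}
    (hf : f p ∈ P.frames p) : g₁.derMat s f p ∈ g₁'.lieAlg := by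
  obtain ⟨t, ht⟩ := hs p
  obtain ⟨_, τ, _, hτ, _, hρ, _⟩ := g₁.suitable p
  obtain ⟨_, τ', _, hτ', _, hρ', _⟩ := g₁'.suitable p
  have hττ : τ' * τ' = 1 := by rcases hτ' with rfl | rfl <;> norm_num
  have := finiteDimensional_fiber (EuclideanSpace ℝ (Fin n)) (E := S) p
  -- the spinor which corresponds to `t` under the two suitable forms
  let t' := ((g₁'.form p).toDual (g₁'.nondeg p)).symm (g₁.form p t)
  have ht' : ∀ w, g₁'.form p t' w = g₁.form p t w := fun w =>
    LinearMap.BilinForm.apply_toDual_symm_apply _ w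
  refine ⟨0, zero_mem _, _, Submodule.subset_span ⟨p, f p, hf, (-(τ * τ')) • t', rfl⟩, ?_⟩
  rw [map_zero, Matrix.transpose_zero, Matrix.transpose_zero, neg_zero, neg_zero]
  refine congrArg (fun C => Matrix.fromBlocks 0 0 C 0) ?_
  ext j i
  rw [Matrix.of_apply, Matrix.of_apply, g₁'.coord_bracket hf, dualVec_eq hf, ht, map_smul,
    LinearMap.smul_apply, map_smul, LinearMap.smul_apply, map_smul, map_smul, LinearMap.smul_apply,
    hρ, hρ', ht', smul_eq_mul, smul_eq_mul]
  linear_combination (-(Δ.ε i) * τ * g₁.form p t (P.ρ p ((f p).1 i) ((f p).2 j))) * -hττ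

/-- For a twistor spinor `s`, the vector field `X_s` defined by one extension of the metric is a
Killing vector field for any extension. -/
theorem IsTwistor.isKilling
    (hDS : ∀ (W : Opens M) (Y : ∀ p : M, TangentSpace (𝓡 m) p) (t : ∀ p : M, S p),
      SmoothVec W Y → SmoothSec m n W t → SmoothSec m n W fun p => DS t p (Y p))
    (hs : SmoothSec m n ⊤ s) (htw : IsTwistor P DS s) :
    g₁'.IsKilling (g₁.spinorField s hs) := by
  refine ⟨isVectorField_interior _, ?_⟩
  rintro U - _ ⟨E, ⟨f, hf, h1, h2⟩, h, hh, rfl⟩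
  have hE := hf.isDualTuple h1 h2
  have hhE := SpinorForm.sEven_of_mem_groupSheaf hh
  obtain ⟨h', _, hp⟩ := g₁'.exists_inv_groupSheaf g₁'.isSuperLie_lieAlg hh
  have hmul : h * h' = 1 := evMat_ext fun p => by rw [map_mul, (hp p).mul_inv, map_one]
  have hx := (g₁'.funMat_mem_lieTensor (g₁.smoothFun_derMat hDS hs hf)).2 fun p hp =>
    g₁.derMat_mem_lieAlg g₁' htw (hf.2 p hp)
  set x := funMat S U (g₁.derMat s f) (g₁.smoothFun_derMat hDS hs hf)
  set d := interior (g₁.flatOn s hs U) (whole U)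
  -- the Lie derivative of `E h` is `E (d h + x h)`, and `E = (E h) h⁻¹`
  refine ⟨h' * (matDer d h + x * h), ?_, ?_⟩
  · rw [g₁'.lieTensor_eq, mem_glin_iff_evMat] at hx ⊢
    intro p
    rw [map_mul, map_add, map_mul, mul_add, ← mul_assoc, evMat_matDer]
    exact add_mem ((hp p).logDer _ (isOddDeriv_contractLeft _)) ((hp p).conj _ (hx p))
  · rw [hE.isHomogeneous.tupleMul_tupleMul hhE, ← mul_assoc, hmul, one_mul,
      SpinorForm.restrict_spinorField]
    refine lieDer_tupleMul (isOddDer_interior _) hE.isHomogeneous hhE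
      (g₁.lieDer_spinorField hDS hs hf hE) (fun k i hki => ?_) fun k i =>
        invol_ofFun (g₁.smoothFun_derMat hDS hs hf k i)
    refine superFun_ext fun p => ?_
    rw [map_zero]
    refine (ev_ofFun (g₁.smoothFun_derMat hDS hs hf k i) p).trans ?_
    rw [g₁.derMat_eq_zero f p k i hki, map_zero]

/-- If the vector field `X_s` is a Killing vector field, then `s` is a twistor spinor. -/
theorem SpinorForm.IsKilling.isTwistor [PreconnectedSpace M]
    {D : CovariantDerivative (𝓡 m) (EuclideanSpace ℝ (Fin m))
      (fun p : M => TangentSpace (𝓡 m) p)}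
    (hD : IsLeviCivita g₀ D) (hDS : IsSpinConnection P D DS) (hs : SmoothSec m n ⊤ s)
    (hX : g₁.IsKilling (g₁.spinorField s hs)) : IsTwistor P DS s := by
  intro p
  obtain ⟨W, hpW, f, hfs, hfP⟩ := P.local_section p
  have hf : P.IsFrameField W f := ⟨hfs, hfP⟩
  obtain ⟨E, hE, hd⟩ := hf.exists_isDualTuple hDS.smooth
  obtain ⟨x, hx, hxE⟩ := hX.2 W (g₁.isSmall hDS.smooth hf) E
    ⟨E, hE, 1, g₁.one_mem_groupSheaf, (tupleMul_one hd.isHomogeneous).symm⟩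
  rw [g₁.restrict_spinorField, g₁.lieDer_spinorField hDS.smooth hs hf hd] at hxE
  rw [← hd.tupleMul_injective hxE, g₁.funMat_mem_lieTensor] at hx
  obtain ⟨A, _, C, hC, hAC⟩ := hx p hpW
  have hfp := hfP p hpW
  obtain ⟨t, rfl⟩ := g₁.exists_of_mem_oddPart hD hDS hfp hC
  refine ⟨-(f p).2.equivFun.symm t, ?_⟩
  suffices h : ∀ i, DS s p ((f p).1 i) = P.ρ p ((f p).1 i) (-(f p).2.equivFun.symm t) by
    intro v
    have : (DS s p).toLinearMap = (P.ρ p).flip (-(f p).2.equivFun.symm t) := (f p).1.ext h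
    exact LinearMap.congr_fun this v
  intro i
  refine sub_eq_zero.1 ((g₁.nondeg p).1 _ fun w => ?_)
  suffices h : ∀ j, g₁.form p (DS s p ((f p).1 i) - P.ρ p ((f p).1 i) (-(f p).2.equivFun.symm t))
      ((f p).2 j) = 0 by
    rw [← (f p).2.sum_repr w, map_sum]
    exact Finset.sum_eq_zero fun j _ => by rw [map_smul, h j, smul_zero]
  intro j
  have h1 := congrFun (congrFun hAC (Sum.inr j)) (Sum.inl i)
  have h2 := congrFun (congrFun (g₁.bracket_eq_oddMat hfp ((f p).2.equivFun.symm t)) j) i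
  have h3 : (fun a => (f p).2.repr ((f p).2.equivFun.symm t) a) = t :=
    (f p).2.equivFun.apply_symm_apply t
  rw [h3, Matrix.of_apply, g₁.coord_bracket hfp] at h2
  change -g₁.form p (DS s p (dualVec g₀ f i p)) ((f p).2 j) = _ at h1
  rw [Matrix.fromBlocks_apply₂₁, ← h2, dualVec_eq hfp, map_smul, map_smul, LinearMap.smul_apply,
    smul_eq_mul] at h1
  rw [map_neg, sub_neg_eq_add, map_add, LinearMap.add_apply]
  have h4 : Δ.ε i * (g₁.form p (DS s p ((f p).1 i)) ((f p).2 j) +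
      g₁.form p (P.ρ p ((f p).1 i) ((f p).2.equivFun.symm t)) ((f p).2 j)) = 0 := by
    linarith
  exact (mul_eq_zero.1 h4).resolve_left (Δ.ε_ne_zero i)

end Twistor

end

end SpinSuper

theorem mainTheorem2 {m n : ℕ}
    {M : Type*} [TopologicalSpace M] [T2Space M] [SecondCountableTopology M]
    [ChartedSpace (EuclideanSpace ℝ (Fin m)) M] [IsManifold (𝓡 m) ∞ M] [SimplyConnectedSpace M]
    {S : M → Type*} [TopologicalSpace (TotalSpace (EuclideanSpace ℝ (Fin n)) S)]
    [∀ p, TopologicalSpace (S p)] [∀ p, AddCommGroup (S p)] [∀ p, Module ℝ (S p)]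
    [∀ p, IsTopologicalAddGroup (S p)] [∀ p, ContinuousSMul ℝ (S p)]
    [FiberBundle (EuclideanSpace ℝ (Fin n)) S] [VectorBundle ℝ (EuclideanSpace ℝ (Fin n)) S]
    [ContMDiffVectorBundle ∞ (EuclideanSpace ℝ (Fin n)) S (𝓡 m)]
    (Δ : SpinSuper.SpinorModule m n) (g₀ : SpinSuper.PseudoMetric m M)
    (P : SpinSuper.SpinStructure S Δ g₀)
    (D : CovariantDerivative (𝓡 m) (EuclideanSpace ℝ (Fin m))
      (fun p : M => TangentSpace (𝓡 m) p))
    (hD : SpinSuper.IsLeviCivita g₀ D)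
    (DS : CovariantDerivative (𝓡 m) (EuclideanSpace ℝ (Fin n)) S)
    (hDS : SpinSuper.IsSpinConnection P D DS)
    (g₁ g₁' : SpinSuper.SpinorForm P DS)
    (s : ∀ p : M, S p) (hs : SpinSuper.SmoothSec m n ⊤ s)
    (hX : g₁.IsKilling (g₁.spinorField s hs)) :
    g₁'.IsKilling (g₁'.spinorField s hs) ∧ g₁'.IsKilling (g₁.spinorField s hs) :=
  have htw := hX.isTwistor g₁ hD hDS hs
  ⟨htw.isKilling g₁' g₁' hDS.smooth hs, htw.isKilling g₁ g₁' hDS.smooth hs⟩
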